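/- Let $m\in\mathbb C$ with $\operatorname{Re} m>-1$ and let $Q\in L^1_{\mathrm{loc}}]0,\infty[$ be complex-valued with $\int_1^\infty|Q(x)|\,dx<\infty$, and $$\int_0^1x^{1-\max(0,-2\operatorname{Re} m)}|Q(x)|\,dx<\infty\ \text{ if } m\neq0,\qquad \int_0^1x\big(1+|\ln x|^2\big)|Q(x)|\,dx<\infty\ \text{ if } m=0 .$$ For $\operatorname{Re}k\ge0$, $k\ne0$, $x>0$, put $u^0_m(x,k)=(2/k)^m\sqrt x\,I_m(kx)$ and $w^0_m(x,k)=\sqrt{2kx/\pi}\,K_m(kx)$, where $I_m$, $K_m$ are the modified Bessel and Macdonald functions (principal branches), and consider the equation $$-f''+\Big(m^2-\tfrac14\Big)\frac1{x^2}f+Qf=-k^2f,\qquad f\in AC^1]0,\infty[. \tag{1}$$ Then, for every $k\neq0$ with $\operatorname{Re}k\ge0$: (a) (1) has a unique solution $u_m(\cdot,k)$ with $u_m-u_m^0=o(x^{\frac12+|\operatorname{Re}m|})$ and $\partial_xu_m-\partial_xu_m^0=o(x^{-\frac12+|\operatorname{Re}m|})$ as $x\to0$, and a unique solution $w_m(\cdot,k)$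 with $w_m-w_m^0=o(e^{-x\operatorname{Re}k})$ and $\partial_xw_m-\partial_xw_m^0=o(e^{-x\operatorname{Re}k})$ as $x\to\infty$. (b) With $v_m(x,k):=\sqrt{\tfrac{\pi}{2k}}\,(k/2)^m\,w_m(x,k)$, the Wronskian $v_m\,\partial_xu_m-\partial_xv_m\,u_m$ does not depend on $x>0$; its value is denoted $\mathscr W_m(k)$ (the Jost function). Moreover $u_m^0(\cdot,k)\,Q\,v_m(\cdot,k)\in L^1]0,\infty[$ and $$\mathscr W_m(k)=1+\int_0^\infty u_m^0(x,k)\,Q(x)\,v_m(x,k)\,dx .$$ Furthermore, $$\lim_{|k|\to\infty,\ \operatorname{Re}k\ge0}\mathscr W_m(k)=1,$$ and therefore the set $\{k\in\mathbb C:\operatorname{Re}k>0,\ \mathscr W_m(k)=0\}$ is discrete, with no accumulation point in the open half-plane $\{\operatorname{Re}k>0\}$. -/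

import Mathlib

open MeasureTheory Set Filter Asymptotics Topology

noncomputable section

namespace PerturbedBessel

/-! Potentials on the half-line `]0,∞[`.  Functions on `]0,∞[` are functions `ℝ → ℂ`, of which
only the values on `Ioi 0` matter. -/

/-- `Q ∈ L¹_loc ]0,∞[`. -/
def MemL1Loc (Q : ℝ → ℂ) : Prop :=
  LocallyIntegrableOn Q (Ioi 0) volume

/-- `Q ∈ 𝓛^{(0)}_ε`: `Q ∈ L¹_loc ]0,∞[` and `∫₀¹ x^{1-ε} |Q(x)| dx < ∞`. -/
def MemLZero (ε : ℝ) (Q : ℝ → ℂ) : Prop :=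
  MemL1Loc Q ∧ IntegrableOn (fun x : ℝ => x ^ (1 - ε) * ‖Q x‖) (Ioo 0 1) volume

/-- `Q ∈ 𝓛^{(0)}_{ε,ln^β}`: `Q ∈ L¹_loc ]0,∞[` and
`∫₀¹ x^{1-ε} (1 + |ln x|^β) |Q(x)| dx < ∞`. -/
def MemLZeroLog (ε β : ℝ) (Q : ℝ → ℂ) : Prop :=
  MemL1Loc Q ∧
    IntegrableOn (fun x : ℝ => x ^ (1 - ε) * (1 + |Real.log x| ^ β) * ‖Q x‖) (Ioo 0 1) volume

/-- `Q ∈ 𝓛^{(∞)}_δ`: `Q ∈ L¹_loc ]0,∞[` and `∫₁^∞ x^δ |Q(x)| dx < ∞`. -/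
def MemLInfty (δ : ℝ) (Q : ℝ → ℂ) : Prop :=
  MemL1Loc Q ∧ IntegrableOn (fun x : ℝ => x ^ δ * ‖Q x‖) (Ioi 1) volume

/-! Absolutely continuous functions and solutions of the eigenequation. -/

/-- `f` is absolutely continuous on `]0,∞[` (locally), with derivative `g ∈ L¹_loc ]0,∞[`. -/
def HasACDeriv (f g : ℝ → ℂ) : Prop :=
  LocallyIntegrableOn g (Ioi 0) volume ∧
    ∀ a b : ℝ, 0 < a → 0 < b → f b - f a = ∫ x in a..b, g x

/-- `f ∈ AC¹ ]0,∞[` and `L_{m²} f = -k² f`, where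
`L_{m²} = -∂ₓ² + (m² - 1/4) / x² + Q(x)`; here `g = f'` and `h = f''`. -/
def IsEigensolution (Q : ℝ → ℂ) (m k : ℂ) (f : ℝ → ℂ) : Prop :=
  ∃ g h : ℝ → ℂ, HasACDeriv f g ∧ HasACDeriv g h ∧
    ∀ᵐ x ∂(volume.restrict (Ioi (0 : ℝ))),
      -h x + (m ^ 2 - 1 / 4) / (x : ℂ) ^ 2 * f x + Q x * f x = -k ^ 2 * f x

/-- The Wronskian `𝓦(f,g;x) = f(x) g'(x) - f'(x) g(x)`. -/
def wronskian (f g : ℝ → ℂ) (x : ℝ) : ℂ :=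
  f x * deriv g x - deriv f x * g x

/-! The unperturbed solutions.  All powers are principal; they are only used in the closed right
half-plane without `0`. -/

/-- The hyperbolic 1d Bessel function
`𝓘_m(z) = ∑ₙ √π (z/2)^{2n+m+1/2} / (n! Γ(m+n+1)) = √(πz/2) I_m(z)`. -/
def besselI (m z : ℂ) : ℂ :=
  ∑' n : ℕ, (Real.sqrt Real.pi : ℂ) * (z / 2) ^ (2 * (n : ℂ) + m + 1 / 2) /
    ((Nat.factorial n : ℂ) * Complex.Gamma (m + n + 1))

/-- The integral representation, for `Re z > 0`, of the 1d Macdonald function: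
`√z / √(2π) ∫₀^∞ exp(-(z/2)(s + s⁻¹)) s^{-m-1} ds`. -/
def macdonaldIntegral (m z : ℂ) : ℂ :=
  z ^ (1 / 2 : ℂ) / (Real.sqrt (2 * Real.pi) : ℂ) *
    ∫ s in Ioi (0 : ℝ), Complex.exp (-(z / 2) * ((s : ℂ) + (s : ℂ)⁻¹)) * (s : ℂ) ^ (-m - 1)

/-- The 1d Macdonald function `𝓚_m(z) = √(2z/π) K_m(z)` for `Re z ≥ 0`, `z ≠ 0`: the integral
representation on `Re z > 0`, extended by continuity to the imaginary axis (where the integral does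
not converge absolutely). -/
def macdonaldK (m : ℂ) : ℂ → ℂ :=
  extendFrom {z : ℂ | 0 < z.re} (macdonaldIntegral m)

/-- `u⁰_m(x,k) = √(2/(πk)) (2/k)^m 𝓘_m(kx)`, for `Re k ≥ 0`, `k ≠ 0`. -/
def u0 (m k : ℂ) (x : ℝ) : ℂ :=
  (2 / (Real.pi * k)) ^ (1 / 2 : ℂ) * (2 / k) ^ m * besselI m (k * x)

/-- `w⁰_m(x,k) = 𝓚_m(kx)`, for `Re k ≥ 0`, `k ≠ 0`. -/
def w0 (m k : ℂ) (x : ℝ) : ℂ :=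
  macdonaldK m (k * x)

/-! The distinguished perturbed solutions. -/

/-- `g` is the solution `u_m(·,k)` with prescribed behavior at `0`. -/
def IsRegularSolution (Q : ℝ → ℂ) (m k : ℂ) (g : ℝ → ℂ) : Prop :=
  IsEigensolution Q m k g ∧
    (fun x => g x - u0 m k x) =o[𝓝[>] (0 : ℝ)] (fun x : ℝ => x ^ (1 / 2 + |m.re|)) ∧
    (fun x => deriv g x - deriv (u0 m k) x) =o[𝓝[>] (0 : ℝ)]
      (fun x : ℝ => x ^ (-(1 / 2) + |m.re|))

/-- `g` is the Jost solution `w_m(·,k)` with prescribed behavior at `∞`. -/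
def IsJostSolution (Q : ℝ → ℂ) (m k : ℂ) (g : ℝ → ℂ) : Prop :=
  IsEigensolution Q m k g ∧
    (fun x => g x - w0 m k x) =o[atTop] (fun x : ℝ => Real.exp (-x * k.re)) ∧
    (fun x => deriv g x - deriv (w0 m k) x) =o[atTop] (fun x : ℝ => Real.exp (-x * k.re))

/-- The solution `u_m(·,k)`. -/
def uSol (Q : ℝ → ℂ) (m k : ℂ) : ℝ → ℂ :=
  Classical.epsilon (IsRegularSolution Q m k)

/-- The Jost solution `w_m(·,k)`. -/
def wSol (Q : ℝ → ℂ) (m k : ℂ) : ℝ → ℂ :=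
  Classical.epsilon (IsJostSolution Q m k)

/-- `v_m(x,k) = √(π/(2k)) (k/2)^m w_m(x,k)`. -/
def vSol (Q : ℝ → ℂ) (m k : ℂ) (x : ℝ) : ℂ :=
  (Real.pi / (2 * k)) ^ (1 / 2 : ℂ) * (k / 2) ^ m * wSol Q m k x

/-- The Jost function `𝓦_m(k) = 𝓦(v_m(·,k), u_m(·,k))`. The Wronskian of two solutions does not
depend on the point, so that any point may be chosen; we take `x = 1`. -/
def jostFunction (Q : ℝ → ℂ) (m k : ℂ) : ℂ :=
  wronskian (vSol Q m k) (uSol Q m k) 1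

end PerturbedBessel

end

noncomputable section

namespace PerturbedBessel

/-! ### Calculus of absolutely continuous functions on the half-line -/

/-! The equation is treated as a perturbation of the Bessel equation by `Q`, through Volterra
equations at both endpoints. Let μ = ±m with Re μ ≥ 0. The unperturbed solutions u = `besselI μ
(kx)`, recessive at 0, and v = k⁻¹ `macdonaldK μ (kx)`, recessive at ∞, have Wronskian 1. If
positive weights U, V dominate u, v and U/V is nondecreasing, the kernel u(x)v(y) - v(x)u(y) with y
≤ x is at most 2U(x)V(y). The Volterra operators at ∞ and at 0 are then controlled, in norms
weighted by V and by a suitable W ≥ U, by one integrable function ψ ≥ 2VW|Q|. The factor exp(2∫ψ) in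
the norm makes them contractions with constant 1/2, however large ∫ψ is
(`integral_mul_exp_primitive_le`), so the Neumann series converge with explicit bounds and solve the
equation (`VolterraData.isSol`). The remainders carry integrals of ψ near the endpoint, which yields
the prescribed asymptotics. Uniqueness follows from variation of constants and a Grönwall
inequality.

The weights require bounds on the Bessel functions that are uniform on the closed half-plane. For
large arguments the same Volterra estimates apply along each ray, with exponentials as base and (m²
- 1/4)/x² as perturbation; the constants do not depend on the direction, so the bounds reach the
imaginary axis. For small arguments the power series handles I, while for K the base is x^{1/2±m}
and the spectral term is the perturbation. These bounds also show that K, its differential system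
and the Wronskian identity `macdonaldK_wronskian` extend to the imaginary axis.

In the product VW the exponentials cancel, and `scaleWeight m ‖k‖ x` is left. At ‖k‖ = 1 its
integrability against |Q| follows from the hypotheses. For ‖k‖ bounded below it is dominated by a
multiple of that case, and it tends to 0 pointwise as ‖k‖ → ∞.

For the Jost function (`Perturbation.wronskian_formula`), the Wronskian of the Jost solution f with
the unperturbed u⁰ has an explicit limit at ∞ and changes by the integral of u⁰Qf on the way to 0;
replacing u⁰ by the perturbed regular solution costs nothing in the limit x → 0. The representation
gives |𝓦 - 1| ≤ J exp(2J) with J = ∫ψ, and J → 0 by dominated convergence. Every Neumann iterate is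
holomorphic in k and the series converges locally uniformly, so 𝓦 is holomorphic for Re k > 0. It is
not identically zero because of its limit 1, hence its zeros are isolated. -/

lemma uIcc_subset_Ioi_zero {a b : ℝ} (ha : 0 < a) (hb : 0 < b) : uIcc a b ⊆ Ioi 0 := by
  intro x hx
  exact lt_of_lt_of_le (lt_min ha hb) hx.1

lemma intervalIntegrable_of_locallyIntegrableOn {f : ℝ → ℂ}
    (hf : LocallyIntegrableOn f (Ioi 0) volume) {a b : ℝ} (ha : 0 < a) (hb : 0 < b) :
    IntervalIntegrable f volume a b := by
  rw [intervalIntegrable_iff]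
  exact (hf.integrableOn_compact_subset (uIcc_subset_Ioi_zero ha hb) isCompact_uIcc).mono_set
    uIoc_subset_uIcc

lemma absolutelyContinuousOnInterval_const (c : ℂ) (a b : ℝ) :
    AbsolutelyContinuousOnInterval (fun _ : ℝ => c) a b :=
  LipschitzOnWith.absolutelyContinuousOnInterval (K := 0)
    (LipschitzWith.const c).lipschitzOnWith

/-- The real and imaginary parts are real integrals, which are absolutely continuous, and they are
recombined with the constants 1 and i. -/
lemma absolutelyContinuousOnInterval_integral {f : ℝ → ℂ} {a b : ℝ}
    (hf : IntervalIntegrable f volume a b) :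
    AbsolutelyContinuousOnInterval (fun x ↦ ∫ v in a..x, f v) a b := by
  have hre : IntervalIntegrable (fun x => (f x).re) volume a b := by
    rw [intervalIntegrable_iff] at hf ⊢; exact hf.re
  have him : IntervalIntegrable (fun x => (f x).im) volume a b := by
    rw [intervalIntegrable_iff] at hf ⊢; exact hf.im
  have h1 := (hre.absolutelyContinuousOnInterval_intervalIntegral (c := a) (by simp)).fun_smul
    (absolutelyContinuousOnInterval_const 1 a b)
  have h2 := (him.absolutelyContinuousOnInterval_intervalIntegral (c := a) (by simp)).fun_smul
    (absolutelyContinuousOnInterval_const Complex.I a b)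
  have h3 := h1.fun_add h2
  rw [absolutelyContinuousOnInterval_iff] at h3 ⊢
  intro ε hε
  obtain ⟨δ, hδ, h⟩ := h3 ε hε
  refine ⟨δ, hδ, fun E hE hlen => ?_⟩
  refine lt_of_eq_of_lt (Finset.sum_congr rfl fun i hi => ?_) (h E hE hlen)
  have key : ∀ x ∈ uIcc a b, ∫ v in a..x, f v =
      (∫ v in a..x, (f v).re) • (1 : ℂ) + (∫ v in a..x, (f v).im) • Complex.I := by
    intro x hx
    have hfx : IntervalIntegrable f volume a x :=
      hf.mono_set (uIcc_subset_uIcc left_mem_uIcc hx)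
    apply Complex.ext
    · have := Complex.reCLM.intervalIntegral_comp_comm hfx
      simpa using this.symm
    · have := Complex.imCLM.intervalIntegral_comp_comm hfx
      simpa using this.symm
  rw [key _ (hE.1 i hi).1, key _ (hE.1 i hi).2]

lemma HasACDeriv.absolutelyContinuousOnInterval {f g : ℝ → ℂ} (h : HasACDeriv f g) {a b : ℝ}
    (ha : 0 < a) (hb : 0 < b) : AbsolutelyContinuousOnInterval f a b := by
  have h1 := (absolutelyContinuousOnInterval_const (f a) a b).fun_add
    (absolutelyContinuousOnInterval_integral (intervalIntegrable_of_locallyIntegrableOn h.1 ha hb))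
  rw [absolutelyContinuousOnInterval_iff] at h1 ⊢
  intro ε hε
  obtain ⟨δ, hδ, h'⟩ := h1 ε hε
  refine ⟨δ, hδ, fun E hE hlen => ?_⟩
  refine lt_of_eq_of_lt (Finset.sum_congr rfl fun i hi => ?_) (h' E hE hlen)
  have key : ∀ x ∈ uIcc a b, f x = f a + ∫ v in a..x, g v := by
    intro x hx
    rw [← h.2 a x ha (uIcc_subset_Ioi_zero ha hb hx)]; ring
  rw [← key _ (hE.1 i hi).1, ← key _ (hE.1 i hi).2]

lemma HasACDeriv.continuousOn {f g : ℝ → ℂ} (h : HasACDeriv f g) : ContinuousOn f (Ioi 0) := by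
  intro x hx
  have hx' : (0 : ℝ) < x := hx
  have hc := (h.absolutelyContinuousOnInterval (a := x / 2) (b := x + 1) (by positivity)
    (by positivity)).continuousOn
  refine (hc.continuousAt ?_).continuousWithinAt
  rw [uIcc_of_le (by linarith)]
  exact Icc_mem_nhds (by linarith) (by linarith)

lemma HasACDeriv.ae_hasDerivAt {f g : ℝ → ℂ} (h : HasACDeriv f g) {a b : ℝ}
    (ha : 0 < a) (hb : 0 < b) : ∀ᵐ x, x ∈ uIcc a b → HasDerivAt f (g x) x := by
  filter_upwards [(intervalIntegrable_of_locallyIntegrableOn h.1 ha hb).ae_hasDerivAt_integral]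
    with x hx hxab
  have hx0 : 0 < x := uIcc_subset_Ioi_zero ha hb hxab
  have h1 := (hx hxab a left_mem_uIcc).const_add (f a)
  refine h1.congr_of_eventuallyEq ?_
  filter_upwards [Ioi_mem_nhds hx0] with y hy
  rw [← h.2 a y ha hy]; ring

/-- Subtracting the primitive of `g` leaves an absolutely continuous function with almost everywhere
vanishing derivative, hence a constant. This converse transfers pointwise rules, in particular the
product rule, to `HasACDeriv`. -/
lemma hasACDeriv_of_ae_hasDerivAt {f g : ℝ → ℂ} (hg : LocallyIntegrableOn g (Ioi 0) volume)
    (hf : ∀ a b : ℝ, 0 < a → 0 < b → AbsolutelyContinuousOnInterval f a b)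
    (hd : ∀ a b : ℝ, 0 < a → 0 < b → ∀ᵐ x, x ∈ uIcc a b → HasDerivAt f (g x) x) :
    HasACDeriv f g := by
  refine ⟨hg, fun a b ha hb => ?_⟩
  have hi := intervalIntegrable_of_locallyIntegrableOn hg ha hb
  have h1 := (hf a b ha hb).fun_sub (absolutelyContinuousOnInterval_integral hi)
  obtain ⟨C, hC⟩ := h1.const_of_ae_hasDerivAt_zero (by
    filter_upwards [hd a b ha hb, hi.ae_hasDerivAt_integral] with x h2 h3 hx
    simpa using (h2 hx).fun_sub (h3 hx a left_mem_uIcc))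
  have ha' := hC a left_mem_uIcc
  have hb' := hC b right_mem_uIcc
  simp only [intervalIntegral.integral_same, sub_zero] at ha'
  rw [ha', ← hb']; ring

lemma locallyIntegrableOn_mul_continuousOn {f g : ℝ → ℂ}
    (hf : LocallyIntegrableOn f (Ioi 0) volume) (hg : ContinuousOn g (Ioi 0)) :
    LocallyIntegrableOn (fun x => f x * g x) (Ioi 0) volume :=
  hf.mul_continuousOn hg isOpen_Ioi.isLocallyClosed

lemma locallyIntegrableOn_continuousOn_mul {f g : ℝ → ℂ}
    (hf : ContinuousOn f (Ioi 0)) (hg : LocallyIntegrableOn g (Ioi 0) volume) :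
    LocallyIntegrableOn (fun x => f x * g x) (Ioi 0) volume :=
  hg.continuousOn_mul hf isOpen_Ioi.isLocallyClosed

lemma HasACDeriv.mul {f f' g g' : ℝ → ℂ} (hf : HasACDeriv f f') (hg : HasACDeriv g g') :
    HasACDeriv (fun x => f x * g x) (fun x => f' x * g x + f x * g' x) := by
  refine hasACDeriv_of_ae_hasDerivAt ?_ ?_ ?_
  · exact (locallyIntegrableOn_mul_continuousOn hf.1 hg.continuousOn).add
      (locallyIntegrableOn_continuousOn_mul hf.continuousOn hg.1)
  · intro a b ha hb
    exact (hf.absolutelyContinuousOnInterval ha hb).fun_smul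
      (hg.absolutelyContinuousOnInterval ha hb)
  · intro a b ha hb
    filter_upwards [hf.ae_hasDerivAt ha hb, hg.ae_hasDerivAt ha hb] with x h1 h2 hx
    exact (h1 hx).mul (h2 hx)

lemma HasACDeriv.add {f f' g g' : ℝ → ℂ} (hf : HasACDeriv f f') (hg : HasACDeriv g g') :
    HasACDeriv (fun x => f x + g x) (fun x => f' x + g' x) := by
  refine ⟨hf.1.add hg.1, fun a b ha hb => ?_⟩
  rw [intervalIntegral.integral_add (intervalIntegrable_of_locallyIntegrableOn hf.1 ha hb)
    (intervalIntegrable_of_locallyIntegrableOn hg.1 ha hb), ← hf.2 a b ha hb, ← hg.2 a b ha hb]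
  ring

lemma HasACDeriv.neg {f f' : ℝ → ℂ} (hf : HasACDeriv f f') :
    HasACDeriv (fun x => -f x) (fun x => -f' x) := by
  refine ⟨hf.1.neg, fun a b ha hb => ?_⟩
  rw [intervalIntegral.integral_neg, ← hf.2 a b ha hb]
  ring

lemma HasACDeriv.sub {f f' g g' : ℝ → ℂ} (hf : HasACDeriv f f') (hg : HasACDeriv g g') :
    HasACDeriv (fun x => f x - g x) (fun x => f' x - g' x) := by
  simpa only [sub_eq_add_neg] using hf.add hg.neg

lemma HasACDeriv.congr {f f' g g' : ℝ → ℂ} (hf : HasACDeriv f f') (h : EqOn g f (Ioi 0))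
    (h' : ∀ᵐ x ∂(volume.restrict (Ioi (0 : ℝ))), g' x = f' x) : HasACDeriv g g' := by
  have h'' : f' =ᵐ[volume.restrict (Ioi (0 : ℝ))] g' := by
    filter_upwards [h'] with x hx using hx.symm
  refine ⟨?_, fun a b ha hb => ?_⟩
  · rw [locallyIntegrableOn_iff isOpen_Ioi.isLocallyClosed] at *
    intro K hK hKc
    exact (((locallyIntegrableOn_iff isOpen_Ioi.isLocallyClosed).1 hf.1) K hK hKc).congr
      (ae_restrict_of_ae_restrict_of_subset hK h'')
  · rw [h hb, h ha, hf.2 a b ha hb]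
    apply intervalIntegral.integral_congr_ae
    rw [ae_restrict_iff' measurableSet_Ioi] at h'
    filter_upwards [h'] with x hx hxab
    exact (hx (uIcc_subset_Ioi_zero ha hb (uIoc_subset_uIcc hxab))).symm

lemma hasACDeriv_of_hasDerivAt {f g : ℝ → ℂ} (h : ∀ x, 0 < x → HasDerivAt f (g x) x)
    (hg : ContinuousOn g (Ioi 0)) : HasACDeriv f g := by
  refine ⟨hg.locallyIntegrableOn measurableSet_Ioi, fun a b ha hb => ?_⟩
  rw [intervalIntegral.integral_eq_sub_of_hasDerivAt
    (fun x hx => h x (uIcc_subset_Ioi_zero ha hb hx))]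
  exact (hg.mono (uIcc_subset_Ioi_zero ha hb)).intervalIntegrable

/-- For solutions of a second order equation the first derivative is itself absolutely continuous,
so this applies at every point and identifies `deriv f` with the function supplied by the equation.
-/
lemma HasACDeriv.hasDerivAt {f g : ℝ → ℂ} (h : HasACDeriv f g) (hg : ContinuousOn g (Ioi 0))
    {x : ℝ} (hx : 0 < x) : HasDerivAt f (g x) x := by
  have h1 : HasDerivAt (fun y => ∫ t in x..y, g t) (g x) x := by
    apply intervalIntegral.integral_hasDerivAt_right
    · simp
    · exact hg.stronglyMeasurableAtFilter isOpen_Ioi _ hx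
    · exact hg.continuousAt (Ioi_mem_nhds hx)
  refine (h1.const_add (f x)).congr_of_eventuallyEq ?_
  filter_upwards [Ioi_mem_nhds hx] with y hy
  rw [← h.2 x y hx hy]; ring

lemma HasACDeriv.eq_of_ae_zero {f g : ℝ → ℂ} (h : HasACDeriv f g)
    (h0 : ∀ᵐ x ∂(volume.restrict (Ioi (0 : ℝ))), g x = 0) {x y : ℝ} (hx : 0 < x) (hy : 0 < y) :
    f x = f y := by
  rw [← sub_eq_zero, h.2 y x hy hx]
  rw [ae_restrict_iff' measurableSet_Ioi] at h0
  rw [intervalIntegral.integral_congr_ae (g := fun _ => 0)]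
  · simp
  · filter_upwards [h0] with t ht htab
    exact ht (uIcc_subset_Ioi_zero hy hx (uIoc_subset_uIcc htab))

lemma locallyIntegrableOn_of_forall_Ioi {h : ℝ → ℂ}
    (hi : ∀ x, 0 < x → IntegrableOn h (Ioi x) volume) :
    LocallyIntegrableOn h (Ioi 0) volume := by
  intro x hx
  have hx' : (0 : ℝ) < x := hx
  exact ⟨Ioi (x / 2), mem_nhdsWithin_of_mem_nhds (Ioi_mem_nhds (by linarith)),
    hi _ (by positivity)⟩

lemma locallyIntegrableOn_of_forall_Ioc {h : ℝ → ℂ}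
    (hi : ∀ x, 0 < x → IntegrableOn h (Ioc 0 x) volume) :
    LocallyIntegrableOn h (Ioi 0) volume := by
  intro x hx
  have hx' : (0 : ℝ) < x := hx
  exact ⟨Ioc 0 (x + 1), mem_nhdsWithin_of_mem_nhds (Ioc_mem_nhds hx' (by linarith)),
    hi _ (by positivity)⟩

lemma hasACDeriv_integral_Ioi {h : ℝ → ℂ} (hi : ∀ x, 0 < x → IntegrableOn h (Ioi x) volume) :
    HasACDeriv (fun x => ∫ t in Ioi x, h t) (fun x => -h x) := by
  refine ⟨(locallyIntegrableOn_of_forall_Ioi hi).neg, fun a b ha hb => ?_⟩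
  rw [intervalIntegral.integral_neg]
  have := intervalIntegral.integral_Ioi_sub_Ioi' (hi a ha) (hi b hb)
  rw [← this]; ring

lemma hasACDeriv_integral_Ioc {h : ℝ → ℂ} (hi : ∀ x, 0 < x → IntegrableOn h (Ioc 0 x) volume) :
    HasACDeriv (fun x => ∫ t in Ioc 0 x, h t) h := by
  refine ⟨locallyIntegrableOn_of_forall_Ioc hi, fun a b ha hb => ?_⟩
  simp only
  rw [← intervalIntegral.integral_of_le ha.le, ← intervalIntegral.integral_of_le hb.le]
  apply intervalIntegral.integral_interval_sub_left
  · exact (intervalIntegrable_iff_integrableOn_Ioc_of_le hb.le).2 (hi b hb)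
  · exact (intervalIntegrable_iff_integrableOn_Ioc_of_le ha.le).2 (hi a ha)

lemma tendsto_integral_Ioi_atTop {E : Type*} [NormedAddCommGroup E] [NormedSpace ℝ E] {h : ℝ → E}
    {a : ℝ} (hi : IntegrableOn h (Ioi a) volume) :
    Tendsto (fun x => ∫ t in Ioi x, h t) atTop (𝓝 0) := by
  have h1 := intervalIntegral_tendsto_integral_Ioi a hi tendsto_id
  have h2 := (tendsto_const_nhds (x := ∫ t in Ioi a, h t)).sub h1
  simp only [sub_self, id] at h2
  refine h2.congr' ?_
  filter_upwards [eventually_ge_atTop a] with x hx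
  have := intervalIntegral.integral_Ioi_sub_Ioi hi hx
  rw [← this]; abel

lemma tendsto_integral_Ioc_zero {E : Type*} [NormedAddCommGroup E] [NormedSpace ℝ E] {h : ℝ → E}
    {a : ℝ} (ha : 0 < a) (hi : IntegrableOn h (Ioc 0 a) volume) :
    Tendsto (fun x => ∫ t in Ioc 0 x, h t) (𝓝[>] 0) (𝓝 0) := by
  have h1 := intervalIntegral.continuousWithinAt_primitive (μ := volume) (f := h) (a := 0)
    (b₀ := 0) (b₁ := 0) (b₂ := a) (by simp) (by simpa [ha.le] using
      (intervalIntegrable_iff_integrableOn_Ioc_of_le ha.le).2 hi)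
  have h2 : Tendsto (fun b => ∫ x in (0:ℝ)..b, h x) (𝓝[Icc 0 a] 0) (𝓝 0) := by
    simpa [ContinuousWithinAt] using h1
  have h3 : Tendsto (fun b => ∫ x in (0:ℝ)..b, h x) (𝓝[>] 0) (𝓝 0) := by
    refine h2.mono_left (nhdsWithin_le_iff.2 ?_)
    filter_upwards [Ioc_mem_nhdsGT ha] with x hx using ⟨hx.1.le, hx.2⟩
  refine h3.congr' ?_
  filter_upwards [self_mem_nhdsWithin] with x hx
  rw [intervalIntegral.integral_of_le (le_of_lt hx)]

lemma HasACDeriv.integral_Ioi {f g : ℝ → ℂ} (h : HasACDeriv f g) {x : ℝ} (hx : 0 < x)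
    (hi : IntegrableOn g (Ioi x) volume) {l : ℂ} (hl : Tendsto f atTop (𝓝 l)) :
    ∫ t in Ioi x, g t = l - f x := by
  have h1 := intervalIntegral_tendsto_integral_Ioi x hi tendsto_id
  refine tendsto_nhds_unique h1 ((hl.sub_const (f x)).congr' ?_)
  filter_upwards [eventually_gt_atTop 0] with y hy
  exact h.2 x y hx hy

lemma HasACDeriv.integral_Ioc {f g : ℝ → ℂ} (h : HasACDeriv f g) {x : ℝ} (hx : 0 < x)
    (hi : IntegrableOn g (Ioc 0 x) volume) {l : ℂ} (hl : Tendsto f (𝓝[>] 0) (𝓝 l)) :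
    ∫ t in Ioc 0 x, g t = f x - l := by
  have h1 := tendsto_integral_Ioc_zero hx hi
  have h2 : Tendsto (fun y => (∫ t in Ioc 0 x, g t) - ∫ t in Ioc 0 y, g t) (𝓝[>] 0)
      (𝓝 ((∫ t in Ioc 0 x, g t) - 0)) := tendsto_const_nhds.sub h1
  rw [sub_zero] at h2
  refine tendsto_nhds_unique h2 ((hl.const_sub (f x)).congr' ?_)
  filter_upwards [Ioo_mem_nhdsGT hx] with y hy
  rw [h.2 y x hy.1 hx, intervalIntegral.integral_of_le hy.2.le, ← Ioc_union_Ioc_eq_Ioc hy.1.le hy.2.le,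
    setIntegral_union (Ioc_disjoint_Ioc_of_le le_rfl) measurableSet_Ioc
      (hi.mono_set (Ioc_subset_Ioc_right hy.2.le)) (hi.mono_set (Ioc_subset_Ioc_left hy.1.le))]
  ring

/-! ### Volterra equations -/

/-- A weight `E` making the Volterra operator with kernel dominated by `ψ`, integrating over
`S x ⊆ T`, a contraction with constant `1 / 2`. -/
structure VolterraWeight (T : Set ℝ) (S : ℝ → Set ℝ) (ψ E : ℝ → ℝ) (B : ℝ) : Prop where
  subset : ∀ x ∈ T, S x ⊆ T
  meas : ∀ x ∈ T, MeasurableSet (S x)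
  nonneg : ∀ x ∈ T, 0 ≤ ψ x
  one_le : ∀ x, 1 ≤ E x
  le_bound : ∀ x, E x ≤ B
  integrable : ∀ x ∈ T, IntegrableOn (fun y => ψ y * E y) (S x) volume
  integral_le : ∀ x ∈ T, ∫ y in S x, ψ y * E y ≤ E x / 2

/-- With M the primitive of ψ, the derivative of exp(2M) is 2ψ exp(2M) almost everywhere. Only an
inequality is needed, and for a monotone function the integral of the almost everywhere derivative
never exceeds the increment, so absolute continuity of exp(2M) plays no role. -/
lemma integral_mul_exp_primitive_le {ψ : ℝ → ℝ} (hψ : Integrable ψ) (h0 : ∀ x, 0 ≤ ψ x) :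
    (∀ x, 1 ≤ Real.exp (2 * ∫ t in Iic x, ψ t)) ∧
    (∀ x, Real.exp (2 * ∫ t in Iic x, ψ t) ≤ Real.exp (2 * ∫ t, ψ t)) ∧
    Integrable (fun y => ψ y * Real.exp (2 * ∫ t in Iic y, ψ t)) ∧
    ∀ x, ∫ y in Iic x, ψ y * Real.exp (2 * ∫ t in Iic y, ψ t) ≤
      Real.exp (2 * ∫ t in Iic x, ψ t) / 2 := by
  have hM0 : ∀ x, 0 ≤ ∫ t in Iic x, ψ t := fun x => setIntegral_nonneg measurableSet_Iic
    fun y _ => h0 y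
  have hM1 : ∀ x, ∫ t in Iic x, ψ t ≤ ∫ t, ψ t := fun x =>
    setIntegral_le_integral hψ (Eventually.of_forall h0)
  have hmono : Monotone fun x => ∫ t in Iic x, ψ t := fun x y hxy =>
    setIntegral_mono_set hψ.integrableOn (Eventually.of_forall h0)
      (Iic_subset_Iic.2 hxy).eventuallyLE
  set E : ℝ → ℝ := fun x => Real.exp (2 * ∫ t in Iic x, ψ t) with hE
  have hEmono : Monotone E := fun x y hxy => by
    apply Real.exp_le_exp.2; have := hmono hxy; simp only at this; linarith
  have hEle : ∀ x, E x ≤ Real.exp (2 * ∫ t, ψ t) := fun x => by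
    apply Real.exp_le_exp.2; linarith [hM1 x]
  have hint : Integrable (fun y => ψ y * E y) := by
    refine hψ.mul_bdd (c := Real.exp (2 * ∫ t, ψ t)) hEmono.measurable.aestronglyMeasurable ?_
    filter_upwards with x
    rw [Real.norm_of_nonneg (Real.exp_pos _).le]
    exact hEle x
  refine ⟨fun x => Real.one_le_exp (by linarith [hM0 x]), hEle, hint, fun x => ?_⟩
  have key : ∀ a, a ≤ x → ∫ y in a..x, ψ y * E y ≤ E x / 2 := by
    intro a hax
    have h1 := (hEmono.monotoneOn (uIcc a x)).intervalIntegral_deriv_mem_uIcc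
    have h2 : ∫ y in a..x, deriv E y = ∫ y in a..x, 2 * (ψ y * E y) := by
      apply intervalIntegral.integral_congr_ae
      filter_upwards [hψ.intervalIntegrable (a := a) (b := x) |>.ae_hasDerivAt_integral]
        with y hy hyax
      have h3 := hy (uIoc_subset_uIcc hyax) a left_mem_uIcc
      have h4 : HasDerivAt (fun x => ∫ t in Iic x, ψ t) (ψ y) y := by
        refine (h3.const_add (∫ t in Iic a, ψ t)).congr_of_eventuallyEq
          (Eventually.of_forall fun z => ?_)
        have := intervalIntegral.integral_Iic_sub_Iic (hψ.integrableOn (s := Iic a))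
          (hψ.integrableOn (s := Iic z))
        simp only
        rw [← this]; ring
      have h5 := (h4.const_mul 2).exp
      rw [h5.deriv]
      simp only [hE]; ring
    rw [h2, intervalIntegral.integral_const_mul] at h1
    have h6 : E a ≤ E x := hEmono hax
    rw [uIcc_of_le (by linarith)] at h1
    have h7 : 0 ≤ E a := (Real.exp_pos _).le
    linarith [h1.2]
  refine le_of_tendsto (intervalIntegral_tendsto_integral_Iic x hint.integrableOn tendsto_id) ?_
  filter_upwards [eventually_le_atBot x] with a ha using key a ha

lemma exists_volterraWeight_left {T : Set ℝ} (hT : MeasurableSet T) {S : ℝ → Set ℝ} {ψ : ℝ → ℝ}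
    (hS : ∀ x ∈ T, S x = T ∩ Iic x) (hψ : IntegrableOn ψ T volume) (h0 : ∀ x ∈ T, 0 ≤ ψ x) :
    ∃ E, VolterraWeight T S ψ E (Real.exp (2 * ∫ t in T, ψ t)) := by
  have hi : Integrable (T.indicator ψ) := (integrable_indicator_iff hT).2 hψ
  obtain ⟨h1, h2, h3, h4⟩ := integral_mul_exp_primitive_le hi
    (fun x => indicator_nonneg h0 x)
  have heq : ∀ x ∈ T, ∫ y in S x, ψ y * Real.exp (2 * ∫ t in Iic y, T.indicator ψ t) =
      ∫ y in Iic x, T.indicator ψ y * Real.exp (2 * ∫ t in Iic y, T.indicator ψ t) := by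
    intro x hx
    rw [hS x hx, inter_comm, ← setIntegral_indicator hT]
    refine setIntegral_congr_fun measurableSet_Iic fun y _ => ?_
    by_cases hy : y ∈ T <;> simp [hy]
  refine ⟨fun x => Real.exp (2 * ∫ t in Iic x, T.indicator ψ t), ?_, ?_, h0, h1, ?_, ?_, ?_⟩
  · intro x hx; rw [hS x hx]; exact inter_subset_left
  · intro x hx; rw [hS x hx]; exact hT.inter measurableSet_Iic
  · intro x; rw [← integral_indicator hT]; exact h2 x
  · intro x hx
    refine (h3.integrableOn (s := S x)).congr_fun (fun y hy => ?_)
      (by rw [hS x hx]; exact hT.inter measurableSet_Iic)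
    have : y ∈ T := by rw [hS x hx] at hy; exact hy.1
    simp [this]
  · intro x hx
    rw [heq x hx]; exact h4 x

/-- The reflection y ↦ -y turns integration over the points above x into integration over the points
below -x. -/
lemma exists_volterraWeight_right {T : Set ℝ} (hT : MeasurableSet T) {S : ℝ → Set ℝ} {ψ : ℝ → ℝ}
    (hS : ∀ x ∈ T, S x = T ∩ Ioi x) (hψ : IntegrableOn ψ T volume) (h0 : ∀ x ∈ T, 0 ≤ ψ x) :
    ∃ E, VolterraWeight T S ψ E (Real.exp (2 * ∫ t in T, ψ t)) := by
  have hi : Integrable (T.indicator ψ) := (integrable_indicator_iff hT).2 hψ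
  have hi' := hi.comp_neg
  obtain ⟨h1, h2, h3, h4⟩ := integral_mul_exp_primitive_le hi'
    (fun x => indicator_nonneg h0 (-x))
  set E0 : ℝ → ℝ := fun x => Real.exp (2 * ∫ t in Iic x, T.indicator ψ (-t)) with hE0
  have heq : ∀ x ∈ T, ∫ y in S x, ψ y * E0 (-y) = ∫ y in Iic (-x), T.indicator ψ (-y) * E0 y := by
    intro x hx
    have := integral_comp_neg_Ioi x (fun y => T.indicator ψ (-y) * E0 y)
    rw [← this, hS x hx, inter_comm, ← setIntegral_indicator hT]
    refine setIntegral_congr_fun measurableSet_Ioi fun y _ => ?_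
    by_cases hy : y ∈ T <;> simp [hy]
  refine ⟨fun x => E0 (-x), ?_, ?_, h0, fun x => h1 _, ?_, ?_, ?_⟩
  · intro x hx; rw [hS x hx]; exact inter_subset_left
  · intro x hx; rw [hS x hx]; exact hT.inter measurableSet_Ioi
  · intro x
    have := h2 (-x)
    have e : ∫ t, T.indicator ψ (-t) = ∫ t in T, ψ t := by
      rw [integral_neg_eq_self (T.indicator ψ) volume, integral_indicator hT]
    rwa [e] at this
  · intro x hx
    refine (h3.comp_neg.integrableOn (s := S x)).congr_fun (fun y hy => ?_)
      (by rw [hS x hx]; exact hT.inter measurableSet_Ioi)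
    have : y ∈ T := by rw [hS x hx] at hy; exact hy.1
    simp [this, hE0]
  · intro x hx
    rw [heq x hx]; exact h4 (-x)

/-- A Grönwall inequality for Volterra equations with forcing term bounded by `C * w`. -/
lemma VolterraWeight.gronwall {T : Set ℝ} {S : ℝ → Set ℝ} {ψ E w : ℝ → ℝ} {B : ℝ}
    (hW : VolterraWeight T S ψ E B) {d : ℝ → ℂ} {N : ℝ → ℝ → ℂ} {C K : ℝ} (hC : 0 ≤ C)
    (hw : ∀ x ∈ T, 0 ≤ w x) (hN : ∀ x ∈ T, ∀ y ∈ S x, ‖N x y‖ * w y ≤ w x * ψ y)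
    (hK : 0 ≤ K) (hd : ∀ x ∈ T, ‖d x‖ ≤ K * w x)
    (heq : ∀ x ∈ T, ‖d x - ∫ y in S x, N x y * d y‖ ≤ C * w x) :
    ∀ x ∈ T, ‖d x‖ ≤ 2 * C * B * w x := by
  -- Feeding a bound with constant c into the equation returns C + c/2, a map whose fixed point is
  -- 2C. The a priori constant K only starts the iteration and disappears in the limit.
  have key : ∀ n : ℕ, ∀ x ∈ T, ‖d x‖ ≤ (2 * C + K * (1 / 2) ^ n) * E x * w x := by
    intro n
    induction n with
    | zero =>
      intro x hx
      refine (hd x hx).trans (mul_le_mul_of_nonneg_right ?_ (hw x hx))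
      have h1 := hW.one_le x
      nlinarith
    | succ n ih =>
      intro x hx
      set c := 2 * C + K * (1 / 2) ^ n with hc
      have hc0 : 0 ≤ c := by positivity
      have h1 : ‖∫ y in S x, N x y * d y‖ ≤ ∫ y in S x, c * w x * (ψ y * E y) := by
        refine norm_integral_le_of_norm_le ((hW.integrable x hx).const_mul _) ?_
        filter_upwards [ae_restrict_mem (hW.meas x hx)] with y hy
        have hyT := hW.subset x hx hy
        rw [norm_mul]
        have h2 := mul_le_mul_of_nonneg_left (ih y hyT) (norm_nonneg (N x y))
        have h3 : 0 ≤ c * E y := mul_nonneg hc0 (zero_le_one.trans (hW.one_le y))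
        have h4 := mul_le_mul_of_nonneg_right (hN x hx y hy) h3
        calc _ ≤ _ := h2
          _ = ‖N x y‖ * w y * (c * E y) := by ring
          _ ≤ _ := h4
          _ = _ := by ring
      rw [integral_const_mul] at h1
      have h2 := mul_le_mul_of_nonneg_left (hW.integral_le x hx) (mul_nonneg hc0 (hw x hx))
      have h3 : ‖d x‖ ≤ C * w x + c * w x * (E x / 2) := by
        calc ‖d x‖ = ‖(d x - ∫ y in S x, N x y * d y) + ∫ y in S x, N x y * d y‖ := by
              rw [sub_add_cancel]
          _ ≤ _ := (norm_add_le _ _).trans (add_le_add (heq x hx) (h1.trans h2))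
      have h4 := mul_le_mul_of_nonneg_left (hW.one_le x) (mul_nonneg hC (hw x hx))
      have h5 : (2 * C + K * (1 / 2) ^ (n + 1)) * E x * w x =
          C * w x * E x + c * w x * (E x / 2) := by
        rw [hc]; ring
      rw [h5]; linarith
  intro x hx
  have hlim : Tendsto (fun n : ℕ => (2 * C + K * (1 / 2) ^ n) * E x * w x) atTop
      (𝓝 ((2 * C + K * 0) * E x * w x)) :=
    (((tendsto_const_nhds.add ((tendsto_pow_atTop_nhds_zero_of_lt_one (by norm_num)
      (by norm_num)).const_mul K))).mul_const _).mul_const _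
  have h1 := ge_of_tendsto' hlim fun n => key n x hx
  rw [mul_zero, add_zero] at h1
  refine h1.trans (mul_le_mul_of_nonneg_right ?_ (hw x hx))
  exact mul_le_mul_of_nonneg_left (hW.le_bound x) (by positivity)

/-- The iterates of the Volterra operator with kernel `N`, integrating over `S x`. -/
def picardIter (S : ℝ → Set ℝ) (N : ℝ → ℝ → ℂ) (f₀ : ℝ → ℂ) : ℕ → ℝ → ℂ
  | 0 => f₀
  | n + 1 => fun x => ∫ y in S x, N x y * picardIter S N f₀ n y

/-- The Neumann series solving `f x = f₀ x + ∫ y in S x, N x y * f y`. -/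
def picardSum (S : ℝ → Set ℝ) (N : ℝ → ℝ → ℂ) (f₀ : ℝ → ℂ) (x : ℝ) : ℂ :=
  ∑' n, picardIter S N f₀ n x

section Picard

variable {T : Set ℝ} {S : ℝ → Set ℝ} {ψ E w : ℝ → ℝ} {B C : ℝ} {N : ℝ → ℝ → ℂ} {f₀ : ℝ → ℂ}

/-- Each application of the operator gains a factor 1/2 in the norm sup |f|/(wE); the condition on
`N` says that the kernel conjugated by `w` is dominated by ψ. -/
lemma VolterraWeight.norm_picardIter_le (hW : VolterraWeight T S ψ E B) (hC : 0 ≤ C)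
    (hw : ∀ x ∈ T, 0 ≤ w x) (hN : ∀ x ∈ T, ∀ y ∈ S x, ‖N x y‖ * w y ≤ w x * ψ y)
    (hf : ∀ x ∈ T, ‖f₀ x‖ ≤ C * w x) (n : ℕ) :
    ∀ x ∈ T, ‖picardIter S N f₀ n x‖ ≤ C * w x * E x * (1 / 2) ^ n := by
  induction n with
  | zero =>
    intro x hx
    have h1 := hW.one_le x
    have h2 := mul_nonneg hC (hw x hx)
    have h3 := hf x hx
    simp only [picardIter, pow_zero, mul_one]
    nlinarith
  | succ n ih =>
    intro x hx
    have h1 : ‖∫ y in S x, N x y * picardIter S N f₀ n y‖ ≤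
        ∫ y in S x, C * w x * (1 / 2) ^ n * (ψ y * E y) := by
      refine norm_integral_le_of_norm_le ((hW.integrable x hx).const_mul _) ?_
      filter_upwards [ae_restrict_mem (hW.meas x hx)] with y hy
      have hyT := hW.subset x hx hy
      rw [norm_mul]
      have h2 := mul_le_mul_of_nonneg_left (ih y hyT) (norm_nonneg (N x y))
      have h3 : 0 ≤ C * E y * (1 / 2) ^ n :=
        mul_nonneg (mul_nonneg hC (zero_le_one.trans (hW.one_le y))) (by positivity)
      have h4 := mul_le_mul_of_nonneg_right (hN x hx y hy) h3
      calc _ ≤ _ := h2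
        _ = ‖N x y‖ * w y * (C * E y * (1 / 2) ^ n) := by ring
        _ ≤ _ := h4
        _ = _ := by ring
    rw [integral_const_mul] at h1
    have h2 := mul_le_mul_of_nonneg_left (hW.integral_le x hx)
      (mul_nonneg (mul_nonneg hC (hw x hx)) (by positivity : (0 : ℝ) ≤ (1 / 2) ^ n))
    simp only [picardIter]
    calc _ ≤ _ := h1
      _ ≤ _ := h2
      _ = _ := by ring

lemma VolterraWeight.norm_picardIter_le_bound (hW : VolterraWeight T S ψ E B) (hC : 0 ≤ C)
    (hw : ∀ x ∈ T, 0 ≤ w x) (hN : ∀ x ∈ T, ∀ y ∈ S x, ‖N x y‖ * w y ≤ w x * ψ y)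
    (hf : ∀ x ∈ T, ‖f₀ x‖ ≤ C * w x) (n : ℕ) :
    ∀ x ∈ T, ‖picardIter S N f₀ n x‖ ≤ C * B * w x * (1 / 2) ^ n := by
  intro x hx
  refine (hW.norm_picardIter_le hC hw hN hf n x hx).trans ?_
  have h1 := mul_le_mul_of_nonneg_left (hW.le_bound x) (mul_nonneg hC (hw x hx))
  calc _ ≤ C * w x * B * (1 / 2) ^ n := by gcongr
    _ = _ := by ring

lemma VolterraWeight.summable_picardIter (hW : VolterraWeight T S ψ E B) (hC : 0 ≤ C)
    (hw : ∀ x ∈ T, 0 ≤ w x) (hN : ∀ x ∈ T, ∀ y ∈ S x, ‖N x y‖ * w y ≤ w x * ψ y)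
    (hf : ∀ x ∈ T, ‖f₀ x‖ ≤ C * w x) {x : ℝ} (hx : x ∈ T) :
    Summable fun n => picardIter S N f₀ n x :=
  Summable.of_norm_bounded (summable_geometric_two.mul_left (C * B * w x))
    fun n => hW.norm_picardIter_le_bound hC hw hN hf n x hx

lemma VolterraWeight.norm_picardSum_le (hW : VolterraWeight T S ψ E B) (hC : 0 ≤ C)
    (hw : ∀ x ∈ T, 0 ≤ w x) (hN : ∀ x ∈ T, ∀ y ∈ S x, ‖N x y‖ * w y ≤ w x * ψ y)
    (hf : ∀ x ∈ T, ‖f₀ x‖ ≤ C * w x) {x : ℝ} (hx : x ∈ T) :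
    ‖picardSum S N f₀ x‖ ≤ 2 * C * B * w x := by
  have := tsum_of_norm_bounded (hasSum_geometric_two.mul_left (C * B * w x))
    fun n => hW.norm_picardIter_le_bound hC hw hN hf n x hx
  calc _ ≤ _ := this
    _ = _ := by ring

/-- The series is integrated term by term: the majorants C w(x) ψ(y) E(y) 2⁻ⁿ are summable in n and
their sum is integrable in y. -/
lemma VolterraWeight.picardSum_eq (hW : VolterraWeight T S ψ E B) (hC : 0 ≤ C)
    (hw : ∀ x ∈ T, 0 ≤ w x) (hN : ∀ x ∈ T, ∀ y ∈ S x, ‖N x y‖ * w y ≤ w x * ψ y)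
    (hf : ∀ x ∈ T, ‖f₀ x‖ ≤ C * w x) {x : ℝ} (hx : x ∈ T)
    (hmeas : ∀ n, AEStronglyMeasurable (fun y => N x y * picardIter S N f₀ n y)
      (volume.restrict (S x))) :
    picardSum S N f₀ x = f₀ x + ∫ y in S x, N x y * picardSum S N f₀ y := by
  have h1 : HasSum (fun n => ∫ y in S x, N x y * picardIter S N f₀ n y)
      (∫ y in S x, N x y * picardSum S N f₀ y) := by
    refine hasSum_integral_of_dominated_convergence
      (fun n y => C * w x * (ψ y * E y) * (1 / 2) ^ n) hmeas ?_ ?_ ?_ ?_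
    · intro n
      filter_upwards [ae_restrict_mem (hW.meas x hx)] with y hy
      have hyT := hW.subset x hx hy
      rw [norm_mul]
      have h2 := mul_le_mul_of_nonneg_left (hW.norm_picardIter_le hC hw hN hf n y hyT)
        (norm_nonneg (N x y))
      have h3 : 0 ≤ C * E y * (1 / 2) ^ n :=
        mul_nonneg (mul_nonneg hC (zero_le_one.trans (hW.one_le y))) (by positivity)
      have h4 := mul_le_mul_of_nonneg_right (hN x hx y hy) h3
      calc _ ≤ _ := h2
        _ = ‖N x y‖ * w y * (C * E y * (1 / 2) ^ n) := by ring
        _ ≤ _ := h4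
        _ = _ := by ring
    · exact Eventually.of_forall fun y => summable_geometric_two.mul_left _
    · simp_rw [tsum_mul_left]
      exact ((hW.integrable x hx).const_mul _).mul_const _
    · filter_upwards [ae_restrict_mem (hW.meas x hx)] with y hy
      exact (hW.summable_picardIter hC hw hN hf (hW.subset x hx hy)).hasSum.mul_left _
  have h2 := hW.summable_picardIter hC hw hN hf hx
  rw [picardSum, h2.tsum_eq_zero_add, ← h1.tsum_eq]
  rfl

end Picard

/-! ### Perturbation of a second order equation with a known fundamental system -/

/-- `f` with derivative `f'` solves `f'' = P f` on `]0,∞[` in the Carathéodory sense. -/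
def IsSol (P : ℝ → ℂ) (f f' : ℝ → ℂ) : Prop :=
  HasACDeriv f f' ∧ HasACDeriv f' (fun x => P x * f x)

/-- `f` with derivative `f'` solves `f'' = P f` classically on `]0,∞[`. -/
def IsClassicalSol (P : ℝ → ℂ) (f f' : ℝ → ℂ) : Prop :=
  (∀ x, 0 < x → HasDerivAt f (f' x) x) ∧ ∀ x, 0 < x → HasDerivAt f' (P x * f x) x

lemma continuousOn_of_hasDerivAt {f f' : ℝ → ℂ} (h : ∀ x, 0 < x → HasDerivAt f (f' x) x) :
    ContinuousOn f (Ioi 0) :=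
  fun x hx => (h x hx).continuousAt.continuousWithinAt

lemma IsClassicalSol.isSol {P f f' : ℝ → ℂ} (h : IsClassicalSol P f f')
    (hP : ContinuousOn P (Ioi 0)) : IsSol P f f' :=
  ⟨hasACDeriv_of_hasDerivAt h.1 (continuousOn_of_hasDerivAt h.2),
    hasACDeriv_of_hasDerivAt h.2 (hP.mul (continuousOn_of_hasDerivAt h.1))⟩

lemma IsClassicalSol.const_mul {P f f' : ℝ → ℂ} (h : IsClassicalSol P f f') (c : ℂ) :
    IsClassicalSol P (fun x => c * f x) (fun x => c * f' x) :=
  ⟨fun x hx => (h.1 x hx).const_mul c, fun x hx =>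
    ((h.2 x hx).const_mul c).congr_deriv (by ring)⟩

lemma IsSol.hasDerivAt {P f f' : ℝ → ℂ} (h : IsSol P f f') {x : ℝ} (hx : 0 < x) :
    HasDerivAt f (f' x) x :=
  h.1.hasDerivAt h.2.continuousOn hx

lemma IsSol.sub {P f f' g g' : ℝ → ℂ} (hf : IsSol P f f') (hg : IsSol P g g') :
    IsSol P (fun x => f x - g x) (fun x => f' x - g' x) := by
  refine ⟨hf.1.sub hg.1, (hf.2.sub hg.2).congr (fun _ _ => rfl) (Eventually.of_forall fun x => ?_)⟩
  ring

/-- The Wronskian of solutions of `f'' = P f` and `g'' = R g` has derivative `(R - P) f g`. -/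
lemma IsSol.hasACDeriv_wronskian {P R f f' g g' : ℝ → ℂ} (hf : IsSol P f f') (hg : IsSol R g g') :
    HasACDeriv (fun x => f x * g' x - f' x * g x) (fun x => (R x - P x) * f x * g x) := by
  refine ((hf.1.mul hg.2).sub (hf.2.mul hg.1)).congr (fun _ _ => rfl)
    (Eventually.of_forall fun x => ?_)
  ring

lemma IsSol.wronskian_eq {P f f' g g' : ℝ → ℂ} (hf : IsSol P f f') (hg : IsSol P g g')
    {x y : ℝ} (hx : 0 < x) (hy : 0 < y) :
    f x * g' x - f' x * g x = f y * g' y - f' y * g y :=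
  (hf.hasACDeriv_wronskian hg).eq_of_ae_zero (Eventually.of_forall fun x => by simp) hx hy

/-- A fundamental system `u`, `v` of `f'' = P f` with Wronskian `v u' - v' u = 1`. -/
structure IsBasePair (P u u' v v' : ℝ → ℂ) : Prop where
  cont : ContinuousOn P (Ioi 0)
  solU : IsClassicalSol P u u'
  solV : IsClassicalSol P v v'
  wr : ∀ x, 0 < x → v x * u' x - v' x * u x = 1

/-- Data for the Volterra equation `f = f₀ + p ∫ q Q f - q ∫ p Q f`. -/
structure VolterraData (S : ℝ → Set ℝ) (σ : ℂ) (P Q p p' q q' : ℝ → ℂ) (w ψ c : ℝ → ℝ) :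
    Prop where
  subset : ∀ x, 0 < x → S x ⊆ Ioi 0
  meas : ∀ x, 0 < x → MeasurableSet (S x)
  -- The sign σ is +1 for integration from 0 and -1 for integration to ∞; this is the only
  -- difference between the endpoints in the argument.
  prim : ∀ h : ℝ → ℂ, (∀ x, 0 < x → IntegrableOn h (S x) volume) →
    HasACDeriv (fun x => ∫ y in S x, h y) (fun x => σ * h x)
  contP : ContinuousOn P (Ioi 0)
  solp : IsClassicalSol P p p'
  solq : IsClassicalSol P q q'
  wr : ∀ x, 0 < x → σ * (p' x * q x - q' x * p x) = 1
  locQ : LocallyIntegrableOn Q (Ioi 0) volume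
  intψ : IntegrableOn ψ (Ioi 0) volume
  nonneg : ∀ x, 0 < x → 0 ≤ w x
  boundq : ∀ y, 0 < y → ‖q y‖ * ‖Q y‖ * w y ≤ ψ y
  -- This integral is only controlled with a factor depending on x. At ∞ it will be V/U and at 0 it
  -- will be U/V, so that after multiplication by `q x` the term is again of the size of `w x`.
  boundp : ∀ x, 0 < x → ∀ y ∈ S x, ‖p y‖ * ‖Q y‖ * w y ≤ c x * ψ y
  kernel : ∀ x, 0 < x → ∀ y ∈ S x, ‖p x * q y - q x * p y‖ * ‖Q y‖ * w y ≤ w x * ψ y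

section VolterraData

variable {S : ℝ → Set ℝ} {σ : ℂ} {P Q p p' q q' : ℝ → ℂ} {w ψ c E : ℝ → ℝ} {B C : ℝ}

lemma VolterraData.integrableOn_q (h : VolterraData S σ P Q p p' q q' w ψ c) {f : ℝ → ℂ}
    (hf : AEStronglyMeasurable f (volume.restrict (Ioi 0))) {K : ℝ} (hK : 0 ≤ K)
    (hb : ∀ x, 0 < x → ‖f x‖ ≤ K * w x) :
    IntegrableOn (fun y => q y * (Q y * f y)) (Ioi 0) volume := by
  refine Integrable.mono' (h.intψ.const_mul K) ?_ ?_
  · exact ((continuousOn_of_hasDerivAt h.solq.1).aestronglyMeasurable measurableSet_Ioi).mul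
      (h.locQ.aestronglyMeasurable.mul hf)
  · filter_upwards [ae_restrict_mem measurableSet_Ioi] with y hy
    rw [norm_mul, norm_mul]
    calc ‖q y‖ * (‖Q y‖ * ‖f y‖) ≤ ‖q y‖ * (‖Q y‖ * (K * w y)) := by gcongr; exact hb y hy
      _ = K * (‖q y‖ * ‖Q y‖ * w y) := by ring
      _ ≤ K * ψ y := mul_le_mul_of_nonneg_left (h.boundq y hy) hK

lemma VolterraData.integrableOn_p (h : VolterraData S σ P Q p p' q q' w ψ c) {f : ℝ → ℂ}
    (hf : AEStronglyMeasurable f (volume.restrict (Ioi 0))) {K : ℝ} (hK : 0 ≤ K)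
    (hb : ∀ x, 0 < x → ‖f x‖ ≤ K * w x) {x : ℝ} (hx : 0 < x) :
    IntegrableOn (fun y => p y * (Q y * f y)) (S x) volume := by
  refine Integrable.mono' ((h.intψ.mono_set (h.subset x hx)).const_mul (K * c x)) ?_ ?_
  · exact (((continuousOn_of_hasDerivAt h.solp.1).aestronglyMeasurable measurableSet_Ioi).mul
      (h.locQ.aestronglyMeasurable.mul hf)).mono_set (h.subset x hx)
  · filter_upwards [ae_restrict_mem (h.meas x hx)] with y hy
    rw [norm_mul, norm_mul]
    calc ‖p y‖ * (‖Q y‖ * ‖f y‖) ≤ ‖p y‖ * (‖Q y‖ * (K * w y)) := by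
          gcongr; exact hb y (h.subset x hx hy)
      _ = K * (‖p y‖ * ‖Q y‖ * w y) := by ring
      _ ≤ K * (c x * ψ y) := mul_le_mul_of_nonneg_left (h.boundp x hx y hy) hK
      _ = _ := by ring

lemma VolterraData.integral_kernel (h : VolterraData S σ P Q p p' q q' w ψ c) {f : ℝ → ℂ}
    (hf : AEStronglyMeasurable f (volume.restrict (Ioi 0))) {K : ℝ} (hK : 0 ≤ K)
    (hb : ∀ x, 0 < x → ‖f x‖ ≤ K * w x) {x : ℝ} (hx : 0 < x) :
    ∫ y in S x, (p x * q y - q x * p y) * Q y * f y =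
      p x * (∫ y in S x, q y * (Q y * f y)) - q x * ∫ y in S x, p y * (Q y * f y) := by
  rw [← integral_const_mul, ← integral_const_mul, ← integral_sub]
  · congr 1; ext y; ring
  · exact ((h.integrableOn_q hf hK hb).mono_set (h.subset x hx)).const_mul _
  · exact (h.integrableOn_p hf hK hb hx).const_mul _

lemma VolterraData.kernel' (h : VolterraData S σ P Q p p' q q' w ψ c) :
    ∀ x ∈ Ioi (0 : ℝ), ∀ y ∈ S x, ‖(p x * q y - q x * p y) * Q y‖ * w y ≤ w x * ψ y := by
  intro x hx y hy
  rw [norm_mul]; exact h.kernel x hx y hy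

/-- Splitting the kernel writes the integral as a combination of primitives with continuous
coefficients. Every Neumann iterate after the first is therefore continuous, which supplies the
measurability for the next one. -/
lemma VolterraData.continuousOn_integral (h : VolterraData S σ P Q p p' q q' w ψ c) {f : ℝ → ℂ}
    (hf : AEStronglyMeasurable f (volume.restrict (Ioi 0))) {K : ℝ} (hK : 0 ≤ K)
    (hb : ∀ x, 0 < x → ‖f x‖ ≤ K * w x) :
    ContinuousOn (fun x => ∫ y in S x, (p x * q y - q x * p y) * Q y * f y) (Ioi 0) := by
  have h1 := h.prim _ fun x hx => (h.integrableOn_q hf hK hb).mono_set (h.subset x hx)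
  have h2 := h.prim _ fun x hx => h.integrableOn_p hf hK hb hx
  exact (((continuousOn_of_hasDerivAt h.solp.1).mul h1.continuousOn).sub
    ((continuousOn_of_hasDerivAt h.solq.1).mul h2.continuousOn)).congr
    fun x hx => h.integral_kernel hf hK hb hx

/-- The solution of the Volterra equation given by the Neumann series. -/
def volterraSol (S : ℝ → Set ℝ) (Q p q f₀ : ℝ → ℂ) : ℝ → ℂ :=
  picardSum S (fun x y => (p x * q y - q x * p y) * Q y) f₀

lemma VolterraData.picardIter_meas (h : VolterraData S σ P Q p p' q q' w ψ c)
    (hW : VolterraWeight (Ioi 0) S ψ E B) {f₀ : ℝ → ℂ} (hC : 0 ≤ C)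
    (hf₀ : ContinuousOn f₀ (Ioi 0)) (hb : ∀ x, 0 < x → ‖f₀ x‖ ≤ C * w x) (n : ℕ) :
    AEStronglyMeasurable (picardIter S (fun x y => (p x * q y - q x * p y) * Q y) f₀ n)
      (volume.restrict (Ioi 0)) := by
  have hB : 0 ≤ B := zero_le_one.trans ((hW.one_le 0).trans (hW.le_bound 0))
  induction n with
  | zero => exact hf₀.aestronglyMeasurable measurableSet_Ioi
  | succ n ih =>
    refine ContinuousOn.aestronglyMeasurable ?_ measurableSet_Ioi
    refine h.continuousOn_integral ih (K := C * B * (1 / 2) ^ n) (by positivity) fun x hx => ?_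
    refine (hW.norm_picardIter_le_bound hC h.nonneg h.kernel' hb n x hx).trans (le_of_eq ?_)
    ring

lemma VolterraData.norm_volterraSol_le (h : VolterraData S σ P Q p p' q q' w ψ c)
    (hW : VolterraWeight (Ioi 0) S ψ E B) {f₀ : ℝ → ℂ} (hC : 0 ≤ C)
    (hb : ∀ x, 0 < x → ‖f₀ x‖ ≤ C * w x) {x : ℝ} (hx : 0 < x) :
    ‖volterraSol S Q p q f₀ x‖ ≤ 2 * C * B * w x :=
  hW.norm_picardSum_le hC h.nonneg h.kernel' hb hx

lemma VolterraData.volterraSol_meas (h : VolterraData S σ P Q p p' q q' w ψ c)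
    (hW : VolterraWeight (Ioi 0) S ψ E B) {f₀ : ℝ → ℂ} (hC : 0 ≤ C)
    (hf₀ : ContinuousOn f₀ (Ioi 0)) (hb : ∀ x, 0 < x → ‖f₀ x‖ ≤ C * w x) :
    AEStronglyMeasurable (volterraSol S Q p q f₀) (volume.restrict (Ioi 0)) := by
  refine aestronglyMeasurable_of_tendsto_ae atTop
    (f := fun n x => ∑ i ∈ Finset.range n,
      picardIter S (fun x y => (p x * q y - q x * p y) * Q y) f₀ i x) (fun n => ?_) ?_
  · exact Finset.aestronglyMeasurable_fun_sum _ fun i _ => h.picardIter_meas hW hC hf₀ hb i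
  · filter_upwards [ae_restrict_mem measurableSet_Ioi] with x hx
    exact (hW.summable_picardIter hC h.nonneg h.kernel' hb hx).hasSum.tendsto_sum_nat

lemma VolterraData.volterraSol_eq (h : VolterraData S σ P Q p p' q q' w ψ c)
    (hW : VolterraWeight (Ioi 0) S ψ E B) {f₀ : ℝ → ℂ} (hC : 0 ≤ C)
    (hf₀ : ContinuousOn f₀ (Ioi 0)) (hb : ∀ x, 0 < x → ‖f₀ x‖ ≤ C * w x) {x : ℝ} (hx : 0 < x) :
    volterraSol S Q p q f₀ x = f₀ x +
      (p x * (∫ y in S x, q y * (Q y * volterraSol S Q p q f₀ y)) -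
        q x * ∫ y in S x, p y * (Q y * volterraSol S Q p q f₀ y)) := by
  have hB : 0 ≤ B := zero_le_one.trans ((hW.one_le 0).trans (hW.le_bound 0))
  rw [← h.integral_kernel (h.volterraSol_meas hW hC hf₀ hb) (K := 2 * C * B) (by positivity)
    (fun x hx => h.norm_volterraSol_le hW hC hb hx) hx]
  refine hW.picardSum_eq hC h.nonneg h.kernel' hb hx fun n => ?_
  have h1 : AEStronglyMeasurable (fun y => (p x * q y - q x * p y) * Q y)
      (volume.restrict (Ioi 0)) :=
    ((((continuousOn_of_hasDerivAt h.solq.1).const_smul (p x)).sub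
      ((continuousOn_of_hasDerivAt h.solp.1).const_smul (q x))).aestronglyMeasurable
      measurableSet_Ioi).mul h.locQ.aestronglyMeasurable
  exact (h1.mul (h.picardIter_meas hW hC hf₀ hb n)).mono_set (h.subset x hx)

/-- In the first derivative the terms coming from the differentiated integrals cancel. In the second
they add up to σ(p'q - q'p)Qf, which is Qf by the normalization of the Wronskian; the integral
equation then reassembles Pf. -/
lemma VolterraData.isSol (h : VolterraData S σ P Q p p' q q' w ψ c)
    (hW : VolterraWeight (Ioi 0) S ψ E B) {f₀ f₀' : ℝ → ℂ} (hC : 0 ≤ C)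
    (hf₀ : IsClassicalSol P f₀ f₀') (hb : ∀ x, 0 < x → ‖f₀ x‖ ≤ C * w x) :
    IsSol (fun x => P x + Q x) (volterraSol S Q p q f₀) (fun x => f₀' x +
      (p' x * (∫ y in S x, q y * (Q y * volterraSol S Q p q f₀ y)) -
        q' x * ∫ y in S x, p y * (Q y * volterraSol S Q p q f₀ y))) := by
  have hB : 0 ≤ B := zero_le_one.trans ((hW.one_le 0).trans (hW.le_bound 0))
  have hc := continuousOn_of_hasDerivAt hf₀.1
  have hm := h.volterraSol_meas hW hC hc hb
  have hle : ∀ x, 0 < x → ‖volterraSol S Q p q f₀ x‖ ≤ 2 * C * B * w x :=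
    fun x hx => h.norm_volterraSol_le hW hC hb hx
  have heq := fun (x : ℝ) (hx : 0 < x) => h.volterraSol_eq hW hC hc hb hx
  set f := volterraSol S Q p q f₀
  have hA := h.prim _ fun x hx =>
    (h.integrableOn_q hm (K := 2 * C * B) (by positivity) hle).mono_set (h.subset x hx)
  have hBi := h.prim _ fun x hx => h.integrableOn_p hm (K := 2 * C * B) (by positivity) hle hx
  have s0 := hf₀.isSol h.contP
  have sp := h.solp.isSol h.contP
  have sq := h.solq.isSol h.contP
  refine ⟨(s0.1.add ((sp.1.mul hA).sub (sq.1.mul hBi))).congr (fun x hx => heq x hx) ?_,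
    (s0.2.add ((sp.2.mul hA).sub (sq.2.mul hBi))).congr (fun x hx => rfl) ?_⟩
  · filter_upwards with x
    ring
  · filter_upwards [ae_restrict_mem measurableSet_Ioi] with x hx
    have h1 := h.wr x hx
    have h2 := heq x hx
    calc (P x + Q x) * f x = P x * f x + (σ * (p' x * q x - q' x * p x)) * (Q x * f x) := by
          rw [h1]; ring
      _ = P x * (f₀ x + (p x * (∫ y in S x, q y * (Q y * f y)) -
            q x * ∫ y in S x, p y * (Q y * f y)))
          + (σ * (p' x * q x - q' x * p x)) * (Q x * f x) := by rw [← h2]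
      _ = _ := by ring

end VolterraData

/-! ### Volterra equations from a weighted fundamental system -/

/-- Positive weights dominating a fundamental system, with `U / V` increasing. -/
structure PairWeights (u v : ℝ → ℂ) (U V : ℝ → ℝ) : Prop where
  posU : ∀ x, 0 < x → 0 < U x
  posV : ∀ x, 0 < x → 0 < V x
  leU : ∀ x, 0 < x → ‖u x‖ ≤ U x
  leV : ∀ x, 0 < x → ‖v x‖ ≤ V x
  ratio : ∀ y x, 0 < y → y ≤ x → U y * V x ≤ U x * V y

/-- Monotonicity of U/V absorbs the cross term V(x)U(y) into U(x)V(y), so both terms of the kernel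
have the same size. -/
lemma PairWeights.kernel_le {u v : ℝ → ℂ} {U V : ℝ → ℝ} (h : PairWeights u v U V) {x y : ℝ}
    (hy : 0 < y) (hyx : y ≤ x) : ‖u x * v y - v x * u y‖ ≤ 2 * (U x * V y) := by
  have hx := hy.trans_le hyx
  have := h.ratio y x hy hyx
  calc ‖u x * v y - v x * u y‖ ≤ ‖u x‖ * ‖v y‖ + ‖v x‖ * ‖u y‖ := by
        refine (norm_sub_le _ _).trans ?_
        rw [norm_mul, norm_mul]
    _ ≤ U x * V y + V x * U y := by
        have := (h.posU x hx).le
        have := (h.posV x hx).le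
        gcongr
        · exact h.leU x hx
        · exact h.leV y hy
        · exact h.leV x hx
        · exact h.leU y hy
    _ ≤ _ := by linarith

/-- At ∞ solutions are measured against the recessive weight V, and the kernel then costs UV|Q|. -/
lemma IsBasePair.volterraData_infty {P Q u u' v v' : ℝ → ℂ} (hB : IsBasePair P u u' v v')
    {U V ψ : ℝ → ℝ} (hUV : PairWeights u v U V) (hQ : LocallyIntegrableOn Q (Ioi 0) volume)
    (hψ : IntegrableOn ψ (Ioi 0) volume)
    (hψ' : ∀ x, 0 < x → 2 * (U x * V x * ‖Q x‖) ≤ ψ x) :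
    VolterraData (fun x => Ioi x) (-1) P Q v v' u u' V ψ (fun x => V x / U x) where
  subset x hx := Ioi_subset_Ioi hx.le
  meas x _ := measurableSet_Ioi
  prim h hi := by simpa using hasACDeriv_integral_Ioi hi
  contP := hB.cont
  solp := hB.solV
  solq := hB.solU
  wr x hx := by linear_combination hB.wr x hx
  locQ := hQ
  intψ := hψ
  nonneg x hx := (hUV.posV x hx).le
  boundq y hy := by
    have h1 := hψ' y hy
    have h2 := hUV.posV y hy
    have h3 := hUV.posU y hy
    have h4 : ‖u y‖ * ‖Q y‖ * V y ≤ U y * ‖Q y‖ * V y := by gcongr; exact hUV.leU y hy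
    have h5 : 0 ≤ U y * V y * ‖Q y‖ := by positivity
    linarith
  boundp x hx y hy := by
    have hy0 : 0 < y := hx.trans hy
    have h1 := hψ' y hy0
    have h2 := hUV.posV y hy0
    have h3 := hUV.posU y hy0
    have h2' := hUV.posV x hx
    have h3' := hUV.posU x hx
    have h4 : ‖v y‖ * ‖Q y‖ * V y ≤ V y * ‖Q y‖ * V y := by gcongr; exact hUV.leV y hy0
    have h5 : 0 ≤ U y * V y * ‖Q y‖ := by positivity
    have h6 : V y ≤ V x / U x * U y := by
      rw [div_mul_eq_mul_div, le_div_iff₀ h3']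
      linarith [hUV.ratio x y hx (le_of_lt hy)]
    calc _ ≤ V y * ‖Q y‖ * V y := h4
      _ ≤ V x / U x * U y * ‖Q y‖ * V y := by gcongr
      _ = V x / U x * (U y * V y * ‖Q y‖) := by ring
      _ ≤ _ := by gcongr; linarith
  kernel x hx y hy := by
    have hy0 : 0 < y := hx.trans hy
    have h1 := hψ' y hy0
    have h2 := hUV.posV y hy0
    have h2' := hUV.posV x hx
    have h3 := hUV.kernel_le hx (le_of_lt hy)
    rw [show v x * u y - u x * v y = u y * v x - v y * u x by ring]
    calc _ ≤ 2 * (U y * V x) * ‖Q y‖ * V y := by gcongr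
      _ = V x * (2 * (U y * V y * ‖Q y‖)) := by ring
      _ ≤ _ := by gcongr

/-- The weight W is allowed to exceed U: when Re m < 0 the solution u⁰ to be perturbed is larger
near 0 than the recessive one. The kernel then costs VW|Q| instead of UV|Q|. -/
lemma IsBasePair.volterraData_zero {P Q u u' v v' : ℝ → ℂ} (hB : IsBasePair P u u' v v')
    {U V W ψ : ℝ → ℝ} (hUV : PairWeights u v U V) (hUW : ∀ x, 0 < x → U x ≤ W x)
    (hQ : LocallyIntegrableOn Q (Ioi 0) volume)
    (hψ : IntegrableOn ψ (Ioi 0) volume)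
    (hψ' : ∀ x, 0 < x → 2 * (V x * W x * ‖Q x‖) ≤ ψ x) :
    VolterraData (fun x => Ioc 0 x) 1 P Q u u' v v' W ψ (fun x => U x / V x) where
  subset x hx := Ioc_subset_Ioi_self
  meas x _ := measurableSet_Ioc
  prim h hi := by simpa using hasACDeriv_integral_Ioc hi
  contP := hB.cont
  solp := hB.solU
  solq := hB.solV
  wr x hx := by linear_combination hB.wr x hx
  locQ := hQ
  intψ := hψ
  nonneg x hx := (hUV.posU x hx).le.trans (hUW x hx)
  boundq y hy := by
    have h1 := hψ' y hy
    have h2 := hUV.posV y hy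
    have h3 := (hUV.posU y hy).trans_le (hUW y hy)
    have h4 : ‖v y‖ * ‖Q y‖ * W y ≤ V y * ‖Q y‖ * W y := by gcongr; exact hUV.leV y hy
    have h5 : 0 ≤ V y * W y * ‖Q y‖ := by positivity
    linarith
  boundp x hx y hy := by
    have hy0 : 0 < y := hy.1
    have h1 := hψ' y hy0
    have h2 := hUV.posV y hy0
    have h3 := hUV.posU y hy0
    have h3'' := (hUV.posU y hy0).trans_le (hUW y hy0)
    have h2' := hUV.posV x hx
    have h3' := hUV.posU x hx
    have h4 : ‖u y‖ * ‖Q y‖ * W y ≤ U y * ‖Q y‖ * W y := by gcongr; exact hUV.leU y hy0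
    have h5 : 0 ≤ V y * W y * ‖Q y‖ := by positivity
    have h6 : U y ≤ U x / V x * V y := by
      rw [div_mul_eq_mul_div, le_div_iff₀ h2']
      linarith [hUV.ratio y x hy0 hy.2]
    calc _ ≤ U y * ‖Q y‖ * W y := h4
      _ ≤ U x / V x * V y * ‖Q y‖ * W y := by gcongr
      _ = U x / V x * (V y * W y * ‖Q y‖) := by ring
      _ ≤ _ := by gcongr; linarith
  kernel x hx y hy := by
    have hy0 : 0 < y := hy.1
    have h1 := hψ' y hy0
    have h2 := hUV.posV y hy0
    have h3 := hUV.kernel_le hy0 hy.2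
    have h4 := (hUV.posU y hy0).trans_le (hUW y hy0)
    have h5 := hUV.posU x hx
    have h6 := hUW x hx
    have h6' := h5.le.trans h6
    have h7 : 0 ≤ 2 * (V y * W y * ‖Q y‖) := by positivity
    calc _ ≤ 2 * (U x * V y) * ‖Q y‖ * W y := by gcongr
      _ = U x * (2 * (V y * W y * ‖Q y‖)) := by ring
      _ ≤ W x * ψ y := by gcongr

/-! Variation of constants. -/

section VariationOfConstants

variable {P Q u u' v v' f f' : ℝ → ℂ}

/-- The Wronskians of `f` with `v` and with `u` are its coefficients along `u` and `v`
(`IsBasePair.eq_coeff`); they would be constant for `Q = 0`, so their derivatives contain only the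
perturbation. -/
lemma IsBasePair.hasACDeriv_coeffU (hB : IsBasePair P u u' v v')
    (hf : IsSol (fun x => P x + Q x) f f') :
    HasACDeriv (fun x => v x * f' x - v' x * f x) (fun x => v x * (Q x * f x)) :=
  ((hB.solV.isSol hB.cont).hasACDeriv_wronskian hf).congr (fun _ _ => rfl)
    (Eventually.of_forall fun x => by ring)

lemma IsBasePair.hasACDeriv_coeffV (hB : IsBasePair P u u' v v')
    (hf : IsSol (fun x => P x + Q x) f f') :
    HasACDeriv (fun x => f x * u' x - f' x * u x) (fun x => -(u x * (Q x * f x))) :=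
  (hf.hasACDeriv_wronskian (hB.solU.isSol hB.cont)).congr (fun _ _ => rfl)
    (Eventually.of_forall fun x => by ring)

lemma IsBasePair.eq_coeff (hB : IsBasePair P u u' v v') {x : ℝ} (hx : 0 < x) (a b : ℂ) :
    a = (v x * b - v' x * a) * u x + (a * u' x - b * u x) * v x := by
  linear_combination (-a) * hB.wr x hx

/-- The two coefficients are integrated from x to ∞, where their limits α and β serve as data. A
solution is thereby tied to its asymptotic coefficients by a Volterra equation, without any
assumption on how it was constructed. -/
lemma IsBasePair.eq_integral_Ioi (hB : IsBasePair P u u' v v')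
    (hf : IsSol (fun x => P x + Q x) f f') {α β : ℂ}
    (hα : Tendsto (fun x => v x * f' x - v' x * f x) atTop (𝓝 α))
    (hβ : Tendsto (fun x => f x * u' x - f' x * u x) atTop (𝓝 β)) {x : ℝ} (hx : 0 < x)
    (hiu : IntegrableOn (fun y => u y * (Q y * f y)) (Ioi x) volume)
    (hiv : IntegrableOn (fun y => v y * (Q y * f y)) (Ioi x) volume) :
    f x = α * u x + β * v x + ∫ y in Ioi x, (v x * u y - u x * v y) * Q y * f y := by
  have h1 := (hB.hasACDeriv_coeffU hf).integral_Ioi hx hiv hα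
  have h2 := (hB.hasACDeriv_coeffV hf).integral_Ioi hx hiu.neg hβ
  rw [integral_neg] at h2
  have h3 : ∫ y in Ioi x, (v x * u y - u x * v y) * Q y * f y =
      v x * (∫ y in Ioi x, u y * (Q y * f y)) - u x * ∫ y in Ioi x, v y * (Q y * f y) := by
    rw [← integral_const_mul, ← integral_const_mul, ← integral_sub (hiu.const_mul _)
      (hiv.const_mul _)]
    congr 1; ext y; ring
  rw [h3, h1]
  linear_combination hB.eq_coeff hx (f x) (f' x) + v x * h2

lemma IsBasePair.eq_integral_Ioc_zero (hB : IsBasePair P u u' v v')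
    (hf : IsSol (fun x => P x + Q x) f f') {α β : ℂ}
    (hα : Tendsto (fun x => v x * f' x - v' x * f x) (𝓝[>] 0) (𝓝 α))
    (hβ : Tendsto (fun x => f x * u' x - f' x * u x) (𝓝[>] 0) (𝓝 β)) {x : ℝ} (hx : 0 < x)
    (hiu : IntegrableOn (fun y => u y * (Q y * f y)) (Ioc 0 x) volume)
    (hiv : IntegrableOn (fun y => v y * (Q y * f y)) (Ioc 0 x) volume) :
    f x = α * u x + β * v x + ∫ y in Ioc 0 x, (u x * v y - v x * u y) * Q y * f y := by
  have h1 := (hB.hasACDeriv_coeffU hf).integral_Ioc hx hiv hα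
  have h2 := (hB.hasACDeriv_coeffV hf).integral_Ioc hx hiu.neg hβ
  rw [integral_neg] at h2
  have h3 : ∫ y in Ioc 0 x, (u x * v y - v x * u y) * Q y * f y =
      u x * (∫ y in Ioc 0 x, v y * (Q y * f y)) - v x * ∫ y in Ioc 0 x, u y * (Q y * f y) := by
    rw [← integral_const_mul, ← integral_const_mul, ← integral_sub (hiv.const_mul _)
      (hiu.const_mul _)]
    congr 1; ext y; ring
  rw [h3, h1]
  linear_combination hB.eq_coeff hx (f x) (f' x) - v x * h2

lemma IsBasePair.eq_intervalIntegral (hB : IsBasePair P u u' v v')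
    (hf : IsSol (fun x => P x + Q x) f f') (hQ : LocallyIntegrableOn Q (Ioi 0) volume)
    {a x : ℝ} (ha : 0 < a) (hx : 0 < x) :
    f x = (v a * f' a - v' a * f a) * u x + (f a * u' a - f' a * u a) * v x +
      ∫ y in a..x, (u x * v y - v x * u y) * Q y * f y := by
  have hi : LocallyIntegrableOn (fun y => Q y * f y) (Ioi 0) volume :=
    locallyIntegrableOn_mul_continuousOn hQ hf.1.continuousOn
  have hiu := intervalIntegrable_of_locallyIntegrableOn (locallyIntegrableOn_continuousOn_mul
    (continuousOn_of_hasDerivAt hB.solU.1) hi) ha hx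
  have hiv := intervalIntegrable_of_locallyIntegrableOn (locallyIntegrableOn_continuousOn_mul
    (continuousOn_of_hasDerivAt hB.solV.1) hi) ha hx
  have h1 := (hB.hasACDeriv_coeffU hf).2 a x ha hx
  have h2 := (hB.hasACDeriv_coeffV hf).2 a x ha hx
  rw [intervalIntegral.integral_neg] at h2
  have h3 : ∫ y in a..x, (u x * v y - v x * u y) * Q y * f y =
      u x * (∫ y in a..x, v y * (Q y * f y)) - v x * ∫ y in a..x, u y * (Q y * f y) := by
    rw [← intervalIntegral.integral_const_mul, ← intervalIntegral.integral_const_mul,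
      ← intervalIntegral.integral_sub (hiv.const_mul _) (hiu.const_mul _)]
    congr 1; ext y; ring
  rw [h3, ← h1]
  linear_combination hB.eq_coeff hx (f x) (f' x) + v x * h2

end VariationOfConstants

/-! ### The modified Bessel function -/

/-- The entire function `∑ tⁿ / (n! Γ(ν + n + 1))`. -/
def besselE (ν t : ℂ) : ℂ :=
  ∑' n : ℕ, t ^ n / ((Nat.factorial n : ℂ) * Complex.Gamma (ν + n + 1))

lemma Gamma_add_ne_zero {ν : ℂ} (hν : -1 < ν.re) (n : ℕ) : Complex.Gamma (ν + n + 1) ≠ 0 := by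
  apply Complex.Gamma_ne_zero_of_re_pos
  simp only [Complex.add_re, Complex.natCast_re, Complex.one_re]
  have : (0 : ℝ) ≤ n := n.cast_nonneg
  linarith

/-- From n = 1 on, the functional equation divides by a factor of modulus at least 1, so the
sequence decreases. The term n = 0 is kept apart because |ν + 1| may be small. -/
lemma exists_bound_inv_Gamma {ν : ℂ} (hν : -1 < ν.re) :
    ∃ C : ℝ, 0 < C ∧ ∀ n : ℕ, ‖(Complex.Gamma (ν + n + 1))⁻¹‖ ≤ C := by
  refine ⟨max ‖(Complex.Gamma (ν + (0 : ℕ) + 1))⁻¹‖ ‖(Complex.Gamma (ν + (1 : ℕ) + 1))⁻¹‖,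
    lt_max_of_lt_left (norm_pos_iff.2 (inv_ne_zero (Gamma_add_ne_zero hν 0))), fun n => ?_⟩
  rcases n with _ | n
  · exact le_max_left _ _
  refine le_trans ?_ (le_max_right _ _)
  induction n with
  | zero => simp
  | succ n ih =>
    refine le_trans ?_ ih
    have h1 : Complex.Gamma (ν + ((n + 1 + 1 : ℕ) : ℂ) + 1) =
        (ν + ((n + 1 : ℕ) : ℂ) + 1) * Complex.Gamma (ν + ((n + 1 : ℕ) : ℂ) + 1) := by
      rw [← Complex.Gamma_add_one]
      · congr 1; push_cast; ring
      · intro h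
        have := congrArg Complex.re h
        simp only [Complex.add_re, Complex.natCast_re, Complex.one_re, Complex.zero_re] at this
        have h2 : (0 : ℝ) ≤ ((n + 1 : ℕ) : ℝ) := Nat.cast_nonneg _
        linarith
    rw [h1, mul_inv, norm_mul]
    refine mul_le_of_le_one_left (norm_nonneg _) ?_
    rw [norm_inv]
    apply inv_le_one_of_one_le₀
    refine le_trans ?_ (Complex.re_le_norm _)
    simp only [Complex.add_re, Complex.natCast_re, Complex.one_re]
    push_cast
    have h2 : (0 : ℝ) ≤ n := Nat.cast_nonneg _
    linarith

lemma norm_besselE_term_le {ν : ℂ} {C : ℝ}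
    (hC : ∀ n : ℕ, ‖(Complex.Gamma (ν + n + 1))⁻¹‖ ≤ C) (t : ℂ) (n : ℕ) :
    ‖t ^ n / ((Nat.factorial n : ℂ) * Complex.Gamma (ν + n + 1))‖ ≤
      C * (‖t‖ ^ n / (Nat.factorial n : ℝ)) := by
  rw [div_eq_mul_inv, mul_inv, norm_mul, norm_mul, norm_inv, norm_pow, Complex.norm_natCast]
  calc _ = ‖(Complex.Gamma (ν + n + 1))⁻¹‖ * (‖t‖ ^ n / (Nat.factorial n : ℝ)) := by ring
    _ ≤ _ := by gcongr; exact hC n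

lemma summable_besselE {ν : ℂ} (hν : -1 < ν.re) (t : ℂ) :
    Summable fun n : ℕ => t ^ n / ((Nat.factorial n : ℂ) * Complex.Gamma (ν + n + 1)) := by
  obtain ⟨C, _, hC⟩ := exists_bound_inv_Gamma hν
  exact Summable.of_norm_bounded ((Real.summable_pow_div_factorial ‖t‖).mul_left C)
    fun n => norm_besselE_term_le hC t n

lemma exists_norm_besselE_le {ν : ℂ} (hν : -1 < ν.re) :
    ∃ C : ℝ, 0 < C ∧ ∀ t, ‖besselE ν t‖ ≤ C * Real.exp ‖t‖ := by
  obtain ⟨C, hC0, hC⟩ := exists_bound_inv_Gamma hν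
  refine ⟨C, hC0, fun t => tsum_of_norm_bounded (HasSum.mul_left C ?_)
    fun n => norm_besselE_term_le hC t n⟩
  rw [Real.exp_eq_exp_ℝ]
  exact NormedSpace.expSeries_div_hasSum_exp _

/-- In the differentiated series the term n = 0 vanishes and the term n + 1 is the n-th term of
order ν + 1, so one bound on the inverse Gamma values controls the derivatives on a ball. -/
lemma hasDerivAt_besselE {ν : ℂ} (hν : -1 < ν.re) (t : ℂ) :
    HasDerivAt (besselE ν) (besselE (ν + 1) t) t := by
  obtain ⟨C, hC0, hC⟩ := exists_bound_inv_Gamma hν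
  set R := ‖t‖ + 1 with hR
  set g' : ℕ → ℂ → ℂ := fun n y =>
    n * y ^ (n - 1) / ((Nat.factorial n : ℂ) * Complex.Gamma (ν + n + 1)) with hg'
  set b : ℕ → ℝ := fun n => Nat.casesOn n 0 fun n => C * (R ^ n / (Nat.factorial n : ℝ)) with hb
  have hterm : ∀ (n : ℕ) (y : ℂ), g' (n + 1) y =
      y ^ n / ((Nat.factorial n : ℂ) * Complex.Gamma (ν + 1 + n + 1)) := by
    intro n y
    have h1 : ((n : ℂ) + 1) ≠ 0 := Nat.cast_add_one_ne_zero n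
    have h2 : ((Nat.factorial n : ℕ) : ℂ) ≠ 0 := Nat.cast_ne_zero.2 (Nat.factorial_ne_zero n)
    simp only [hg', Nat.factorial_succ, Nat.add_sub_cancel]
    push_cast
    rw [show ν + (n + 1) + 1 = ν + 1 + n + 1 by ring, mul_assoc, mul_div_mul_left _ _ h1]
  have h := hasDerivAt_tsum_of_isPreconnected (u := b) (t := Metric.ball (0 : ℂ) R)
    (g := fun n y => y ^ n / ((Nat.factorial n : ℂ) * Complex.Gamma (ν + n + 1))) (g' := g')
    (y₀ := 0) (y := t) ?_ Metric.isOpen_ball (convex_ball _ _).isPreconnected ?_ ?_ ?_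
    (summable_besselE hν 0) ?_
  · refine h.congr_deriv ?_
    rw [Summable.tsum_eq_zero_add]
    · simp only [hterm]
      simp [hg', besselE]
    · rw [← summable_nat_add_iff 1]
      simp only [hterm]
      exact summable_besselE (by simp; linarith) t
  · rw [← summable_nat_add_iff 1]
    exact (Real.summable_pow_div_factorial R).mul_left C
  · intro n y _
    exact (hasDerivAt_pow n y).div_const _
  · intro n y hy
    rcases n with _ | n
    · simp [hg', hb]
    · rw [hterm]
      have hC' : ∀ n : ℕ, ‖(Complex.Gamma (ν + 1 + n + 1))⁻¹‖ ≤ C := by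
        intro n
        have := hC (n + 1)
        push_cast at this
        rwa [show ν + (n + 1) + 1 = ν + 1 + n + 1 by ring] at this
      refine (norm_besselE_term_le hC' y n).trans ?_
      have hyR : ‖y‖ ≤ R := (mem_ball_zero_iff.1 hy).le
      simp only [hb]
      gcongr
  · simp [hR]; positivity
  · simp [hR]

/-- Termwise, 1/Γ(ν+n+1) = (ν+n+1)/Γ(ν+n+2). The part ν + 1 of the factor gives the first term, and
the part n cancels against n! and gives the shifted series. -/
lemma besselE_recurrence {ν : ℂ} (hν : -1 < ν.re) (t : ℂ) :
    besselE ν t = (ν + 1) * besselE (ν + 1) t + t * besselE (ν + 2) t := by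
  have s1 := summable_besselE (ν := ν + 1) (by simp; linarith) t
  have s2 := summable_besselE (ν := ν + 2) (by simp; linarith) t
  have s0 := summable_besselE hν t
  have hG : ∀ n : ℕ, Complex.Gamma (ν + 1 + n + 1) = (ν + n + 1) * Complex.Gamma (ν + n + 1) := by
    intro n
    rw [← Complex.Gamma_add_one]
    · congr 1; ring
    · intro h
      have := congrArg Complex.re h
      simp only [Complex.add_re, Complex.natCast_re, Complex.one_re, Complex.zero_re] at this
      have h2 : (0 : ℝ) ≤ (n : ℝ) := Nat.cast_nonneg _
      linarith
  have hne : ∀ n : ℕ, ν + n + 1 ≠ 0 := by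
    intro n h
    have := congrArg Complex.re h
    simp only [Complex.add_re, Complex.natCast_re, Complex.one_re, Complex.zero_re] at this
    have h2 : (0 : ℝ) ≤ (n : ℝ) := Nat.cast_nonneg _
    linarith
  have key : ∀ n : ℕ, t ^ n / ((Nat.factorial n : ℂ) * Complex.Gamma (ν + n + 1)) -
      (ν + 1) * (t ^ n / ((Nat.factorial n : ℂ) * Complex.Gamma (ν + 1 + n + 1))) =
      n * t ^ n / ((Nat.factorial n : ℂ) * Complex.Gamma (ν + 1 + n + 1)) := by
    intro n
    have h2 : ((Nat.factorial n : ℕ) : ℂ) ≠ 0 := Nat.cast_ne_zero.2 (Nat.factorial_ne_zero n)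
    have h3 := Gamma_add_ne_zero hν n
    have h4 := hne n
    rw [hG]
    field_simp
    ring
  have e1 : besselE ν t - (ν + 1) * besselE (ν + 1) t =
      ∑' n : ℕ, n * t ^ n / ((Nat.factorial n : ℂ) * Complex.Gamma (ν + 1 + n + 1)) := by
    rw [besselE, besselE, ← tsum_mul_left, ← s0.tsum_sub (s1.mul_left _)]
    exact tsum_congr key
  have hs : Summable fun n : ℕ =>
      n * t ^ n / ((Nat.factorial n : ℂ) * Complex.Gamma (ν + 1 + n + 1)) :=
    (s0.sub (s1.mul_left (ν + 1))).congr key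
  have e2 : ∑' n : ℕ, n * t ^ n / ((Nat.factorial n : ℂ) * Complex.Gamma (ν + 1 + n + 1)) =
      t * besselE (ν + 2) t := by
    rw [hs.tsum_eq_zero_add, besselE, ← tsum_mul_left]
    simp only [Nat.cast_zero, zero_mul, zero_div, zero_add]
    refine tsum_congr fun n => ?_
    have h1 : ((n : ℂ) + 1) ≠ 0 := Nat.cast_add_one_ne_zero n
    have h2 : ((Nat.factorial n : ℕ) : ℂ) ≠ 0 := Nat.cast_ne_zero.2 (Nat.factorial_ne_zero n)
    rw [Nat.factorial_succ]
    push_cast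
    rw [show ν + 1 + (n + 1) + 1 = ν + 2 + n + 1 by ring, mul_assoc,
      mul_div_mul_left _ _ h1, pow_succ]
    ring
  rw [← e2, ← e1]; ring

/-- All multivaluedness sits in a single power, and the remaining factor is entire in z². -/
lemma besselI_eq (ν : ℂ) {z : ℂ} (hz : z ≠ 0) :
    besselI ν z = (Real.sqrt Real.pi : ℂ) * (z / 2) ^ (ν + 1 / 2) * besselE ν ((z / 2) ^ 2) := by
  have h2 : z / 2 ≠ 0 := div_ne_zero hz two_ne_zero
  rw [besselI, besselE, ← tsum_mul_left]
  refine tsum_congr fun n => ?_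
  rw [show 2 * (n : ℂ) + ν + 1 / 2 = (ν + 1 / 2) + ((2 * n : ℕ) : ℂ) by push_cast; ring,
    Complex.cpow_add _ _ h2, Complex.cpow_natCast, pow_mul]
  ring

lemma half_mem_slitPlane {z : ℂ} (hz : z ∈ Complex.slitPlane) : z / 2 ∈ Complex.slitPlane := by
  rw [Complex.mem_slitPlane_iff] at hz ⊢
  have h1 : (z / 2).re = z.re / 2 := by simp
  have h2 : (z / 2).im = z.im / 2 := by simp
  rw [h1, h2]
  rcases hz with h | h
  · left; linarith
  · right; intro h'; apply h; linarith

lemma hasDerivAt_besselI {ν : ℂ} (hν : -1 < ν.re) {z : ℂ} (hz : z ∈ Complex.slitPlane) :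
    HasDerivAt (besselI ν) (besselI (ν + 1) z + (ν + 1 / 2) / z * besselI ν z) z := by
  have hz0 : z ≠ 0 := Complex.slitPlane_ne_zero hz
  have h2 : z / 2 ≠ 0 := div_ne_zero hz0 two_ne_zero
  have hd : HasDerivAt (fun w : ℂ => w / 2) (1 / 2) z := (hasDerivAt_id z).div_const 2
  have h1 := hd.cpow_const (c := ν + 1 / 2) (half_mem_slitPlane hz)
  have h3 : HasDerivAt (fun w => besselE ν ((w / 2) ^ 2))
      (besselE (ν + 1) ((z / 2) ^ 2) * (z / 2)) z := by
    refine (HasDerivAt.comp z (h₂ := besselE ν) (h := fun w => (w / 2) ^ 2)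
      (hasDerivAt_besselE hν ((z / 2) ^ 2)) (hd.fun_pow 2)).congr_deriv ?_
    norm_num
    left; ring
  have h4 := (h1.const_mul (Real.sqrt Real.pi : ℂ)).mul h3
  have h5 : besselI ν =ᶠ[𝓝 z] fun w => (Real.sqrt Real.pi : ℂ) * (w / 2) ^ (ν + 1 / 2) *
      besselE ν ((w / 2) ^ 2) := by
    filter_upwards [isOpen_ne.mem_nhds hz0] with w hw using besselI_eq ν hw
  refine (h4.congr_of_eventuallyEq h5).congr_deriv ?_
  rw [besselI_eq _ hz0, besselI_eq _ hz0, Complex.cpow_sub _ _ h2,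
    show ν + 1 + 1 / 2 = ν + 1 / 2 + 1 by ring, Complex.cpow_add (ν + 1 / 2) 1 h2, Complex.cpow_one]
  generalize (z / 2) ^ (ν + 1 / 2) = A
  generalize besselE ν ((z / 2) ^ 2) = B
  generalize besselE (ν + 1) ((z / 2) ^ 2) = D
  field_simp
  ring

lemma besselI_recurrence {ν : ℂ} (hν : -1 < ν.re) {z : ℂ} (hz0 : z ≠ 0) :
    besselI ν z = besselI (ν + 2) z + 2 * (ν + 1) / z * besselI (ν + 1) z := by
  have h2 : z / 2 ≠ 0 := div_ne_zero hz0 two_ne_zero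
  rw [besselI_eq _ hz0, besselI_eq _ hz0, besselI_eq _ hz0, besselE_recurrence hν,
    show ν + 1 + 1 / 2 = ν + 1 / 2 + 1 by ring,
    show ν + 2 + 1 / 2 = ν + 1 / 2 + 1 + 1 by ring, Complex.cpow_add (ν + 1 / 2 + 1) 1 h2,
    Complex.cpow_add (ν + 1 / 2) 1 h2, Complex.cpow_one]
  generalize (z / 2) ^ (ν + 1 / 2) = A
  generalize besselE (ν + 1) ((z / 2) ^ 2) = B
  generalize besselE (ν + 2) ((z / 2) ^ 2) = D
  field_simp
  ring

/-- The derivative formula at order ν + 1 produces order ν + 2, which the recurrence removes. The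
orders ν and ν + 1 thus form a closed first order system. -/
lemma hasDerivAt_besselI_succ {ν : ℂ} (hν : -1 < ν.re) {z : ℂ} (hz : z ∈ Complex.slitPlane) :
    HasDerivAt (besselI (ν + 1)) (besselI ν z - (ν + 1 / 2) / z * besselI (ν + 1) z) z := by
  have hz0 : z ≠ 0 := Complex.slitPlane_ne_zero hz
  refine (hasDerivAt_besselI (ν := ν + 1) (by simp; linarith) hz).congr_deriv ?_
  rw [besselI_recurrence hν hz0, show ν + 1 + 1 = ν + 2 by ring]
  field_simp
  ring

lemma norm_cpow_le_exp (z w : ℂ) (hz : z ≠ 0) :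
    ‖z ^ w‖ ≤ ‖z‖ ^ w.re * Real.exp (Real.pi * |w.im|) := by
  rw [Complex.norm_cpow_of_ne_zero hz, div_eq_mul_inv, ← Real.exp_neg]
  gcongr
  calc -(z.arg * w.im) ≤ |z.arg * w.im| := neg_le_abs _
    _ = |z.arg| * |w.im| := abs_mul _ _
    _ ≤ _ := by gcongr; exact Complex.abs_arg_le_pi z

lemma exists_norm_besselI_le_small {ν : ℂ} (hν : -1 < ν.re) :
    ∃ C : ℝ, 0 < C ∧ ∀ z : ℂ, z ≠ 0 → ‖z‖ ≤ 1 → ‖besselI ν z‖ ≤ C * ‖z‖ ^ (1 / 2 + ν.re) := by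
  obtain ⟨C, hC0, hC⟩ := exists_norm_besselE_le hν
  refine ⟨Real.sqrt Real.pi * ((1 / 2) ^ (1 / 2 + ν.re) * Real.exp (Real.pi * |ν.im|)) *
    (C * Real.exp 1), by positivity, fun z hz0 hz1 => ?_⟩
  have h2 : z / 2 ≠ 0 := div_ne_zero hz0 two_ne_zero
  rw [besselI_eq _ hz0, norm_mul, norm_mul]
  have e1 : ‖((Real.sqrt Real.pi : ℝ) : ℂ)‖ = Real.sqrt Real.pi := by
    rw [Complex.norm_real, Real.norm_of_nonneg (Real.sqrt_nonneg _)]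
  have e2 := norm_cpow_le_exp (z / 2) (ν + 1 / 2) h2
  have e3 : (ν + 1 / 2).re = 1 / 2 + ν.re := by simp; ring
  have e4 : (ν + 1 / 2).im = ν.im := by simp
  have e5 : ‖z / 2‖ = 1 / 2 * ‖z‖ := by simp; ring
  rw [e3, e4, e5, Real.mul_rpow (by norm_num) (norm_nonneg _)] at e2
  have e6 : ‖besselE ν ((z / 2) ^ 2)‖ ≤ C * Real.exp 1 := by
    refine (hC _).trans ?_
    gcongr
    rw [norm_pow, e5]
    nlinarith [norm_nonneg z]
  rw [e1]
  calc _ ≤ Real.sqrt Real.pi * ((1 / 2) ^ (1 / 2 + ν.re) * ‖z‖ ^ (1 / 2 + ν.re) *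
        Real.exp (Real.pi * |ν.im|)) * (C * Real.exp 1) := by gcongr
    _ = _ := by ring

/-! ### The Macdonald function in the open half-plane -/

lemma mul_ofReal_cpow {z : ℂ} (hz : z ≠ 0) {r : ℝ} (hr : 0 < r) (s : ℂ) :
    (z * r) ^ s = z ^ s * (r : ℂ) ^ s := by
  have hr0 : (r : ℂ) ≠ 0 := Complex.ofReal_ne_zero.2 hr.ne'
  rw [Complex.cpow_def_of_ne_zero (mul_ne_zero hz hr0), Complex.cpow_def_of_ne_zero hz,
    Complex.cpow_def_of_ne_zero hr0, Complex.log_mul_ofReal r hr z hz, ← Complex.exp_add,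
    ← Complex.ofReal_log hr.le]
  congr 1; ring

lemma ofReal_cpow_half {r : ℝ} (hr : 0 ≤ r) : (r : ℂ) ^ (1 / 2 : ℂ) = (Real.sqrt r : ℂ) := by
  rw [Real.sqrt_eq_rpow, Complex.ofReal_cpow hr]; norm_num

lemma one_add_sq_le_cosh (t : ℝ) : 1 + t ^ 2 / 2 ≤ Real.cosh t := by
  have h1 : Real.cosh t = 1 + 2 * Real.sinh (t / 2) ^ 2 := by
    have := Real.cosh_two_mul (t / 2)
    rw [show 2 * (t / 2) = t by ring, Real.cosh_sq] at this
    rw [this]; ring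
  have h2 : (t / 2) ^ 2 ≤ Real.sinh (t / 2) ^ 2 := by
    rw [sq_le_sq]
    rcases le_total 0 (t / 2) with h | h
    · rw [abs_of_nonneg h, abs_of_nonneg (Real.sinh_nonneg_iff.2 h)]
      exact Real.self_le_sinh_iff.2 h
    · rw [abs_of_nonpos h, abs_of_nonpos (Real.sinh_nonpos_iff.2 h)]
      linarith [Real.sinh_le_self_iff.2 h]
  rw [h1]; nlinarith

lemma integrable_exp_quadratic {b : ℝ} (hb : 0 < b) (c : ℝ) :
    Integrable fun t : ℝ => Real.exp (-b * t ^ 2 + c * t) := by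
  have := (integrable_cexp_quadratic (b := (b : ℂ)) (by simpa using hb) (c : ℂ) 0).norm
  refine this.congr (Eventually.of_forall fun t => ?_)
  simp only [Complex.norm_exp]
  congr 1
  have : -(b : ℂ) * (t : ℂ) ^ 2 + c * t + 0 = ((-b * t ^ 2 + c * t : ℝ) : ℂ) := by push_cast; ring
  rw [this, Complex.ofReal_re]

/-- The integrand `exp (-z cosh t - m t)`. -/
def macIntegrand (m z : ℂ) (t : ℝ) : ℂ :=
  Complex.exp (-z * Real.cosh t - m * t)

/-- `∫ exp (-z cosh t - m t) dt`, twice the Macdonald function. -/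
def macF (m z : ℂ) : ℂ := ∫ t : ℝ, macIntegrand m z t

lemma norm_macIntegrand (m z : ℂ) (t : ℝ) :
    ‖macIntegrand m z t‖ = Real.exp (-z.re * Real.cosh t - m.re * t) := by
  rw [macIntegrand, Complex.norm_exp]
  congr 1
  simp [-Complex.ofReal_cosh]

lemma continuous_macIntegrand (m z : ℂ) : Continuous (macIntegrand m z) := by
  unfold macIntegrand
  have := Real.continuous_cosh
  fun_prop

lemma integrable_macIntegrand (m : ℂ) {z : ℂ} (hz : 0 < z.re) : Integrable (macIntegrand m z) := by
  refine Integrable.mono' (integrable_exp_quadratic (b := z.re / 2) (by positivity) (-m.re))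
    (continuous_macIntegrand m z).aestronglyMeasurable (Eventually.of_forall fun t => ?_)
  rw [norm_macIntegrand]
  apply Real.exp_le_exp.2
  have := one_add_sq_le_cosh t
  nlinarith

lemma macIntegrand_shift (m z : ℂ) (t : ℝ) :
    macIntegrand (m - 1) z t = Complex.exp t * macIntegrand m z t ∧
    macIntegrand (m + 1) z t = Complex.exp (-t) * macIntegrand m z t := by
  constructor <;> rw [macIntegrand, macIntegrand, ← Complex.exp_add] <;> congr 1 <;> ring

lemma macIntegrand_cosh (m z : ℂ) (t : ℝ) :
    (Real.cosh t : ℂ) * macIntegrand m z t =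
      1 / 2 * (macIntegrand (m - 1) z t + macIntegrand (m + 1) z t) := by
  rw [(macIntegrand_shift m z t).1, (macIntegrand_shift m z t).2, Complex.ofReal_cosh, Complex.cosh]
  ring

lemma macIntegrand_sinh (m z : ℂ) (t : ℝ) :
    (Real.sinh t : ℂ) * macIntegrand m z t =
      1 / 2 * (macIntegrand (m - 1) z t - macIntegrand (m + 1) z t) := by
  rw [(macIntegrand_shift m z t).1, (macIntegrand_shift m z t).2, Complex.ofReal_sinh, Complex.sinh]
  ring

/-- Differentiation under the integral brings down -cosh t, which splits into shifts of m by ±1. For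
Re w > Re z / 2 all integrands are dominated by those at the real point Re z / 2. -/
lemma hasDerivAt_macF_symm (m : ℂ) {z : ℂ} (hz : 0 < z.re) :
    HasDerivAt (macF m) (-(1 / 2) * (macF (m - 1) z + macF (m + 1) z)) z := by
  set a : ℂ := ((z.re / 2 : ℝ) : ℂ) with ha
  have ha0 : 0 < a.re := by simp [ha]; positivity
  have h := hasDerivAt_integral_of_dominated_loc_of_deriv_le (μ := volume) (𝕜 := ℂ)
    (F := fun w t => macIntegrand m w t) (F' := fun w t => -(Real.cosh t : ℂ) * macIntegrand m w t)
    (x₀ := z) (s := {w : ℂ | z.re / 2 < w.re})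
    (bound := fun t => ‖macIntegrand (m - 1) a t‖ + ‖macIntegrand (m + 1) a t‖)
    ((isOpen_lt continuous_const Complex.continuous_re).mem_nhds (by
      show z.re / 2 < z.re; linarith))
    (Eventually.of_forall fun w => (continuous_macIntegrand m w).aestronglyMeasurable)
    (integrable_macIntegrand m hz) ?_ ?_ ?_ ?_
  · refine h.2.congr_deriv ?_
    rw [macF, macF, ← integral_add (integrable_macIntegrand _ hz) (integrable_macIntegrand _ hz),
      ← integral_const_mul]
    congr 1; ext t
    rw [neg_mul, macIntegrand_cosh]; ring
  · have := Real.continuous_cosh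
    have := continuous_macIntegrand m z
    exact (by fun_prop : Continuous _).aestronglyMeasurable
  · refine Eventually.of_forall fun t w hw => ?_
    have hw' : z.re / 2 < w.re := hw
    rw [neg_mul, norm_neg, macIntegrand_cosh, norm_mul]
    have h1 : ∀ m' : ℂ, ‖macIntegrand m' w t‖ ≤ ‖macIntegrand m' a t‖ := by
      intro m'
      rw [norm_macIntegrand, norm_macIntegrand]
      apply Real.exp_le_exp.2
      have : a.re = z.re / 2 := by simp [ha]
      rw [this]
      nlinarith [Real.cosh_pos t]
    have h2 : ‖(1 / 2 : ℂ)‖ ≤ 1 := by norm_num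
    calc _ ≤ 1 * ‖macIntegrand (m - 1) w t + macIntegrand (m + 1) w t‖ := by gcongr
      _ ≤ ‖macIntegrand (m - 1) w t‖ + ‖macIntegrand (m + 1) w t‖ := by
          rw [one_mul]; exact norm_add_le _ _
      _ ≤ _ := add_le_add (h1 _) (h1 _)
  · exact (integrable_macIntegrand _ ha0).norm.add (integrable_macIntegrand _ ha0).norm
  · refine Eventually.of_forall fun t w _ => ?_
    have h1 : HasDerivAt (fun w : ℂ => -w * Real.cosh t - m * t) (-(Real.cosh t : ℂ)) w := by
      simpa using ((hasDerivAt_id w).neg.mul_const (Real.cosh t : ℂ)).sub_const (m * t)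
    refine h1.cexp.congr_deriv ?_
    rw [macIntegrand]; ring

/-- The integral over ℝ of the t-derivative of the integrand vanishes. -/
lemma macF_recurrence (m : ℂ) {z : ℂ} (hz : 0 < z.re) :
    z * (macF (m + 1) z - macF (m - 1) z) = 2 * m * macF m z := by
  have hd : ∀ t : ℝ, HasDerivAt (macIntegrand m z)
      (-z * (1 / 2 * (macIntegrand (m - 1) z t - macIntegrand (m + 1) z t))
        - m * macIntegrand m z t) t := by
    intro t
    have h1 : HasDerivAt (fun t : ℝ => -z * (Real.cosh t : ℂ) - m * t)
        (-z * (Real.sinh t : ℂ) - m) t := by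
      have h2 := (Real.hasDerivAt_cosh t).ofReal_comp.const_mul (-z)
      have h3 := (hasDerivAt_id t).ofReal_comp.const_mul m
      simpa using h2.fun_sub h3
    refine h1.cexp.congr_deriv ?_
    rw [← macIntegrand_sinh, macIntegrand]; ring
  have i1 := integrable_macIntegrand (m - 1) hz
  have i2 := integrable_macIntegrand (m + 1) hz
  have i0 := integrable_macIntegrand m hz
  have i12 : Integrable fun t => macIntegrand (m - 1) z t - macIntegrand (m + 1) z t := i1.sub i2
  have h := integral_eq_zero_of_hasDerivAt_of_integrable hd
    ((i12.const_mul (1 / 2)).const_mul (-z) |>.sub (i0.const_mul m)) i0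
  rw [integral_sub ((i12.const_mul (1 / 2)).const_mul (-z)) (i0.const_mul m),
    integral_const_mul, integral_const_mul, integral_const_mul, integral_sub i1 i2] at h
  simp only [macF]
  linear_combination 2 * h

lemma macF_neg (m z : ℂ) : macF (-m) z = macF m z := by
  rw [macF, macF, ← integral_neg_eq_self]
  congr 1; ext t
  simp only [macIntegrand, Real.cosh_neg]
  congr 1; push_cast; ring

lemma hasDerivAt_macF (m : ℂ) {z : ℂ} (hz : 0 < z.re) :
    HasDerivAt (macF m) (-macF (m + 1) z + m / z * macF m z) z := by
  have hz0 : z ≠ 0 := by rintro rfl; simp at hz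
  refine (hasDerivAt_macF_symm m hz).congr_deriv ?_
  have h := macF_recurrence m hz
  field_simp
  linear_combination h

lemma integral_Ioi_eq_integral_exp (g : ℝ → ℂ) :
    ∫ s in Ioi (0 : ℝ), g s = ∫ t : ℝ, (Real.exp t : ℂ) * g (Real.exp t) := by
  have h := integral_image_eq_integral_abs_deriv_smul (s := univ) (f := Real.exp)
    (f' := Real.exp) MeasurableSet.univ
    (fun x _ => (Real.hasDerivAt_exp x).hasDerivWithinAt) Real.exp_injective.injOn g
  rw [image_univ, Real.range_exp, setIntegral_univ] at h
  rw [h]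
  congr 1; ext t
  rw [abs_of_pos (Real.exp_pos t), Complex.real_smul]

lemma integrableOn_Ioi_iff_integrable_exp (g : ℝ → ℂ) :
    IntegrableOn g (Ioi 0) ↔ Integrable fun t : ℝ => (Real.exp t : ℂ) * g (Real.exp t) := by
  have h := integrableOn_image_iff_integrableOn_abs_deriv_smul (s := univ) (f := Real.exp)
    (f' := Real.exp) MeasurableSet.univ
    (fun x _ => (Real.hasDerivAt_exp x).hasDerivWithinAt) Real.exp_injective.injOn g
  rw [image_univ, Real.range_exp, integrableOn_univ] at h
  rw [h]
  refine integrable_congr (Eventually.of_forall fun t => ?_)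
  simp only
  rw [abs_of_pos (Real.exp_pos t), Complex.real_smul]

lemma ofReal_exp_cpow (t : ℝ) (s : ℂ) : ((Real.exp t : ℝ) : ℂ) ^ s = Complex.exp (s * t) := by
  rw [Complex.cpow_def_of_ne_zero (Complex.ofReal_ne_zero.2 (Real.exp_pos t).ne'),
    ← Complex.ofReal_log (Real.exp_pos t).le, Real.log_exp, mul_comm]

/-- The substitution s = exp t symmetrizes the exponent into z cosh t; reflection in t then shows
evenness in the order. -/
lemma macdonaldIntegral_eq (m z : ℂ) :
    macdonaldIntegral m z = z ^ (1 / 2 : ℂ) / (Real.sqrt (2 * Real.pi) : ℂ) * macF m z := by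
  rw [macdonaldIntegral, macF, integral_Ioi_eq_integral_exp]
  congr 2; ext t
  rw [ofReal_exp_cpow, Complex.ofReal_exp, ← Complex.exp_neg, ← Complex.exp_add, ← Complex.exp_add,
    macIntegrand, Complex.ofReal_cosh, Complex.cosh]
  congr 1; ring

lemma macdonaldIntegral_neg (m z : ℂ) : macdonaldIntegral (-m) z = macdonaldIntegral m z := by
  rw [macdonaldIntegral_eq, macdonaldIntegral_eq, macF_neg]

lemma hasDerivAt_macdonaldIntegral (m : ℂ) {z : ℂ} (hz : 0 < z.re) :
    HasDerivAt (macdonaldIntegral m)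
      (-macdonaldIntegral (m + 1) z + (m + 1 / 2) / z * macdonaldIntegral m z) z := by
  have hz0 : z ≠ 0 := by rintro rfl; simp at hz
  have h1 := ((hasDerivAt_id z).cpow_const (c := (1 / 2 : ℂ)) (Or.inl hz)).div_const
    (Real.sqrt (2 * Real.pi) : ℂ)
  have h2 := h1.mul (hasDerivAt_macF m hz)
  have h3 : macdonaldIntegral m = fun z => z ^ (1 / 2 : ℂ) / (Real.sqrt (2 * Real.pi) : ℂ) *
    macF m z := funext fun z => macdonaldIntegral_eq m z
  rw [h3]
  refine h2.congr_deriv ?_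
  simp only [id, macdonaldIntegral_eq, Complex.cpow_sub _ _ hz0, Complex.cpow_one]
  field_simp
  ring

lemma tendsto_mul_cosh_sub_one (τ : ℝ) :
    Tendsto (fun r : ℝ => r * (Real.cosh (τ / Real.sqrt r) - 1)) atTop (𝓝 (τ ^ 2 / 2)) := by
  have h1 : Tendsto (fun r : ℝ => τ ^ 2 / 2 + (τ ^ 2 / 2) ^ 2 / r) atTop (𝓝 (τ ^ 2 / 2 + 0)) :=
    tendsto_const_nhds.add (tendsto_const_nhds.div_atTop tendsto_id)
  rw [add_zero] at h1
  refine tendsto_of_tendsto_of_tendsto_of_le_of_le' tendsto_const_nhds h1 ?_ ?_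
  · filter_upwards [eventually_gt_atTop 0] with r hr
    have h2 := one_add_sq_le_cosh (τ / Real.sqrt r)
    rw [div_pow, Real.sq_sqrt hr.le] at h2
    calc τ ^ 2 / 2 = r * (τ ^ 2 / r / 2) := by field_simp
      _ ≤ _ := by gcongr; linarith
  · filter_upwards [eventually_gt_atTop 0, eventually_ge_atTop (τ ^ 2 / 2)] with r hr hr2
    have h2 := Real.cosh_le_exp_half_sq (τ / Real.sqrt r)
    rw [div_pow, Real.sq_sqrt hr.le] at h2
    have h3 : |τ ^ 2 / r / 2| ≤ 1 := by
      rw [abs_of_nonneg (by positivity), div_div, div_le_one (by positivity)]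
      linarith
    have h4 := (abs_le.1 (Real.abs_exp_sub_one_sub_id_le h3)).2
    calc r * (Real.cosh (τ / Real.sqrt r) - 1)
        ≤ r * (τ ^ 2 / r / 2 + (τ ^ 2 / r / 2) ^ 2) := by gcongr; linarith
      _ = _ := by field_simp

/-- Laplace's method: with t = τ/√r the exponent r(cosh t - 1) tends to τ²/2 and a Gaussian integral
remains. The limit is taken along one ray at a time; uniformity in the direction is obtained later
from the differential equation. -/
lemma tendsto_exp_mul_macdonaldIntegral (m : ℂ) {ω : ℂ} (hω : 0 < ω.re) :
    Tendsto (fun r : ℝ => Complex.exp (ω * r) * macdonaldIntegral m (ω * r)) atTop (𝓝 1) := by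
  have hω0 : ω ≠ 0 := by rintro rfl; simp at hω
  set G : ℝ → ℝ → ℂ := fun r τ =>
    Complex.exp (-ω * ((r * (Real.cosh (τ / Real.sqrt r) - 1) : ℝ) : ℂ)
      - m * ((τ / Real.sqrt r : ℝ) : ℂ)) with hG
  have hlim : Tendsto (fun r => ∫ τ, G r τ) atTop (𝓝 (∫ τ : ℝ, Complex.exp (-(ω / 2) * τ ^ 2))) := by
    -- The two Gaussians, with linear terms ±|Re m|τ, dominate for τ ≥ 0 and τ ≤ 0 respectively. The
    -- condition r ≥ 1 gives |τ|/√r ≤ |τ|.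
    refine tendsto_integral_filter_of_dominated_convergence
      (fun τ => Real.exp (-(ω.re / 2) * τ ^ 2 + |m.re| * τ) +
        Real.exp (-(ω.re / 2) * τ ^ 2 + -|m.re| * τ)) ?_ ?_ ?_ ?_
    · refine Eventually.of_forall fun r => ?_
      have := Real.continuous_cosh
      exact (by simp only [hG]; fun_prop : Continuous (G r)).aestronglyMeasurable
    · filter_upwards [eventually_ge_atTop 1] with r hr
      refine Eventually.of_forall fun τ => ?_
      have hr0 : 0 < r := by linarith
      simp only [hG, Complex.norm_exp]
      have e1 : (-ω * ((r * (Real.cosh (τ / Real.sqrt r) - 1) : ℝ) : ℂ)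
          - m * ((τ / Real.sqrt r : ℝ) : ℂ)).re =
          -ω.re * (r * (Real.cosh (τ / Real.sqrt r) - 1)) - m.re * (τ / Real.sqrt r) := by
        rw [Complex.sub_re, Complex.re_mul_ofReal, Complex.re_mul_ofReal, Complex.neg_re]
      rw [e1]
      have h2 := one_add_sq_le_cosh (τ / Real.sqrt r)
      rw [div_pow, Real.sq_sqrt hr0.le] at h2
      have h3 : τ ^ 2 / 2 ≤ r * (Real.cosh (τ / Real.sqrt r) - 1) := by
        calc τ ^ 2 / 2 = r * (τ ^ 2 / r / 2) := by field_simp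
          _ ≤ _ := by gcongr; linarith
      have h4 : -(m.re * (τ / Real.sqrt r)) ≤ |m.re| * |τ| := by
        refine (neg_le_abs _).trans ?_
        rw [abs_mul, abs_div, abs_of_nonneg (Real.sqrt_nonneg r)]
        gcongr
        exact div_le_self (abs_nonneg _) (Real.one_le_sqrt.2 hr)
      have h5 : -ω.re * (r * (Real.cosh (τ / Real.sqrt r) - 1)) - m.re * (τ / Real.sqrt r) ≤
          -(ω.re / 2) * τ ^ 2 + |m.re| * |τ| := by nlinarith
      rcases le_total 0 τ with h | h
      · rw [abs_of_nonneg h] at h5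
        exact (Real.exp_le_exp.2 h5).trans (le_add_of_nonneg_right (Real.exp_pos _).le)
      · rw [abs_of_nonpos h] at h5
        refine (Real.exp_le_exp.2 (h5.trans (le_of_eq ?_))).trans
          (le_add_of_nonneg_left (Real.exp_pos _).le)
        ring
    · exact (integrable_exp_quadratic (by positivity) _).add
        (integrable_exp_quadratic (by positivity) _)
    · refine Eventually.of_forall fun τ => ?_
      have h1 := (Complex.continuous_ofReal.tendsto _).comp (tendsto_mul_cosh_sub_one τ)
      have h2 : Tendsto (fun r : ℝ => τ / Real.sqrt r) atTop (𝓝 0) :=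
        tendsto_const_nhds.div_atTop Real.tendsto_sqrt_atTop
      have h3 := (Complex.continuous_ofReal.tendsto _).comp h2
      have h4 := ((h1.const_mul (-ω)).sub (h3.const_mul m)).cexp
      have e : -ω * ((τ ^ 2 / 2 : ℝ) : ℂ) - m * ((0 : ℝ) : ℂ) = -(ω / 2) * (τ : ℂ) ^ 2 := by
        push_cast; ring
      rw [e] at h4
      exact h4
  have hval : ω ^ (1 / 2 : ℂ) / (Real.sqrt (2 * Real.pi) : ℂ) *
      ∫ τ : ℝ, Complex.exp (-(ω / 2) * τ ^ 2) = 1 := by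
    have hre : 0 < (ω / 2).re := by simp; exact hω
    have h2pi : (0 : ℝ) < 2 * Real.pi := by positivity
    rw [integral_gaussian_complex hre,
      show (Real.pi : ℂ) / (ω / 2) = ω⁻¹ * ((2 * Real.pi : ℝ) : ℂ) by push_cast; field_simp,
      mul_ofReal_cpow (inv_ne_zero hω0) h2pi, Complex.inv_cpow _ _ (by
        intro h
        have := (Complex.arg_eq_pi_iff.1 h).1
        linarith), ofReal_cpow_half h2pi.le]
    have h1 : ω ^ (1 / 2 : ℂ) ≠ 0 := by simp [Complex.cpow_eq_zero_iff, hω0]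
    have h2 : (Real.sqrt (2 * Real.pi) : ℂ) ≠ 0 :=
      Complex.ofReal_ne_zero.2 (Real.sqrt_pos.2 h2pi).ne'
    field_simp
  have hfin := hlim.const_mul (ω ^ (1 / 2 : ℂ) / (Real.sqrt (2 * Real.pi) : ℂ))
  rw [hval] at hfin
  refine hfin.congr' ?_
  filter_upwards [eventually_gt_atTop 0] with r hr
  have hs : 0 < Real.sqrt r := Real.sqrt_pos.2 hr
  have h1 : Complex.exp (ω * r) * ((Real.sqrt r : ℂ) * macF m (ω * r)) = ∫ τ, G r τ := by
    have h2 := Measure.integral_comp_div (macIntegrand m (ω * r)) (Real.sqrt r)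
    rw [abs_of_pos hs, Complex.real_smul] at h2
    rw [macF, ← h2, ← integral_const_mul]
    congr 1; ext τ
    rw [macIntegrand, ← Complex.exp_add]
    simp only [hG]
    congr 1; push_cast; ring
  rw [← h1, macdonaldIntegral_eq, mul_ofReal_cpow hω0 hr, ofReal_cpow_half hr.le]
  ring

lemma integrable_exp_sub_exp {μ : ℂ} (hμ : 0 < μ.re) :
    Integrable (fun t : ℝ => Complex.exp (-(Real.exp t : ℂ) + μ * t)) ∧
    ∫ t : ℝ, Complex.exp (-(Real.exp t : ℂ) + μ * t) = Complex.Gamma μ := by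
  have e : (fun t : ℝ => (Real.exp t : ℂ) *
      (((Real.exp (-Real.exp t) : ℝ) : ℂ) * ((Real.exp t : ℝ) : ℂ) ^ (μ - 1))) =
      fun t : ℝ => Complex.exp (-(Real.exp t : ℂ) + μ * t) := by
    ext t
    rw [ofReal_exp_cpow, Complex.ofReal_exp t, Complex.ofReal_exp, ← Complex.exp_add,
      ← Complex.exp_add]
    congr 1; push_cast; ring
  constructor
  · have := (integrableOn_Ioi_iff_integrable_exp _).1 (Complex.GammaIntegral_convergent hμ)
    rwa [e] at this
  · rw [Complex.Gamma_eq_integral hμ, Complex.GammaIntegral, integral_Ioi_eq_integral_exp, e]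

/-- Translating t by log(x/2) turns x cosh t into exp(t) + (x²/4) exp(-t). The second term
disappears as x → 0 and leaves the Gamma integral. -/
lemma tendsto_cpow_mul_macF {μ : ℂ} (hμ : 0 < μ.re) :
    Tendsto (fun x : ℝ => (x / 2 : ℂ) ^ μ * macF μ x) (𝓝[>] 0) (𝓝 (Complex.Gamma μ)) := by
  obtain ⟨hi, hv⟩ := integrable_exp_sub_exp hμ
  rw [← hv]
  have hlim : Tendsto (fun x : ℝ => ∫ t : ℝ, Complex.exp (-(Real.exp t : ℂ)
      - ((x ^ 2 / 4 * Real.exp (-t) : ℝ) : ℂ) + μ * t)) (𝓝[>] 0)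
      (𝓝 (∫ t : ℝ, Complex.exp (-(Real.exp t : ℂ) + μ * t))) := by
    refine tendsto_integral_filter_of_dominated_convergence
      (fun t => ‖Complex.exp (-(Real.exp t : ℂ) + μ * t)‖) ?_ ?_ hi.norm ?_
    · exact Eventually.of_forall fun x => (by fun_prop : Continuous _).aestronglyMeasurable
    · refine Eventually.of_forall fun x => Eventually.of_forall fun t => ?_
      rw [Complex.norm_exp, Complex.norm_exp]
      apply Real.exp_le_exp.2
      simp only [Complex.add_re, Complex.sub_re, Complex.ofReal_re]
      have : 0 ≤ x ^ 2 / 4 * Real.exp (-t) := by positivity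
      linarith
    · refine Eventually.of_forall fun t => ?_
      have h1 : Continuous fun x : ℝ => Complex.exp (-(Real.exp t : ℂ)
        - ((x ^ 2 / 4 * Real.exp (-t) : ℝ) : ℂ) + μ * t) := by fun_prop
      have h2 := (h1.tendsto 0).mono_left (nhdsWithin_le_nhds (s := Ioi 0))
      simpa using h2
  refine hlim.congr' ?_
  filter_upwards [self_mem_nhdsWithin] with x hx
  have hx0 : (0 : ℝ) < x / 2 := by have : (0 : ℝ) < x := hx; linarith
  rw [← macF_neg, macF, ← integral_add_right_eq_self (macIntegrand (-μ) x) (-Real.log (x / 2)),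
    ← integral_const_mul]
  congr 1; ext t
  have e1 : (x / 2 : ℂ) ^ μ = Complex.exp (μ * Real.log (x / 2)) := by
    rw [show (x / 2 : ℂ) = ((x / 2 : ℝ) : ℂ) by push_cast; ring,
      Complex.cpow_def_of_ne_zero (Complex.ofReal_ne_zero.2 hx0.ne'),
      ← Complex.ofReal_log hx0.le, mul_comm]
  have e2 : x * Real.cosh (t + -Real.log (x / 2)) = Real.exp t + x ^ 2 / 4 * Real.exp (-t) := by
    rw [Real.cosh_eq, neg_add, neg_neg, Real.exp_add, Real.exp_add, Real.exp_neg (Real.log _),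
      Real.exp_log hx0]
    have : (x : ℝ) ≠ 0 := (by linarith : (0 : ℝ) < x).ne'
    field_simp
    ring
  have e3 : (x : ℂ) * (Real.cosh (t + -Real.log (x / 2)) : ℂ) =
      (Real.exp t : ℂ) + ((x ^ 2 / 4 * Real.exp (-t) : ℝ) : ℂ) := by
    rw [← Complex.ofReal_mul, e2]; push_cast; ring
  rw [e1, macIntegrand, ← Complex.exp_add]
  congr 1
  rw [neg_mul, e3]; push_cast; ring

/-! ### A priori estimates for solutions of the perturbed equation -/

section Estimates

variable {P Q u u' v v' f f' : ℝ → ℂ} {U V ψ : ℝ → ℝ}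

lemma PairWeights.integrableOn_of_le_V (hUV : PairWeights u v U V)
    (hB : IsBasePair P u u' v v')
    (hQ : LocallyIntegrableOn Q (Ioi 0) volume) (hfc : ContinuousOn f (Ioi 0)) {x : ℝ} (hx : 0 < x)
    (hψ : IntegrableOn ψ (Ioi x) volume) (hψ' : ∀ y, x < y → 2 * (U y * V y * ‖Q y‖) ≤ ψ y)
    {K : ℝ} (hK : 0 ≤ K) (hfK : ∀ y, x < y → ‖f y‖ ≤ K * V y) :
    IntegrableOn (fun y => u y * (Q y * f y)) (Ioi x) volume ∧
      IntegrableOn (fun y => v y * (Q y * f y)) (Ioi x) volume := by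
  have hs : Ioi x ⊆ Ioi 0 := Ioi_subset_Ioi hx.le
  have hmeas : AEStronglyMeasurable (fun y => Q y * f y) (volume.restrict (Ioi 0)) :=
    hQ.aestronglyMeasurable.mul (hfc.aestronglyMeasurable measurableSet_Ioi)
  constructor
  · refine Integrable.mono' (hψ.const_mul K) ?_ ?_
    · exact (((continuousOn_of_hasDerivAt hB.solU.1).aestronglyMeasurable measurableSet_Ioi).mul
        hmeas).mono_set hs
    · filter_upwards [ae_restrict_mem measurableSet_Ioi] with y hy
      have hy0 : 0 < y := hs hy
      have h2 := hUV.posV y hy0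
      have h3 := hUV.posU y hy0
      have h5 : 0 ≤ U y * V y * ‖Q y‖ := by positivity
      rw [norm_mul, norm_mul]
      calc _ ≤ U y * (‖Q y‖ * (K * V y)) := by
            gcongr
            · exact hUV.leU y hy0
            · exact hfK y hy
        _ = K * (U y * V y * ‖Q y‖) := by ring
        _ ≤ K * ψ y := by gcongr; linarith [hψ' y hy]
  · refine Integrable.mono' (hψ.const_mul (K * (V x / U x))) ?_ ?_
    · exact (((continuousOn_of_hasDerivAt hB.solV.1).aestronglyMeasurable measurableSet_Ioi).mul
        hmeas).mono_set hs
    · filter_upwards [ae_restrict_mem measurableSet_Ioi] with y hy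
      have hy0 : 0 < y := hs hy
      have h2 := hUV.posV y hy0
      have h3 := hUV.posU y hy0
      have h2' := hUV.posV x hx
      have h3' := hUV.posU x hx
      have h5 : 0 ≤ U y * V y * ‖Q y‖ := by positivity
      have h6 : V y ≤ V x / U x * U y := by
        rw [div_mul_eq_mul_div, le_div_iff₀ h3']
        linarith [hUV.ratio x y hx (le_of_lt hy)]
      rw [norm_mul, norm_mul]
      calc _ ≤ V y * (‖Q y‖ * (K * V y)) := by
            gcongr
            · exact hUV.leV y hy0
            · exact hfK y hy
        _ ≤ V x / U x * U y * (‖Q y‖ * (K * V y)) := by gcongr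
        _ = K * (V x / U x) * (U y * V y * ‖Q y‖) := by ring
        _ ≤ K * (V x / U x) * ψ y := by gcongr; linarith [hψ' y hy]

/-- The a priori bound `K` only makes the integrals converge and starts the Grönwall iteration. The
conclusion depends on the data at ∞ and on ∫ψ alone, hence is uniform over families of solutions. -/
lemma IsBasePair.norm_le_infty (hB : IsBasePair P u u' v v') (hUV : PairWeights u v U V)
    (hQ : LocallyIntegrableOn Q (Ioi 0) volume) (hf : IsSol (fun x => P x + Q x) f f')
    {α β : ℂ} (hα : Tendsto (fun x => v x * f' x - v' x * f x) atTop (𝓝 α))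
    (hβ : Tendsto (fun x => f x * u' x - f' x * u x) atTop (𝓝 β)) {x₀ : ℝ} (hx₀ : 0 ≤ x₀)
    (hψ : IntegrableOn ψ (Ioi x₀) volume) (hψ' : ∀ y, x₀ < y → 2 * (U y * V y * ‖Q y‖) ≤ ψ y)
    {K C : ℝ} (hK : 0 ≤ K) (hfK : ∀ y, x₀ < y → ‖f y‖ ≤ K * V y) (hC : 0 ≤ C)
    (hf₀ : ∀ y, x₀ < y → ‖α * u y + β * v y‖ ≤ C * V y) :
    ∀ x, x₀ < x → ‖f x‖ ≤ 2 * C * Real.exp (2 * ∫ t in Ioi x₀, ψ t) * V x := by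
  have h0 : ∀ x ∈ Ioi x₀, 0 ≤ ψ x := fun y hy => by
    have hy0 : 0 < y := hx₀.trans_lt hy
    have h2 := hUV.posV y hy0
    have h3 := hUV.posU y hy0
    have h5 : 0 ≤ 2 * (U y * V y * ‖Q y‖) := by positivity
    linarith [hψ' y hy]
  obtain ⟨E, hE⟩ := exists_volterraWeight_right (T := Ioi x₀) (S := fun x => Ioi x)
    measurableSet_Ioi (fun x hx => by
      rw [inter_eq_right.2 (Ioi_subset_Ioi (le_of_lt hx))]) hψ h0
  refine hE.gronwall (N := fun x y => (v x * u y - u x * v y) * Q y) (K := K) hC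
    (fun x hx => (hUV.posV x (hx₀.trans_lt hx)).le) ?_ hK hfK ?_
  · intro x hx y hy
    have hx0 : 0 < x := hx₀.trans_lt hx
    have hy0 : 0 < y := hx0.trans hy
    have h2 := hUV.posV y hy0
    have h2' := hUV.posV x hx0
    have h3 := hUV.kernel_le hx0 (le_of_lt hy)
    rw [norm_mul, show v x * u y - u x * v y = u y * v x - v y * u x by ring]
    calc _ ≤ 2 * (U y * V x) * ‖Q y‖ * V y := by gcongr
      _ = V x * (2 * (U y * V y * ‖Q y‖)) := by ring
      _ ≤ _ := by gcongr; exact hψ' y (lt_trans hx hy)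
  · intro x hx
    have hx0 : 0 < x := hx₀.trans_lt hx
    have hi := hUV.integrableOn_of_le_V hB hQ hf.1.continuousOn hx0
      (hψ.mono_set (Ioi_subset_Ioi (le_of_lt hx))) (fun y hy => hψ' y (lt_trans hx hy)) hK
      (fun y hy => hfK y (lt_trans hx hy))
    have h1 := hB.eq_integral_Ioi hf hα hβ hx0 hi.1 hi.2
    have h2 : f x - ∫ y in Ioi x, (v x * u y - u x * v y) * Q y * f y = α * u x + β * v x := by
      linear_combination h1
    rw [h2]
    exact hf₀ x hx

lemma exists_norm_le_mul_of_continuousOn {g : ℝ → ℂ} {w : ℝ → ℝ} {a b : ℝ}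
    (hg : ContinuousOn g (Icc a b)) (hw : ContinuousOn w (Icc a b)) (hpos : ∀ x ∈ Icc a b, 0 < w x) :
    ∃ K : ℝ, 0 ≤ K ∧ ∀ x ∈ Icc a b, ‖g x‖ ≤ K * w x := by
  obtain ⟨K, hK⟩ := isCompact_Icc.exists_bound_of_continuousOn
    (hg.norm.div hw fun x hx => (hpos x hx).ne')
  refine ⟨max K 0, le_max_right _ _, fun x hx => ?_⟩
  have h1 := (le_abs_self _).trans ((hK x hx).trans (le_max_left K 0))
  exact (div_le_iff₀ (hpos x hx)).1 h1

/-- On a bounded interval (a, b] continuity provides an a priori bound, and the Grönwall constant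
does not depend on it or on b. Moving away from 0 the dominant weight is U. -/
lemma IsBasePair.norm_le_forward (hB : IsBasePair P u u' v v') (hUV : PairWeights u v U V)
    (hQ : LocallyIntegrableOn Q (Ioi 0) volume) (hf : IsSol (fun x => P x + Q x) f f')
    {a : ℝ} (ha : 0 < a) (hU : ContinuousOn U (Ioi 0))
    (hψ : IntegrableOn ψ (Ioi a) volume) (hψ' : ∀ y, a < y → 2 * (U y * V y * ‖Q y‖) ≤ ψ y)
    {C : ℝ} (hC : 0 ≤ C)
    (hf₀ : ∀ y, a < y → ‖(v a * f' a - v' a * f a) * u y + (f a * u' a - f' a * u a) * v y‖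
      ≤ C * U y) :
    ∀ x, a < x → ‖f x‖ ≤ 2 * C * Real.exp (2 * ∫ t in Ioi a, ψ t) * U x := by
  intro b hb
  have h0 : ∀ x ∈ Ioi a, 0 ≤ ψ x := fun y hy => by
    have hy0 : 0 < y := ha.trans hy
    have h2 := hUV.posV y hy0
    have h3 := hUV.posU y hy0
    have h5 : 0 ≤ 2 * (U y * V y * ‖Q y‖) := by positivity
    linarith [hψ' y hy]
  have hsub : Ioc a b ⊆ Ioi a := Ioc_subset_Ioi_self
  obtain ⟨E, hE⟩ := exists_volterraWeight_left (T := Ioc a b) (S := fun x => Ioc a x)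
    measurableSet_Ioc (fun x hx => by
      rw [Ioc_inter_Iic, min_eq_right hx.2]) (hψ.mono_set hsub) (fun x hx => h0 x (hsub hx))
  have hIcc : Icc a b ⊆ Ioi 0 := fun y hy => ha.trans_le hy.1
  obtain ⟨K, hK, hfK⟩ := exists_norm_le_mul_of_continuousOn (hf.1.continuousOn.mono hIcc)
    (hU.mono hIcc) fun x hx => hUV.posU x (hIcc hx)
  have key := hE.gronwall (N := fun x y => (u x * v y - v x * u y) * Q y) (K := K) (w := U)
    (d := f) hC (fun x hx => (hUV.posU x (ha.trans hx.1)).le) ?_ hK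
    (fun x hx => hfK x ⟨hx.1.le, hx.2⟩) ?_ b ⟨hb, le_rfl⟩
  · refine key.trans ?_
    have := (hUV.posU b (ha.trans hb)).le
    gcongr
    filter_upwards [ae_restrict_mem measurableSet_Ioi] with y hy using h0 y hy
  · intro x hx y hy
    have hx0 : 0 < x := ha.trans hx.1
    have hy0 : 0 < y := ha.trans hy.1
    have h2 := hUV.posU y hy0
    have h2' := hUV.posU x hx0
    have h3 := hUV.kernel_le hy0 hy.2
    rw [norm_mul]
    calc _ ≤ 2 * (U x * V y) * ‖Q y‖ * U y := by gcongr
      _ = U x * (2 * (U y * V y * ‖Q y‖)) := by ring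
      _ ≤ _ := by gcongr; exact hψ' y hy.1
  · intro x hx
    have hx0 : 0 < x := ha.trans hx.1
    have h1 := hB.eq_intervalIntegral hf hQ ha hx0
    rw [intervalIntegral.integral_of_le hx.1.le] at h1
    refine le_of_eq_of_le ?_ (hf₀ x hx.1)
    congr 1
    linear_combination h1

/-- The mirror image of the forward estimate: moving towards 0 the dominant weight is V, and the
constant is independent of the left endpoint b of the interval used. -/
lemma IsBasePair.norm_le_backward (hB : IsBasePair P u u' v v') (hUV : PairWeights u v U V)
    (hQ : LocallyIntegrableOn Q (Ioi 0) volume) (hf : IsSol (fun x => P x + Q x) f f')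
    {a : ℝ} (ha : 0 < a) (hV : ContinuousOn V (Ioi 0))
    (hψ : IntegrableOn ψ (Ioc 0 a) volume)
    (hψ' : ∀ y, 0 < y → y ≤ a → 2 * (U y * V y * ‖Q y‖) ≤ ψ y)
    {C : ℝ} (hC : 0 ≤ C)
    (hf₀ : ∀ y, 0 < y → y ≤ a →
      ‖(v a * f' a - v' a * f a) * u y + (f a * u' a - f' a * u a) * v y‖ ≤ C * V y) :
    ∀ x, 0 < x → x ≤ a → ‖f x‖ ≤ 2 * C * Real.exp (2 * ∫ t in Ioc 0 a, ψ t) * V x := by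
  intro b hb hba
  have h0 : ∀ x ∈ Ioc 0 a, 0 ≤ ψ x := fun y hy => by
    have h2 := hUV.posV y hy.1
    have h3 := hUV.posU y hy.1
    have h5 : 0 ≤ 2 * (U y * V y * ‖Q y‖) := by positivity
    linarith [hψ' y hy.1 hy.2]
  have hsub : Icc b a ⊆ Ioc 0 a := fun y hy => ⟨hb.trans_le hy.1, hy.2⟩
  obtain ⟨E, hE⟩ := exists_volterraWeight_right (T := Icc b a) (S := fun x => Ioc x a)
    measurableSet_Icc (fun x hx => by
      ext y; constructor
      · exact fun hy => ⟨⟨hx.1.trans hy.1.le, hy.2⟩, hy.1⟩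
      · exact fun hy => ⟨hy.2, hy.1.2⟩) (hψ.mono_set hsub) (fun x hx => h0 x (hsub hx))
  have hIcc : Icc b a ⊆ Ioi 0 := fun y hy => hb.trans_le hy.1
  obtain ⟨K, hK, hfK⟩ := exists_norm_le_mul_of_continuousOn (hf.1.continuousOn.mono hIcc)
    (hV.mono hIcc) fun x hx => hUV.posV x (hIcc hx)
  have key := hE.gronwall (N := fun x y => (v x * u y - u x * v y) * Q y) (K := K) (w := V)
    (d := f) hC (fun x hx => (hUV.posV x (hIcc hx)).le) ?_ hK hfK ?_ b ⟨le_rfl, hba⟩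
  · refine key.trans ?_
    have := (hUV.posV b hb).le
    gcongr
    filter_upwards [ae_restrict_mem measurableSet_Ioc] with y hy using h0 y hy
  · intro x hx y hy
    have hx0 : 0 < x := hIcc hx
    have hy0 : 0 < y := hx0.trans hy.1
    have h2 := hUV.posV y hy0
    have h2' := hUV.posV x hx0
    have h3 := hUV.kernel_le hx0 hy.1.le
    rw [norm_mul, show v x * u y - u x * v y = u y * v x - v y * u x by ring]
    calc _ ≤ 2 * (U y * V x) * ‖Q y‖ * V y := by gcongr
      _ = V x * (2 * (U y * V y * ‖Q y‖)) := by ring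
      _ ≤ _ := by gcongr; exact hψ' y hy0 hy.2
  · intro x hx
    have hx0 : 0 < x := hIcc hx
    have h1 := hB.eq_intervalIntegral hf hQ ha hx0
    rw [intervalIntegral.integral_symm, intervalIntegral.integral_of_le hx.2,
      ← integral_neg] at h1
    have h2 : ∫ y in Ioc x a, -((u x * v y - v x * u y) * Q y * f y) =
        ∫ y in Ioc x a, (v x * u y - u x * v y) * Q y * f y := by
      congr 1; ext y; ring
    rw [h2] at h1
    refine le_of_eq_of_le ?_ (hf₀ x hx0 hx.2)
    congr 1
    linear_combination h1

end Estimates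

/-! ### Bounds for Bessel and Macdonald functions -/

/-- The potential `k² + (m² - 1/4) / x²` of the unperturbed equation. -/
def basePot (m k : ℂ) (x : ℝ) : ℂ := k ^ 2 + (m ^ 2 - 1 / 4) / (x : ℂ) ^ 2

/-- The first order system satisfied along the ray through `k` by two Bessel functions of
consecutive orders `m` and `m + 1`. -/
def RaySystem (s m k : ℂ) (f g : ℝ → ℂ) : Prop :=
  ∀ x : ℝ, 0 < x → HasDerivAt f (k * (s * g x + (m + 1 / 2) / (k * x) * f x)) x ∧
    HasDerivAt g (k * (s * f x - (m + 1 / 2) / (k * x) * g x)) x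

/-- Eliminating `g` leaves the Bessel equation; the sign is s = 1 for I and s = -1 for K, and only
its square enters. -/
lemma RaySystem.isClassicalSol {s m k : ℂ} {f g : ℝ → ℂ} (h : RaySystem s m k f g) (hk : k ≠ 0)
    (hs : s ^ 2 = 1) : IsClassicalSol (basePot m k) f
      (fun x => k * (s * g x + (m + 1 / 2) / (k * x) * f x)) := by
  refine ⟨fun x hx => (h x hx).1, fun x hx => ?_⟩
  have hx0 : (x : ℂ) ≠ 0 := Complex.ofReal_ne_zero.2 hx.ne'
  have h1 : HasDerivAt (fun x : ℝ => (m + 1 / 2) / (k * (x : ℂ)))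
      (-((m + 1 / 2) / (k * (x : ℂ) ^ 2))) x := by
    have h2 : HasDerivAt (fun x : ℝ => k * (x : ℂ)) k x := by
      simpa using (hasDerivAt_id x).ofReal_comp.const_mul k
    refine ((hasDerivAt_const x (m + 1 / 2)).fun_div h2 (mul_ne_zero hk hx0)).congr_deriv ?_
    field_simp
    ring
  refine ((((h x hx).2.const_mul s).fun_add (h1.fun_mul (h x hx).1)).const_mul k).congr_deriv ?_
  rw [basePot]
  field_simp
  linear_combination (16 * k ^ 2 * (x : ℂ) ^ 2 * f x) * hs

lemma continuousOn_basePot (m k : ℂ) : ContinuousOn (basePot m k) (Ioi 0) := by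
  refine continuousOn_const.add (continuousOn_const.div (by fun_prop) fun x hx => ?_)
  exact pow_ne_zero 2 (Complex.ofReal_ne_zero.2 (ne_of_gt hx))

lemma continuousOn_inv_sq (c : ℂ) : ContinuousOn (fun x : ℝ => c / (x : ℂ) ^ 2) (Ioi 0) := by
  refine continuousOn_const.div (by fun_prop) fun x hx => ?_
  exact pow_ne_zero 2 (Complex.ofReal_ne_zero.2 (ne_of_gt hx))

lemma hasDerivAt_ray {F : ℂ → ℂ} {d k : ℂ} {x : ℝ} (h : HasDerivAt F d (k * x)) :
    HasDerivAt (fun x : ℝ => F (k * x)) (k * d) x := by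
  have h2 : HasDerivAt (fun x : ℝ => k * (x : ℂ)) k x := by
    simpa using (hasDerivAt_id x).ofReal_comp.const_mul k
  have := HasDerivAt.scomp (g₁ := F) (h := fun x : ℝ => k * (x : ℂ)) x h h2
  simpa [Function.comp_def] using this

/-- By evenness, order m + 1 equals order -(m + 1), and the derivative formula raises the latter to
-m, that is, to order m. -/
lemma hasDerivAt_macdonaldIntegral_succ (m : ℂ) {z : ℂ} (hz : 0 < z.re) :
    HasDerivAt (macdonaldIntegral (m + 1))
      (-macdonaldIntegral m z - (m + 1 / 2) / z * macdonaldIntegral (m + 1) z) z := by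
  have h := hasDerivAt_macdonaldIntegral (-(m + 1)) hz
  have e : macdonaldIntegral (-(m + 1)) = macdonaldIntegral (m + 1) :=
    funext fun z => macdonaldIntegral_neg _ z
  rw [show -(m + 1) + 1 = -m by ring, macdonaldIntegral_neg, e] at h
  refine h.congr_deriv ?_
  ring

lemma re_mul_ofReal_pos {k : ℂ} (hk : 0 < k.re) {x : ℝ} (hx : 0 < x) : 0 < (k * x).re := by
  rw [Complex.re_mul_ofReal]; positivity

lemma raySystem_macdonaldIntegral (m : ℂ) {k : ℂ} (hk : 0 < k.re) :
    RaySystem (-1) m k (fun x => macdonaldIntegral m (k * x))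
      (fun x => macdonaldIntegral (m + 1) (k * x)) := by
  intro x hx
  have hz := re_mul_ofReal_pos hk hx
  refine ⟨(hasDerivAt_ray (hasDerivAt_macdonaldIntegral m hz)).congr_deriv ?_,
    (hasDerivAt_ray (hasDerivAt_macdonaldIntegral_succ m hz)).congr_deriv ?_⟩ <;> ring

lemma mem_slitPlane_of_re_nonneg {z : ℂ} (hz : 0 ≤ z.re) (hz0 : z ≠ 0) :
    z ∈ Complex.slitPlane := by
  rw [Complex.mem_slitPlane_iff]
  rcases hz.lt_or_eq with h | h
  · exact Or.inl h
  · right; intro h'; exact hz0 (Complex.ext h.symm h')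

lemma raySystem_besselI {m : ℂ} (hm : -1 < m.re) {k : ℂ} (hk : 0 ≤ k.re) (hk0 : k ≠ 0) :
    RaySystem 1 m k (fun x => besselI m (k * x)) (fun x => besselI (m + 1) (k * x)) := by
  intro x hx
  have hz : k * x ∈ Complex.slitPlane := by
    refine mem_slitPlane_of_re_nonneg ?_ (mul_ne_zero hk0 (Complex.ofReal_ne_zero.2 hx.ne'))
    rw [Complex.re_mul_ofReal]; positivity
  refine ⟨(hasDerivAt_ray (hasDerivAt_besselI hm hz)).congr_deriv ?_,
    (hasDerivAt_ray (hasDerivAt_besselI_succ hm hz)).congr_deriv ?_⟩ <;> ring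

/-! ### Large arguments: comparison with exponentials -/

lemma isBasePair_exp {k : ℂ} (hk : k ≠ 0) :
    IsBasePair (fun _ => k ^ 2) (fun x : ℝ => Complex.exp (k * x))
      (fun x : ℝ => k * Complex.exp (k * x)) (fun x : ℝ => Complex.exp (-(k * x)) / (2 * k))
      (fun x : ℝ => -Complex.exp (-(k * x)) / 2) := by
  have h1 : ∀ x : ℝ, HasDerivAt (fun x : ℝ => k * (x : ℂ)) k x := fun x => by
    simpa using (hasDerivAt_id x).ofReal_comp.const_mul k
  refine ⟨continuousOn_const, ⟨fun x _ => ?_, fun x _ => ?_⟩, ⟨fun x _ => ?_, fun x _ => ?_⟩,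
    fun x _ => ?_⟩
  · exact (h1 x).cexp.congr_deriv (by ring)
  · exact ((h1 x).cexp.const_mul k).congr_deriv (by ring)
  · exact ((h1 x).fun_neg.cexp.div_const (2 * k)).congr_deriv (by field_simp)
  · exact ((h1 x).fun_neg.cexp.fun_neg.div_const 2).congr_deriv (by field_simp)
  · have : Complex.exp (-(k * x)) * Complex.exp (k * x) = 1 := by
      rw [← Complex.exp_add]; simp
    field_simp
    linear_combination 2 * this

lemma norm_exp_ray (k : ℂ) (x : ℝ) : ‖Complex.exp (k * x)‖ = Real.exp (x * k.re) := by
  rw [Complex.norm_exp, Complex.re_mul_ofReal, mul_comm]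

lemma norm_exp_neg_ray (k : ℂ) (x : ℝ) : ‖Complex.exp (-(k * x))‖ = Real.exp (-(x * k.re)) := by
  rw [Complex.norm_exp, Complex.neg_re, Complex.re_mul_ofReal, mul_comm]

lemma pairWeights_exp {k : ℂ} (hk : 0 ≤ k.re) (hk0 : k ≠ 0) :
    PairWeights (fun x : ℝ => Complex.exp (k * x)) (fun x : ℝ => Complex.exp (-(k * x)) / (2 * k))
      (fun x => Real.exp (x * k.re)) (fun x => Real.exp (-(x * k.re)) / (2 * ‖k‖)) := by
  have hk' : 0 < ‖k‖ := norm_pos_iff.2 hk0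
  refine ⟨fun x _ => by positivity, fun x _ => by positivity, fun x _ => ?_, fun x _ => ?_,
    fun y x hy hyx => ?_⟩
  · rw [norm_exp_ray]
  · rw [norm_div, norm_exp_neg_ray, norm_mul]; simp
  · rw [mul_div_assoc', mul_div_assoc', ← Real.exp_add, ← Real.exp_add]
    gcongr

lemma integrableOn_const_div_sq (C : ℝ) {a : ℝ} (ha : 0 < a) :
    IntegrableOn (fun x : ℝ => C / x ^ 2) (Ioi a) volume := by
  have : IntegrableOn (fun x : ℝ => C * x ^ (-2 : ℝ)) (Ioi a) volume :=
    (integrableOn_Ioi_rpow_of_lt (a := -2) (by norm_num) ha).const_mul C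
  refine this.congr_fun (fun x hx => ?_) measurableSet_Ioi
  have hx0 : 0 < x := ha.trans hx
  simp only
  rw [Real.rpow_neg hx0.le, div_eq_mul_inv]
  norm_num

lemma two_mul_weights_exp {k : ℂ} (hk : ‖k‖ = 1) (c : ℂ) (y : ℝ) :
    2 * (Real.exp (y * k.re) * (Real.exp (-(y * k.re)) / (2 * ‖k‖)) * ‖c / (y : ℂ) ^ 2‖) =
      ‖c‖ / y ^ 2 := by
  rw [mul_div_assoc', ← Real.exp_add, add_neg_cancel, Real.exp_zero, hk, norm_div, norm_pow,
    Complex.norm_real, Real.norm_eq_abs, sq_abs]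
  ring

lemma exists_norm_le_of_tendsto_atTop {g : ℝ → ℂ} {a : ℝ} {l : ℂ} (hg : ContinuousOn g (Ici a))
    (hl : Tendsto g atTop (𝓝 l)) : ∃ K : ℝ, 0 ≤ K ∧ ∀ x, a ≤ x → ‖g x‖ ≤ K := by
  have h1 : ∀ᶠ x in atTop, ‖g x‖ ≤ ‖l‖ + 1 :=
    hl.norm.eventually (eventually_le_nhds (by linarith))
  obtain ⟨b, hb⟩ := eventually_atTop.1 h1
  obtain ⟨K, hK⟩ := isCompact_Icc.exists_bound_of_continuousOn
    (hg.mono (Icc_subset_Ici_self : Icc a b ⊆ Ici a))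
  refine ⟨max K (‖l‖ + 1), le_max_of_le_right (by positivity), fun x hx => ?_⟩
  rcases le_total x b with h | h
  · exact (hK x ⟨hx, h⟩).trans (le_max_left _ _)
  · exact (hb x h).trans (le_max_right _ _)

lemma exists_unit_ray {z : ℂ} (hz : 0 < ‖z‖) :
    ∃ ω : ℂ, ‖ω‖ = 1 ∧ ω ≠ 0 ∧ ω * (‖z‖ : ℝ) = z ∧ ‖z‖ * ω.re = z.re := by
  have hz0 : (‖z‖ : ℂ) ≠ 0 := Complex.ofReal_ne_zero.2 hz.ne'
  have h1 : z / ‖z‖ * (‖z‖ : ℝ) = z := by field_simp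
  have h2 : ‖z / ‖z‖‖ = 1 := by rw [norm_div]; simp [hz.ne']
  exact ⟨z / ‖z‖, h2, norm_pos_iff.1 (by rw [h2]; norm_num), h1, by
    rw [← Complex.re_ofReal_mul, mul_comm, h1]⟩

/-- Along the unit ray through z the function solves a perturbation of f'' = ω²f by c/x², whose
integral over (1/2, ∞) is finite and independent of ω. The Laplace limits give the coefficients 0
and 2ω at ∞, so the constant is uniform in the direction. Starting at 1/2 leaves room to evaluate at
|z| = 1. -/
lemma exists_norm_macdonaldIntegral_le_large (m : ℂ) :
    ∃ C : ℝ, 0 < C ∧ ∀ z : ℂ, 0 < z.re → 1 ≤ ‖z‖ →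
      ‖macdonaldIntegral m z‖ ≤ C * Real.exp (-z.re) := by
  set c : ℂ := m ^ 2 - 1 / 4 with hc
  refine ⟨2 * Real.exp (2 * ∫ t in Ioi (1 / 2 : ℝ), ‖c‖ / t ^ 2), by positivity,
    fun z hz hz1 => ?_⟩
  have hzn : 0 < ‖z‖ := by linarith
  obtain ⟨ω, hωn, hω0, hωz, hzre⟩ := exists_unit_ray hzn
  have hωre : 0 < ω.re := by
    rw [← hzre] at hz
    exact pos_of_mul_pos_right hz hzn.le
  set f : ℝ → ℂ := fun x => macdonaldIntegral m (ω * x) with hf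
  have hsys := raySystem_macdonaldIntegral m hωre
  have hsol := (hsys.isClassicalSol hω0 (by norm_num)).isSol (continuousOn_basePot m ω)
  set f' : ℝ → ℂ := fun x : ℝ => ω * (-1 * macdonaldIntegral (m + 1) (ω * x) +
    (m + 1 / 2) / (ω * x) * macdonaldIntegral m (ω * x)) with hf'
  have l0 := tendsto_exp_mul_macdonaldIntegral m hωre
  have l1 := tendsto_exp_mul_macdonaldIntegral (m + 1) hωre
  have linv : Tendsto (fun x : ℝ => (m + 1 / 2) / (ω * x)) atTop (𝓝 0) := by
    have h1 : Tendsto (fun x : ℝ => ((x⁻¹ : ℝ) : ℂ)) atTop (𝓝 ((0 : ℝ) : ℂ)) :=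
      (Complex.continuous_ofReal.tendsto _).comp tendsto_inv_atTop_zero
    have h2 := h1.const_mul ((m + 1 / 2) / ω)
    rw [Complex.ofReal_zero, mul_zero] at h2
    refine h2.congr fun x => ?_
    push_cast
    rw [div_mul_eq_div_div, div_eq_mul_inv]
    field_simp
  have l2 : Tendsto (fun x : ℝ => Complex.exp (ω * x) * f' x) atTop (𝓝 (-ω)) := by
    have := ((l1.neg).add (linv.mul l0)).const_mul ω
    simp only [add_zero, mul_neg, mul_one] at this
    refine this.congr fun x => ?_
    simp only [hf']; ring
  have ldec : Tendsto (fun x : ℝ => Complex.exp (-(ω * x)) * Complex.exp (-(ω * x))) atTop (𝓝 0) := by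
    rw [tendsto_zero_iff_norm_tendsto_zero]
    have h1 : Tendsto (fun x : ℝ => Real.exp (-(x * (2 * ω.re)))) atTop (𝓝 0) :=
      Real.tendsto_exp_neg_atTop_nhds_zero.comp (tendsto_id.atTop_mul_const (by positivity))
    refine h1.congr fun x => ?_
    rw [norm_mul, norm_exp_neg_ray, ← Real.exp_add]; congr 1; ring
  have hee : ∀ x : ℝ, Complex.exp (-(ω * x)) * Complex.exp (ω * x) = 1 := fun x => by
    rw [← Complex.exp_add]; simp
  -- Both the solution and the recessive exponential decay like exp(-ωx), so the coefficient along
  -- the growing exponential vanishes at ∞.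
  have hα : Tendsto (fun x : ℝ => Complex.exp (-(ω * x)) / (2 * ω) * f' x -
      -Complex.exp (-(ω * x)) / 2 * f x) atTop (𝓝 0) := by
    have h1 := ldec.mul ((l2.div_const (2 * ω)).add (l0.div_const 2))
    rw [zero_mul] at h1
    refine h1.congr fun x => ?_
    have h2 := hee x
    simp only [hf]
    linear_combination (Complex.exp (-(ω * x)) * (f' x / (2 * ω) +
      macdonaldIntegral m (ω * x) / 2)) * h2
  have hβ : Tendsto (fun x : ℝ => f x * (ω * Complex.exp (ω * x)) - f' x * Complex.exp (ω * x))
      atTop (𝓝 (2 * ω)) := by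
    have h1 := (l0.const_mul ω).sub l2
    rw [show ω * 1 - -ω = 2 * ω by ring] at h1
    refine h1.congr fun x => ?_
    simp only [hf]; ring
  obtain ⟨K, hK, hKb⟩ := exists_norm_le_of_tendsto_atTop (a := 1 / 2)
    (g := fun x : ℝ => Complex.exp (ω * x) * macdonaldIntegral m (ω * x)) (by
      refine ContinuousOn.mul (by fun_prop) (hsol.1.continuousOn.mono fun x hx => ?_)
      exact lt_of_lt_of_le (by norm_num : (0 : ℝ) < 1 / 2) hx) l0
  -- The factors 2 in `K` and `C` compensate the denominator 2‖ω‖ of the recessive weight.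
  have main := (isBasePair_exp hω0).norm_le_infty (pairWeights_exp hωre.le hω0)
    (Q := fun x : ℝ => c / (x : ℂ) ^ 2)
    ((continuousOn_inv_sq c).locallyIntegrableOn measurableSet_Ioi) (f := f) (f' := f') hsol hα hβ
    (x₀ := 1 / 2) (by norm_num) (integrableOn_const_div_sq ‖c‖ (by norm_num))
    (fun y _ => (two_mul_weights_exp hωn c y).le) (K := 2 * K) (C := 2) (by positivity) ?_
    (by norm_num) ?_ ‖z‖ (by linarith)
  · have e1 : f ‖z‖ = macdonaldIntegral m z := by simp only [hf]; rw [hωz]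
    rw [e1, hzre, hωn] at main
    refine main.trans (le_of_eq ?_)
    ring
  · intro y hy
    have h1 := hKb y hy.le
    rw [norm_mul, norm_exp_ray] at h1
    rw [hωn, Real.exp_neg]
    have h2 := Real.exp_pos (y * ω.re)
    calc ‖f y‖ = (Real.exp (y * ω.re))⁻¹ * (Real.exp (y * ω.re) * ‖f y‖) := by field_simp
      _ ≤ (Real.exp (y * ω.re))⁻¹ * K := by gcongr
      _ = _ := by ring
  · intro y _
    rw [zero_mul, zero_add, norm_mul, norm_div, norm_exp_neg_ray, norm_mul, hωn]
    norm_num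

/-- The data at distance 1/2 from the origin are bounded by the power series and propagated forward
against the growing exponential. No decay of the ray is used, so the imaginary axis is included. -/
lemma exists_norm_besselI_le_large {m : ℂ} (hm : -1 < m.re) :
    ∃ C : ℝ, 0 < C ∧ ∀ z : ℂ, 0 ≤ z.re → 1 ≤ ‖z‖ → ‖besselI m z‖ ≤ C * Real.exp z.re := by
  set c : ℂ := m ^ 2 - 1 / 4 with hc
  obtain ⟨C₀, hC₀, h0⟩ := exists_norm_besselI_le_small hm
  obtain ⟨C₁, hC₁, h1⟩ := exists_norm_besselI_le_small (ν := m + 1) (by simp; linarith)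
  set D₀ := C₀ * (1 / 2 : ℝ) ^ (1 / 2 + m.re) with hD₀
  set D₁ := C₁ * (1 / 2 : ℝ) ^ (1 / 2 + (m + 1).re) + ‖m + 1 / 2‖ * 2 * D₀ with hD₁
  have hD₀0 : 0 < D₀ := by positivity
  have hD₁0 : 0 < D₁ := by positivity
  refine ⟨2 * (2 * (D₀ + D₁) * Real.exp 1) *
    Real.exp (2 * ∫ t in Ioi (1 / 2 : ℝ), ‖c‖ / t ^ 2), by positivity, fun z hz hz1 => ?_⟩
  have hzn : 0 < ‖z‖ := by linarith
  obtain ⟨ω, hωn, hω0, hωz, hzre⟩ := exists_unit_ray hzn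
  have hωre : 0 ≤ ω.re := by
    rw [← hzre] at hz
    exact nonneg_of_mul_nonneg_right hz hzn
  have hωre1 : ω.re ≤ 1 := hωn ▸ Complex.re_le_norm ω
  have hsys := raySystem_besselI hm hωre hω0
  have hsol := (hsys.isClassicalSol hω0 (by norm_num)).isSol (continuousOn_basePot m ω)
  set f : ℝ → ℂ := fun x => besselI m (ω * x) with hf
  set f' : ℝ → ℂ := fun x : ℝ => ω * (1 * besselI (m + 1) (ω * x) +
    (m + 1 / 2) / (ω * x) * besselI m (ω * x)) with hf'
  have hn2 : ‖ω * ((1 / 2 : ℝ) : ℂ)‖ = 1 / 2 := by rw [norm_mul, hωn]; simp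
  have hne2 : ω * ((1 / 2 : ℝ) : ℂ) ≠ 0 := norm_pos_iff.1 (by rw [hn2]; norm_num)
  have b0 : ‖f (1 / 2)‖ ≤ D₀ := by
    have := h0 _ hne2 (by rw [hn2]; norm_num)
    rwa [hn2] at this
  have b1 : ‖f' (1 / 2)‖ ≤ D₁ := by
    have h2 := h1 _ hne2 (by rw [hn2]; norm_num)
    rw [hn2] at h2
    simp only [hf']
    rw [norm_mul, hωn, one_mul, one_mul]
    refine (norm_add_le _ _).trans (add_le_add h2 ?_)
    rw [norm_mul, norm_div, hn2]
    calc ‖m + 1 / 2‖ / (1 / 2) * ‖besselI m (ω * ((1 / 2 : ℝ) : ℂ))‖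
        = ‖m + 1 / 2‖ * 2 * ‖besselI m (ω * ((1 / 2 : ℝ) : ℂ))‖ := by ring
      _ ≤ _ := by gcongr
  have main := (isBasePair_exp hω0).norm_le_forward (pairWeights_exp hωre hω0)
    (Q := fun x : ℝ => c / (x : ℂ) ^ 2)
    ((continuousOn_inv_sq c).locallyIntegrableOn measurableSet_Ioi) (f := f) (f' := f') hsol
    (a := 1 / 2) (by norm_num) (by fun_prop) (integrableOn_const_div_sq ‖c‖ (by norm_num))
    (fun y _ => (two_mul_weights_exp hωn c y).le) (C := 2 * (D₀ + D₁) * Real.exp 1)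
    (by positivity) ?_ ‖z‖ (by linarith)
  · have e1 : f ‖z‖ = besselI m z := by simp only [hf]; rw [hωz]
    rwa [e1, hzre] at main
  · intro y hy
    have e1 : Real.exp (-(1 / 2 * ω.re)) ≤ Real.exp 1 := Real.exp_le_exp.2 (by linarith)
    have e2 : Real.exp (1 / 2 * ω.re) ≤ Real.exp 1 := Real.exp_le_exp.2 (by linarith)
    have e3 : Real.exp (-(y * ω.re)) ≤ Real.exp (y * ω.re) := by
      apply Real.exp_le_exp.2
      have : 0 ≤ y * ω.re := mul_nonneg (by linarith) hωre
      linarith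
    have n2 : ‖(2 : ℂ)‖ = 2 := by norm_num
    generalize f (1 / 2) = A at b0 ⊢
    generalize f' (1 / 2) = B at b1 ⊢
    clear_value D₀ D₁
    have a1 : ‖Complex.exp (-(ω * ((1 / 2 : ℝ) : ℂ))) / (2 * ω) * B -
        -Complex.exp (-(ω * ((1 / 2 : ℝ) : ℂ))) / 2 * A‖ ≤ Real.exp 1 * (D₀ + D₁) := by
      refine (norm_sub_le _ _).trans ?_
      rw [norm_mul, norm_mul, norm_div, norm_div, norm_neg, norm_mul, norm_exp_neg_ray, hωn, n2]
      calc _ ≤ Real.exp 1 / (2 * 1) * D₁ + Real.exp 1 / 2 * D₀ := by gcongr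
        _ ≤ _ := by nlinarith [Real.exp_pos 1]
    have a2 : ‖A * (ω * Complex.exp (ω * ((1 / 2 : ℝ) : ℂ))) -
        B * Complex.exp (ω * ((1 / 2 : ℝ) : ℂ))‖ ≤ Real.exp 1 * (D₀ + D₁) := by
      refine (norm_sub_le _ _).trans ?_
      rw [norm_mul, norm_mul, norm_mul, norm_exp_ray, hωn, one_mul]
      calc _ ≤ D₀ * Real.exp 1 + D₁ * Real.exp 1 := by gcongr
        _ = _ := by ring
    refine (norm_add_le _ _).trans ?_
    rw [norm_mul, norm_mul, norm_exp_ray, norm_div, norm_exp_neg_ray, norm_mul, hωn, n2]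
    calc _ ≤ Real.exp 1 * (D₀ + D₁) * Real.exp (y * ω.re) +
          Real.exp 1 * (D₀ + D₁) * (Real.exp (y * ω.re) / (2 * 1)) := by gcongr
      _ ≤ _ := by nlinarith [Real.exp_pos (y * ω.re), mul_pos (mul_pos (Real.exp_pos 1) (add_pos hD₀0 hD₁0)) (Real.exp_pos (y * ω.re))]

/-! ### Small arguments, and bounds on the whole half-plane -/

/-- The logarithmic correction of the Macdonald function at `0`, present only for `m = 0`. -/
def logFactor (m : ℂ) (t : ℝ) : ℝ := if m = 0 then 1 - Real.log (min 1 t) else 1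

/-- The size of the Macdonald function. -/
def wK (m z : ℂ) : ℝ :=
  Real.exp (-z.re) * (min 1 ‖z‖) ^ (1 / 2 - |m.re|) * logFactor m ‖z‖

/-- The size of the modified Bessel function of order with real part `s`. -/
def wI (s : ℝ) (z : ℂ) : ℝ := Real.exp z.re * (min 1 ‖z‖) ^ (1 / 2 + s)

lemma one_le_logFactor (m : ℂ) {t : ℝ} (ht : 0 < t) : 1 ≤ logFactor m t := by
  unfold logFactor
  split_ifs
  · have := Real.log_nonpos (le_min zero_le_one ht.le) (min_le_left 1 t)
    linarith
  · exact le_rfl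

lemma wK_pos (m : ℂ) {z : ℂ} (hz : z ≠ 0) : 0 < wK m z := by
  have hz' : 0 < ‖z‖ := norm_pos_iff.2 hz
  have h1 := one_le_logFactor m hz'
  have h2 : 0 < min 1 ‖z‖ := lt_min one_pos hz'
  unfold wK
  positivity

lemma wI_pos (s : ℝ) {z : ℂ} (hz : z ≠ 0) : 0 < wI s z := by
  have hz' : 0 < ‖z‖ := norm_pos_iff.2 hz
  have h2 : 0 < min 1 ‖z‖ := lt_min one_pos hz'
  unfold wI
  positivity

/-- Near 0 the roles are exchanged: (m² - 1/4)/x² belongs to the base equation and the spectral term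
ω², of modulus 1, is the perturbation. The data at |z| = 1 come from the large-argument bound and
are propagated backward to 0. The constant `M` makes the kernel bounded and lets V absorb the
component along `u`. -/
lemma exists_norm_macdonaldIntegral_le_of_pair {u u' v v' : ℝ → ℂ} {U V : ℝ → ℝ} {m : ℂ}
    (hB : IsBasePair (fun x : ℝ => (m ^ 2 - 1 / 4) / (x : ℂ) ^ 2) u u' v v')
    (hUV : PairWeights u v U V) (hV : ContinuousOn V (Ioi 0)) {M : ℝ}
    (hM1 : ∀ y, 0 < y → y ≤ 1 → U y * V y ≤ M) (hM2 : ∀ y, 0 < y → y ≤ 1 → U y ≤ M * V y) :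
    ∃ C : ℝ, 0 < C ∧ ∀ z : ℂ, 0 < z.re → ‖z‖ ≤ 1 → ‖macdonaldIntegral m z‖ ≤ C * V ‖z‖ := by
  obtain ⟨C₀, hC₀, h0⟩ := exists_norm_macdonaldIntegral_le_large m
  obtain ⟨C₁, hC₁, h1⟩ := exists_norm_macdonaldIntegral_le_large (m + 1)
  have hM : 0 < M :=
    lt_of_lt_of_le (mul_pos (hUV.posU 1 one_pos) (hUV.posV 1 one_pos)) (hM1 1 one_pos le_rfl)
  set D := C₀ + (C₁ + ‖m + 1 / 2‖ * C₀) with hD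
  have hD0 : 0 < D := by positivity
  set C := (‖v 1‖ * D + ‖v' 1‖ * D) * M + (D * ‖u' 1‖ + D * ‖u 1‖) + 1 with hC
  have hC0 : 0 < C := by positivity
  refine ⟨2 * C * Real.exp (2 * ∫ _ in Ioc (0 : ℝ) 1, 2 * M), by positivity, fun z hz hz1 => ?_⟩
  have hzn : 0 < ‖z‖ := norm_pos_iff.2 (by rintro rfl; simp at hz)
  obtain ⟨ω, hωn, hω0, hωz, hzre⟩ := exists_unit_ray hzn
  have hωre : 0 < ω.re := by
    rw [← hzre] at hz
    exact pos_of_mul_pos_right hz hzn.le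
  have hsys := raySystem_macdonaldIntegral m hωre
  have hsol := (hsys.isClassicalSol hω0 (by norm_num)).isSol (continuousOn_basePot m ω)
  set f : ℝ → ℂ := fun x => macdonaldIntegral m (ω * x) with hf
  set f' : ℝ → ℂ := fun x : ℝ => ω * (-1 * macdonaldIntegral (m + 1) (ω * x) +
    (m + 1 / 2) / (ω * x) * macdonaldIntegral m (ω * x)) with hf'
  have hexp : Real.exp (-ω.re) ≤ 1 := Real.exp_le_one_iff.2 (by linarith)
  have k0 : ‖macdonaldIntegral m ω‖ ≤ C₀ :=
    (h0 ω hωre hωn.ge).trans (mul_le_of_le_one_right hC₀.le hexp)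
  have k1 : ‖macdonaldIntegral (m + 1) ω‖ ≤ C₁ :=
    (h1 ω hωre hωn.ge).trans (mul_le_of_le_one_right hC₁.le hexp)
  have b0 : ‖f 1‖ ≤ D := by
    simp only [hf, Complex.ofReal_one, mul_one]
    refine k0.trans ?_
    have : 0 ≤ C₁ + ‖m + 1 / 2‖ * C₀ := by positivity
    linarith
  have b1 : ‖f' 1‖ ≤ D := by
    simp only [hf', Complex.ofReal_one, mul_one]
    rw [norm_mul, hωn, one_mul]
    refine (norm_add_le _ _).trans ?_
    rw [norm_mul, norm_mul, norm_div, hωn, div_one, norm_neg, norm_one, one_mul]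
    have : ‖m + 1 / 2‖ * ‖macdonaldIntegral m ω‖ ≤ ‖m + 1 / 2‖ * C₀ := by gcongr
    linarith
  have hsol' : IsSol (fun x : ℝ => (m ^ 2 - 1 / 4) / (x : ℂ) ^ 2 + ω ^ 2) f f' := by
    have e : (fun x : ℝ => (m ^ 2 - 1 / 4) / (x : ℂ) ^ 2 + ω ^ 2) = basePot m ω := by
      ext x; rw [basePot, add_comm]
    rw [e]; exact hsol
  have main := hB.norm_le_backward hUV (Q := fun _ => ω ^ 2)
    (continuousOn_const.locallyIntegrableOn measurableSet_Ioi) hsol' one_pos hV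
    (ψ := fun _ => 2 * M) (integrableOn_const (by simp)) ?_ (C := C) hC0.le ?_ ‖z‖ hzn hz1
  · have e1 : f ‖z‖ = macdonaldIntegral m z := by simp only [hf]; rw [hωz]
    rwa [e1] at main
  · intro y hy hy1
    rw [norm_pow, hωn, one_pow, mul_one]
    linarith [hM1 y hy hy1]
  · intro y hy hy1
    have hVy := hUV.posV y hy
    generalize f 1 = A at b0 ⊢
    generalize f' 1 = B at b1 ⊢
    clear_value D
    have a1 : ‖v 1 * B - v' 1 * A‖ ≤ ‖v 1‖ * D + ‖v' 1‖ * D := by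
      refine (norm_sub_le _ _).trans ?_
      rw [norm_mul, norm_mul]
      gcongr
    have a2 : ‖A * u' 1 - B * u 1‖ ≤ D * ‖u' 1‖ + D * ‖u 1‖ := by
      refine (norm_sub_le _ _).trans ?_
      rw [norm_mul, norm_mul]
      gcongr
    have a3 : ‖u y‖ ≤ M * V y := (hUV.leU y hy).trans (hM2 y hy hy1)
    have a4 := hUV.leV y hy
    refine (norm_add_le _ _).trans ?_
    rw [norm_mul, norm_mul]
    calc _ ≤ (‖v 1‖ * D + ‖v' 1‖ * D) * (M * V y) + (D * ‖u' 1‖ + D * ‖u 1‖) * V y := by gcongr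
      _ ≤ C * V y := by rw [hC]; nlinarith

lemma hasDerivAt_ofReal_cpow (s : ℂ) {x : ℝ} (hx : 0 < x) :
    HasDerivAt (fun x : ℝ => (x : ℂ) ^ s) (s * (x : ℂ) ^ (s - 1)) x := by
  have h1 := (hasDerivAt_id (x : ℂ)).cpow_const (c := s)
    (Complex.ofReal_mem_slitPlane.2 hx)
  simpa using h1.comp_ofReal

lemma cpow_sub_two (s : ℂ) {x : ℂ} (hx : x ≠ 0) : x ^ (s - 1 - 1) = x ^ s / x ^ 2 := by
  rw [Complex.cpow_sub _ _ hx, Complex.cpow_sub _ _ hx, Complex.cpow_one, div_div, sq]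

/-- The base solutions are x^{1/2±m}; normalizing their Wronskian divides by 2m, so m = 0 is treated
separately with √x and √x log x. A nonzero imaginary m needs no logarithm. -/
lemma exists_norm_macdonaldIntegral_le_small_of_re_nonneg {m : ℂ} (hm : 0 ≤ m.re) :
    ∃ C : ℝ, 0 < C ∧ ∀ z : ℂ, 0 < z.re → ‖z‖ ≤ 1 →
      ‖macdonaldIntegral m z‖ ≤ C * (‖z‖ ^ (1 / 2 - |m.re|) * logFactor m ‖z‖) := by
  by_cases hm0 : m = 0
  · subst hm0
    have hB : IsBasePair (fun x : ℝ => ((0 : ℂ) ^ 2 - 1 / 4) / (x : ℂ) ^ 2)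
        (fun x : ℝ => (x : ℂ) ^ (1 / 2 : ℂ)) (fun x : ℝ => 1 / 2 * (x : ℂ) ^ (1 / 2 - 1 : ℂ))
        (fun x : ℝ => -((x : ℂ) ^ (1 / 2 : ℂ) * (Real.log x : ℂ)))
        (fun x : ℝ => -(1 / 2 * (x : ℂ) ^ (1 / 2 - 1 : ℂ) * (Real.log x : ℂ)
          + (x : ℂ) ^ (1 / 2 - 1 : ℂ))) := by
      have hl : ∀ x : ℝ, 0 < x → HasDerivAt (fun x : ℝ => (Real.log x : ℂ)) ((x : ℂ)⁻¹) x := by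
        intro x hx
        simpa using (Real.hasDerivAt_log hx.ne').ofReal_comp
      have hc : ∀ x : ℝ, 0 < x → (x : ℂ) ≠ 0 := fun x hx => Complex.ofReal_ne_zero.2 hx.ne'
      refine ⟨continuousOn_inv_sq _, ⟨fun x hx => hasDerivAt_ofReal_cpow _ hx, fun x hx => ?_⟩,
        ⟨fun x hx => ?_, fun x hx => ?_⟩, fun x hx => ?_⟩
      · refine ((hasDerivAt_ofReal_cpow _ hx).const_mul _).congr_deriv ?_
        rw [Complex.cpow_sub _ _ (hc x hx), Complex.cpow_sub _ _ (hc x hx), Complex.cpow_one]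
        have := hc x hx
        field_simp
        ring
      · refine ((hasDerivAt_ofReal_cpow _ hx).fun_mul (hl x hx)).fun_neg.congr_deriv ?_
        have e : (x : ℂ) ^ (1 / 2 - 1 : ℂ) = (x : ℂ) ^ (1 / 2 : ℂ) * (x : ℂ)⁻¹ := by
          rw [Complex.cpow_sub _ _ (hc x hx), Complex.cpow_one, div_eq_mul_inv]
        simp only [e]
      · refine ((((hasDerivAt_ofReal_cpow _ hx).const_mul (1 / 2)).fun_mul (hl x hx)).fun_add
          (hasDerivAt_ofReal_cpow _ hx)).fun_neg.congr_deriv ?_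
        rw [Complex.cpow_sub _ _ (hc x hx), Complex.cpow_sub _ _ (hc x hx), Complex.cpow_one]
        have := hc x hx
        field_simp
        ring
      · have h1 : (x : ℂ) ^ (1 / 2 : ℂ) * (x : ℂ) ^ (1 / 2 - 1 : ℂ) = 1 := by
          rw [← Complex.cpow_add _ _ (hc x hx)]; norm_num
        linear_combination h1
    have hn : ∀ x : ℝ, 0 < x → ‖(x : ℂ) ^ (1 / 2 : ℂ)‖ = x ^ (1 / 2 : ℝ) := fun x hx => by
      rw [Complex.norm_cpow_eq_rpow_re_of_pos hx]; norm_num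
    -- U carries the logarithm only for x ≥ 1 and V on both sides of 1. The quotient U/V is then
    -- 1/(1 - log x) below 1 and constant above, hence nondecreasing.
    have hUV : PairWeights (fun x : ℝ => (x : ℂ) ^ (1 / 2 : ℂ))
        (fun x : ℝ => -((x : ℂ) ^ (1 / 2 : ℂ) * (Real.log x : ℂ)))
        (fun x => x ^ (1 / 2 : ℝ) * (1 + Real.log (max 1 x)))
        (fun x => x ^ (1 / 2 : ℝ) * (1 + |Real.log x|)) := by
      have hlog : ∀ x : ℝ, 0 ≤ Real.log (max 1 x) := fun x => Real.log_nonneg (le_max_left _ _)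
      refine ⟨fun x hx => ?_, fun x hx => by positivity, fun x hx => ?_, fun x hx => ?_,
        fun y x hy hyx => ?_⟩
      · have := hlog x; positivity
      · rw [hn x hx]
        have := hlog x
        exact le_mul_of_one_le_right (by positivity) (by linarith)
      · rw [norm_neg, norm_mul, hn x hx, Complex.norm_real, Real.norm_eq_abs]
        gcongr
        linarith
      · have hx := hy.trans_le hyx
        have key : (1 + Real.log (max 1 y)) * (1 + |Real.log x|) ≤
            (1 + Real.log (max 1 x)) * (1 + |Real.log y|) := by
          rcases le_total x 1 with h | h
          · rw [max_eq_left h, max_eq_left (hyx.trans h), Real.log_one,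
              abs_of_nonpos (Real.log_nonpos hx.le h),
              abs_of_nonpos (Real.log_nonpos hy.le (hyx.trans h))]
            have := Real.log_le_log hy hyx
            linarith
          · rcases le_total y 1 with h' | h'
            · rw [max_eq_left h', max_eq_right h, Real.log_one,
                abs_of_nonneg (Real.log_nonneg h)]
              have := Real.log_nonneg h
              have := abs_nonneg (Real.log y)
              nlinarith
            · rw [max_eq_right h', max_eq_right h, abs_of_nonneg (Real.log_nonneg h),
                abs_of_nonneg (Real.log_nonneg h')]
              linarith
        calc _ = (x ^ (1 / 2 : ℝ) * y ^ (1 / 2 : ℝ)) *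
              ((1 + Real.log (max 1 y)) * (1 + |Real.log x|)) := by ring
          _ ≤ (x ^ (1 / 2 : ℝ) * y ^ (1 / 2 : ℝ)) *
              ((1 + Real.log (max 1 x)) * (1 + |Real.log y|)) := by gcongr
          _ = _ := by ring
    have hM1 : ∀ y : ℝ, 0 < y → y ≤ 1 → y ^ (1 / 2 : ℝ) * (1 + Real.log (max 1 y)) *
        (y ^ (1 / 2 : ℝ) * (1 + |Real.log y|)) ≤ 1 := by
      intro y hy hy1
      rw [max_eq_left hy1, Real.log_one, add_zero, mul_one, abs_of_nonpos (Real.log_nonpos hy.le hy1),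
        ← mul_assoc, ← Real.rpow_add hy]
      norm_num
      have h1 := Real.one_sub_inv_le_log_of_pos hy
      have h2 : y * (1 - y⁻¹) ≤ y * Real.log y := by gcongr
      rw [mul_sub, mul_inv_cancel₀ hy.ne'] at h2
      linarith
    have hM2 : ∀ y : ℝ, 0 < y → y ≤ 1 → y ^ (1 / 2 : ℝ) * (1 + Real.log (max 1 y)) ≤
        1 * (y ^ (1 / 2 : ℝ) * (1 + |Real.log y|)) := by
      intro y hy hy1
      rw [max_eq_left hy1, Real.log_one, add_zero, mul_one, one_mul]
      exact le_mul_of_one_le_right (by positivity) (by linarith [abs_nonneg (Real.log y)])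
    obtain ⟨C, hC, h⟩ := exists_norm_macdonaldIntegral_le_of_pair hB hUV (by
        refine ContinuousOn.mul ?_ ?_
        · exact fun x hx => (Real.continuousAt_rpow_const x _ (Or.inl (ne_of_gt hx))).continuousWithinAt
        · exact continuousOn_const.add
            (Real.continuousOn_log.mono fun x hx => (ne_of_gt hx : x ≠ 0)).abs) hM1 hM2
    refine ⟨C, hC, fun z hz hz1 => ?_⟩
    have hzn : 0 < ‖z‖ := norm_pos_iff.2 (by rintro rfl; simp at hz)
    refine (h z hz hz1).trans (le_of_eq ?_)
    rw [logFactor, if_pos rfl, min_eq_right hz1, abs_of_nonpos (Real.log_nonpos hzn.le hz1)]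
    simp [sub_eq_add_neg]
  · have hmn : 0 < ‖m‖ := norm_pos_iff.2 hm0
    have hc : ∀ x : ℝ, 0 < x → (x : ℂ) ≠ 0 := fun x hx => Complex.ofReal_ne_zero.2 hx.ne'
    have hB : IsBasePair (fun x : ℝ => (m ^ 2 - 1 / 4) / (x : ℂ) ^ 2)
        (fun x : ℝ => (x : ℂ) ^ (1 / 2 + m)) (fun x : ℝ => (1 / 2 + m) * (x : ℂ) ^ (1 / 2 + m - 1))
        (fun x : ℝ => (x : ℂ) ^ (1 / 2 - m) / (2 * m))
        (fun x : ℝ => (1 / 2 - m) * (x : ℂ) ^ (1 / 2 - m - 1) / (2 * m)) := by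
      refine ⟨continuousOn_inv_sq _, ⟨fun x hx => hasDerivAt_ofReal_cpow _ hx, fun x hx => ?_⟩,
        ⟨fun x hx => (hasDerivAt_ofReal_cpow _ hx).div_const _, fun x hx => ?_⟩, fun x hx => ?_⟩
      · refine ((hasDerivAt_ofReal_cpow _ hx).const_mul _).congr_deriv ?_
        rw [cpow_sub_two _ (hc x hx)]
        ring
      · refine (((hasDerivAt_ofReal_cpow _ hx).const_mul _).div_const _).congr_deriv ?_
        rw [cpow_sub_two _ (hc x hx)]
        ring
      · have h1 : (x : ℂ) ^ (1 / 2 - m) * (x : ℂ) ^ (1 / 2 + m - 1) = 1 := by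
          rw [← Complex.cpow_add _ _ (hc x hx)]; ring_nf; simp
        have h2 : (x : ℂ) ^ (1 / 2 - m - 1) * (x : ℂ) ^ (1 / 2 + m) = 1 := by
          rw [← Complex.cpow_add _ _ (hc x hx)]; ring_nf; simp
        calc _ = ((1 / 2 + m) * ((x : ℂ) ^ (1 / 2 - m) * (x : ℂ) ^ (1 / 2 + m - 1)) -
            (1 / 2 - m) * ((x : ℂ) ^ (1 / 2 - m - 1) * (x : ℂ) ^ (1 / 2 + m))) / (2 * m) := by ring
          _ = 1 := by rw [h1, h2]; field_simp; ring
    have hn : ∀ x : ℝ, 0 < x → ∀ s : ℂ, ‖(x : ℂ) ^ s‖ = x ^ s.re := fun x hx s =>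
      Complex.norm_cpow_eq_rpow_re_of_pos hx s
    have hUV : PairWeights (fun x : ℝ => (x : ℂ) ^ (1 / 2 + m))
        (fun x : ℝ => (x : ℂ) ^ (1 / 2 - m) / (2 * m))
        (fun x => x ^ (1 / 2 + m.re)) (fun x => x ^ (1 / 2 - m.re) / (2 * ‖m‖)) := by
      refine ⟨fun x hx => by positivity, fun x hx => by positivity, fun x hx => ?_, fun x hx => ?_,
        fun y x hy hyx => ?_⟩
      · rw [hn x hx]; simp
      · rw [norm_div, hn x hx]; simp
      · have hx := hy.trans_le hyx
        have e : ∀ t : ℝ, 0 < t → t ^ (1 / 2 + m.re) = t ^ (1 / 2 - m.re) * t ^ (2 * m.re) := by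
          intro t ht
          rw [← Real.rpow_add ht]; congr 1; ring
        rw [e y hy, e x hx]
        have h1 : y ^ (2 * m.re) ≤ x ^ (2 * m.re) := Real.rpow_le_rpow hy.le hyx (by positivity)
        calc _ = (y ^ (1 / 2 - m.re) * x ^ (1 / 2 - m.re) / (2 * ‖m‖)) * y ^ (2 * m.re) := by ring
          _ ≤ (y ^ (1 / 2 - m.re) * x ^ (1 / 2 - m.re) / (2 * ‖m‖)) * x ^ (2 * m.re) := by gcongr
          _ = _ := by ring
    -- Of the two summands in the constant, 1/(2‖m‖) bounds the product of the weights, and 2‖m‖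
    -- cancels the denominator when U is compared with V.
    have hM1 : ∀ y : ℝ, 0 < y → y ≤ 1 → y ^ (1 / 2 + m.re) * (y ^ (1 / 2 - m.re) / (2 * ‖m‖)) ≤
        1 / (2 * ‖m‖) + 2 * ‖m‖ := by
      intro y hy hy1
      rw [mul_div_assoc', ← Real.rpow_add hy]
      have : y ^ (1 / 2 + m.re + (1 / 2 - m.re)) = y := by
        rw [show 1 / 2 + m.re + (1 / 2 - m.re) = 1 by ring, Real.rpow_one]
      rw [this]
      have : y / (2 * ‖m‖) ≤ 1 / (2 * ‖m‖) := by gcongr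
      have : 0 < 2 * ‖m‖ := by positivity
      linarith
    have hM2 : ∀ y : ℝ, 0 < y → y ≤ 1 → y ^ (1 / 2 + m.re) ≤
        (1 / (2 * ‖m‖) + 2 * ‖m‖) * (y ^ (1 / 2 - m.re) / (2 * ‖m‖)) := by
      intro y hy hy1
      have h1 : y ^ (1 / 2 + m.re) ≤ y ^ (1 / 2 - m.re) :=
        Real.rpow_le_rpow_of_exponent_ge hy hy1 (by linarith)
      have h2 : 0 ≤ 1 / (2 * ‖m‖) * (y ^ (1 / 2 - m.re) / (2 * ‖m‖)) := by positivity
      rw [add_mul, mul_div_cancel₀ _ (by positivity : 2 * ‖m‖ ≠ 0)]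
      linarith
    obtain ⟨C, hC, h⟩ := exists_norm_macdonaldIntegral_le_of_pair hB hUV (by
        refine ContinuousOn.div_const ?_ _
        exact fun x hx => (Real.continuousAt_rpow_const x _
          (Or.inl (ne_of_gt hx))).continuousWithinAt) hM1 hM2
    refine ⟨C / (2 * ‖m‖), by positivity, fun z hz hz1 => ?_⟩
    refine (h z hz hz1).trans (le_of_eq ?_)
    rw [logFactor, if_neg hm0, abs_of_nonneg hm]
    ring

/-- The two regimes are glued at |z| = 1. For |z| ≤ 1 the factor exp(-Re z) is at least exp(-1),
which accounts for the extra e. Negative Re m is reduced to the positive case by evenness in the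
order. -/
lemma exists_norm_macdonaldIntegral_le (m : ℂ) :
    ∃ C : ℝ, 0 < C ∧ ∀ z : ℂ, 0 < z.re → ‖macdonaldIntegral m z‖ ≤ C * wK m z := by
  obtain ⟨C₁, hC₁, h1⟩ := exists_norm_macdonaldIntegral_le_large m
  have hsmall : ∃ C : ℝ, 0 < C ∧ ∀ z : ℂ, 0 < z.re → ‖z‖ ≤ 1 →
      ‖macdonaldIntegral m z‖ ≤ C * (‖z‖ ^ (1 / 2 - |m.re|) * logFactor m ‖z‖) := by
    rcases le_total 0 m.re with h | h
    · exact exists_norm_macdonaldIntegral_le_small_of_re_nonneg h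
    · obtain ⟨C, hC, hb⟩ := exists_norm_macdonaldIntegral_le_small_of_re_nonneg (m := -m)
        (by simpa using h)
      refine ⟨C, hC, fun z hz hz1 => ?_⟩
      have := hb z hz hz1
      rw [macdonaldIntegral_neg] at this
      simpa [logFactor] using this
  obtain ⟨C₂, hC₂, h2⟩ := hsmall
  refine ⟨C₁ + C₂ * Real.exp 1, by positivity, fun z hz => ?_⟩
  have hzn : 0 < ‖z‖ := norm_pos_iff.2 (by rintro rfl; simp at hz)
  have hw := wK_pos m (norm_pos_iff.1 hzn)
  rcases le_total 1 ‖z‖ with h | h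
  · have e : wK m z = Real.exp (-z.re) := by
      rw [wK, min_eq_left h, Real.one_rpow, logFactor, min_eq_left h]; simp
    refine (h1 z hz h).trans ?_
    rw [e]
    gcongr
    have : 0 < C₂ * Real.exp 1 := by positivity
    linarith
  · have e : Real.exp 1 * wK m z = Real.exp (1 - z.re) *
        (‖z‖ ^ (1 / 2 - |m.re|) * logFactor m ‖z‖) := by
      rw [wK, min_eq_right h, sub_eq_add_neg 1 z.re, Real.exp_add]; ring
    have hre : z.re ≤ 1 := (Complex.re_le_norm z).trans h
    have h3 : 1 ≤ Real.exp (1 - z.re) := Real.one_le_exp (by linarith)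
    have h4 := one_le_logFactor m hzn
    calc _ ≤ C₂ * (‖z‖ ^ (1 / 2 - |m.re|) * logFactor m ‖z‖) := h2 z hz h
      _ ≤ C₂ * (Real.exp 1 * wK m z) := by
          rw [e]
          exact mul_le_mul_of_nonneg_left (le_mul_of_one_le_left (by positivity) h3) hC₂.le
      _ ≤ _ := by nlinarith

lemma exists_norm_besselI_le {m : ℂ} (hm : -1 < m.re) :
    ∃ C : ℝ, 0 < C ∧ ∀ z : ℂ, 0 ≤ z.re → z ≠ 0 → ‖besselI m z‖ ≤ C * wI m.re z := by
  obtain ⟨C₁, hC₁, h1⟩ := exists_norm_besselI_le_large hm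
  obtain ⟨C₂, hC₂, h2⟩ := exists_norm_besselI_le_small hm
  refine ⟨C₁ + C₂, by positivity, fun z hz hz0 => ?_⟩
  have hzn : 0 < ‖z‖ := norm_pos_iff.2 hz0
  rcases le_total 1 ‖z‖ with h | h
  · rw [wI, min_eq_left h, Real.one_rpow, mul_one]
    refine (h1 z hz h).trans ?_
    gcongr
    linarith
  · rw [wI, min_eq_right h]
    calc _ ≤ C₂ * ‖z‖ ^ (1 / 2 + m.re) := h2 z hz0 h
      _ ≤ (C₁ + C₂) * (1 * ‖z‖ ^ (1 / 2 + m.re)) := by rw [one_mul]; gcongr; linarith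
      _ ≤ _ := by gcongr; exact Real.one_le_exp hz

lemma continuousOn_logFactor (m : ℂ) : ContinuousOn (logFactor m) (Ioi 0) := by
  unfold logFactor
  split_ifs
  · refine continuousOn_const.sub (ContinuousOn.log (by fun_prop) fun x hx => ?_)
    exact (lt_min one_pos hx).ne'
  · exact continuousOn_const

lemma continuousOn_wK (m : ℂ) : ContinuousOn (wK m) {0}ᶜ := by
  unfold wK
  refine ContinuousOn.mul (ContinuousOn.mul (by fun_prop) ?_) ?_
  · refine ContinuousOn.rpow_const (by fun_prop) fun x hx => Or.inl ?_
    exact (lt_min one_pos (norm_pos_iff.2 hx)).ne'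
  · exact (continuousOn_logFactor m).comp continuous_norm.continuousOn
      fun x hx => norm_pos_iff.2 hx

lemma continuousOn_wI (s : ℝ) : ContinuousOn (wI s) {0}ᶜ := by
  unfold wI
  refine ContinuousOn.mul (by fun_prop) ?_
  refine ContinuousOn.rpow_const (by fun_prop) fun x hx => Or.inl ?_
  exact (lt_min one_pos (norm_pos_iff.2 hx)).ne'

/-! ### Boundary values of the Macdonald function on the imaginary axis -/

/-- A function on the open half-plane with locally bounded derivative extends continuously to the
boundary. -/
lemma exists_tendsto_of_deriv_bounded {F F' : ℂ → ℂ} {z₀ : ℂ} {C : ℝ}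
    (hF : ∀ z : ℂ, 0 < z.re → HasDerivAt F (F' z) z)
    (hC : ∀ᶠ z in 𝓝 z₀, 0 < z.re → ‖F' z‖ ≤ C) :
    ∃ y, Tendsto F (𝓝[{z : ℂ | 0 < z.re}] z₀) (𝓝 y) := by
  obtain ⟨r, hr, hb⟩ := Metric.eventually_nhds_iff_ball.1 hC
  set s : Set ℂ := {z : ℂ | 0 < z.re} ∩ Metric.ball z₀ r with hs
  have hconv : Convex ℝ s := (convex_halfSpace_re_gt 0).inter (convex_ball z₀ r)
  -- The intersection of the half-plane with a ball is convex, so a bounded derivative gives a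
  -- Lipschitz function, and Lipschitz functions extend to the boundary.
  have hlip : LipschitzOnWith C.toNNReal F s :=
    hconv.lipschitzOnWith_of_nnnorm_hasDerivWithin_le
      (fun z hz => (hF z hz.1).hasDerivWithinAt) fun z hz => by
        rw [← NNReal.coe_le_coe, coe_nnnorm]
        exact (hb z hz.2 hz.1).trans (Real.le_coe_toNNReal C)
  obtain ⟨g, hg, hEq⟩ := hlip.extend_finite_dimension
  refine ⟨g z₀, ?_⟩
  have h1 : Tendsto g (𝓝[{z : ℂ | 0 < z.re}] z₀) (𝓝 (g z₀)) :=
    hg.continuous.continuousAt.mono_left nhdsWithin_le_nhds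
  refine h1.congr' ?_
  filter_upwards [self_mem_nhdsWithin, nhdsWithin_le_nhds (Metric.ball_mem_nhds z₀ hr)] with z h h'
  exact (hEq ⟨h, h'⟩).symm

lemma exists_eventually_norm_macdonaldIntegral_le (m : ℂ) {z₀ : ℂ} (hz₀ : z₀ ≠ 0) :
    ∃ C : ℝ, ∀ᶠ z in 𝓝 z₀, 0 < z.re → ‖macdonaldIntegral m z‖ ≤ C := by
  obtain ⟨C, hC, h⟩ := exists_norm_macdonaldIntegral_le m
  have hcont : ContinuousAt (wK m) z₀ :=
    (continuousOn_wK m).continuousAt (isOpen_compl_singleton.mem_nhds hz₀)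
  refine ⟨C * (wK m z₀ + 1), ?_⟩
  filter_upwards [hcont.eventually (gt_mem_nhds (lt_add_one _))] with z hz hz1
  exact (h z hz1).trans (by gcongr)

/-- The derivative involves only the orders m and m + 1, both of which are bounded near every
nonzero boundary point. -/
lemma exists_tendsto_macdonaldIntegral (m : ℂ) {z₀ : ℂ} (hz₀ : z₀ ≠ 0) :
    ∃ y, Tendsto (macdonaldIntegral m) (𝓝[{z : ℂ | 0 < z.re}] z₀) (𝓝 y) := by
  obtain ⟨C₀, h0⟩ := exists_eventually_norm_macdonaldIntegral_le m hz₀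
  obtain ⟨C₁, h1⟩ := exists_eventually_norm_macdonaldIntegral_le (m + 1) hz₀
  have hcont : ContinuousAt (fun z : ℂ => ‖(m + 1 / 2) / z‖) z₀ :=
    (continuousAt_const.div continuousAt_id hz₀).norm
  refine exists_tendsto_of_deriv_bounded (fun z hz => hasDerivAt_macdonaldIntegral m hz)
    (C := C₁ + (‖(m + 1 / 2) / z₀‖ + 1) * C₀) ?_
  filter_upwards [h0, h1, hcont.eventually (gt_mem_nhds (lt_add_one _))] with z k0 k1 k2 hz
  refine (norm_add_le _ _).trans ?_
  rw [norm_neg, norm_mul]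
  have := k0 hz
  have := k1 hz
  gcongr

/-- The closed right half-plane without `0`. -/
def halfPlane : Set ℂ := {z : ℂ | 0 ≤ z.re ∧ z ≠ 0}

lemma halfPlane_subset_closure : halfPlane ⊆ closure {z : ℂ | 0 < z.re} := by
  intro z hz
  rw [Complex.closure_setOfPred_lt_re]
  exact hz.1

lemma mem_halfPlane_of_re_pos {z : ℂ} (hz : 0 < z.re) : z ∈ halfPlane :=
  ⟨hz.le, by rintro rfl; simp at hz⟩

lemma mul_mem_halfPlane {k : ℂ} (hk : k ∈ halfPlane) {x : ℝ} (hx : 0 < x) :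
    k * x ∈ halfPlane :=
  ⟨by rw [Complex.re_mul_ofReal]; exact mul_nonneg hk.1 hx.le,
    mul_ne_zero hk.2 (Complex.ofReal_ne_zero.2 hx.ne')⟩

lemma continuousOn_macdonaldK (m : ℂ) : ContinuousOn (macdonaldK m) halfPlane :=
  continuousOn_extendFrom halfPlane_subset_closure fun _ hz =>
    exists_tendsto_macdonaldIntegral m hz.2

lemma tendsto_macdonaldK (m : ℂ) {z : ℂ} (hz : z ∈ halfPlane) :
    Tendsto (macdonaldIntegral m) (𝓝[{z : ℂ | 0 < z.re}] z) (𝓝 (macdonaldK m z)) :=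
  tendsto_extendFrom (exists_tendsto_macdonaldIntegral m hz.2)

lemma macdonaldK_eq (m : ℂ) {z : ℂ} (hz : 0 < z.re) : macdonaldK m z = macdonaldIntegral m z :=
  extendFrom_extends (fun _ hz => (hasDerivAt_macdonaldIntegral m hz).continuousAt.continuousWithinAt)
    z hz

lemma macdonaldK_neg (m : ℂ) : macdonaldK (-m) = macdonaldK m := by
  unfold macdonaldK
  congr 1
  ext z
  exact macdonaldIntegral_neg m z

/-- An identity between continuous functions extends to the boundary of the half-plane. -/
lemma eqOn_halfPlane {F G : ℂ → ℂ} (hF : ContinuousOn F halfPlane) (hG : ContinuousOn G halfPlane)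
    (h : ∀ z : ℂ, 0 < z.re → F z = G z) : EqOn F G halfPlane := by
  intro z hz
  have hne : (𝓝[{z : ℂ | 0 < z.re}] z).NeBot :=
    mem_closure_iff_nhdsWithin_neBot.1 (halfPlane_subset_closure hz)
  have hsub : {z : ℂ | 0 < z.re} ⊆ halfPlane := fun z hz => mem_halfPlane_of_re_pos hz
  have h1 : Tendsto F (𝓝[{z : ℂ | 0 < z.re}] z) (𝓝 (F z)) := (hF z hz).mono hsub
  have h2 : Tendsto G (𝓝[{z : ℂ | 0 < z.re}] z) (𝓝 (G z)) := (hG z hz).mono hsub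
  refine tendsto_nhds_unique h1 (h2.congr' ?_)
  filter_upwards [self_mem_nhdsWithin] with y hy
  exact (h y hy).symm

lemma exists_norm_macdonaldK_le (m : ℂ) :
    ∃ C : ℝ, 0 < C ∧ ∀ z ∈ halfPlane, ‖macdonaldK m z‖ ≤ C * wK m z := by
  obtain ⟨C, hC, h⟩ := exists_norm_macdonaldIntegral_le m
  refine ⟨C, hC, fun z hz => ?_⟩
  have hne : (𝓝[{z : ℂ | 0 < z.re}] z).NeBot :=
    mem_closure_iff_nhdsWithin_neBot.1 (halfPlane_subset_closure hz)
  have hcont : ContinuousAt (fun z => C * wK m z) z :=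
    continuousAt_const.mul ((continuousOn_wK m).continuousAt (isOpen_compl_singleton.mem_nhds hz.2))
  refine le_of_tendsto_of_tendsto (tendsto_macdonaldK m hz).norm
    (hcont.mono_left nhdsWithin_le_nhds) ?_
  filter_upwards [self_mem_nhdsWithin] with y hy
  exact h y hy

/-- A derivative on the open half-plane that is continuous up to the boundary is a derivative along
rays in the boundary. -/
lemma hasDerivAt_ray_of_continuousOn {F F' : ℂ → ℂ} (hF : ContinuousOn F halfPlane)
    (hF' : ContinuousOn F' halfPlane) (h : ∀ z : ℂ, 0 < z.re → HasDerivAt F (F' z) z)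
    {k : ℂ} (hk : k ∈ halfPlane) {x : ℝ} (hx : 0 < x) :
    HasDerivAt (fun x : ℝ => F (k * x)) (k * F' (k * x)) x := by
  have hz := mul_mem_halfPlane hk hx
  set z₀ := k * x with hz₀
  have hr : 0 < ‖z₀‖ / 2 := half_pos (norm_pos_iff.2 hz.2)
  -- The radius keeps the closure of this convex set away from 0, so continuity is available on all
  -- of it and the derivative extends to the closure.
  set s : Set ℂ := Metric.ball z₀ (‖z₀‖ / 2) ∩ {z : ℂ | 0 < z.re} with hs
  have hopen : IsOpen s := Metric.isOpen_ball.inter (isOpen_lt continuous_const Complex.continuous_re)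
  have hconv : Convex ℝ s := (convex_ball _ _).inter (convex_halfSpace_re_gt 0)
  have hsub : s ⊆ halfPlane := fun z hz => mem_halfPlane_of_re_pos hz.2
  have hcl : closure s ⊆ halfPlane := by
    intro z hz
    have h1 : z ∈ closure {z : ℂ | 0 < z.re} := closure_mono inter_subset_right hz
    have h2 : z ∈ Metric.closedBall z₀ (‖z₀‖ / 2) :=
      Metric.closure_ball_subset_closedBall (closure_mono inter_subset_left hz)
    rw [Complex.closure_setOfPred_lt_re] at h1
    refine ⟨h1, ?_⟩
    rintro rfl
    rw [Metric.mem_closedBall, dist_zero_left] at h2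
    linarith
  have hfd : ∀ y ∈ s, HasFDerivAt F (F' y • (1 : ℂ →L[ℝ] ℂ)) y := fun y hy =>
    (h y hy.2).complexToReal_fderiv
  have hlim : Tendsto (fun y => fderiv ℝ F y) (𝓝[s] z₀) (𝓝 (F' z₀ • (1 : ℂ →L[ℝ] ℂ))) := by
    have h1 : Tendsto F' (𝓝[s] z₀) (𝓝 (F' z₀)) := (hF' z₀ hz).mono hsub
    refine (h1.smul_const (1 : ℂ →L[ℝ] ℂ)).congr' ?_
    filter_upwards [self_mem_nhdsWithin] with y hy
    exact (hfd y hy).fderiv.symm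
  have key := hasFDerivWithinAt_closure_of_tendsto_fderiv
    (fun y hy => (hfd y hy).differentiableAt.differentiableWithinAt) hconv hopen
    (fun y hy => (hF y (hcl hy)).mono hsub) hlim
  have hray : HasDerivAt (fun x : ℝ => k * (x : ℂ)) k x := by
    simpa using (hasDerivAt_id (x : ℂ)).comp_ofReal.const_mul k
  -- When k is imaginary the ray runs inside the boundary. The derivative within the closure
  -- suffices because the ray stays in it for parameters near x.
  set t : Set ℝ := {y : ℝ | k * (y : ℂ) ∈ closure s} with ht
  have htn : t ∈ 𝓝 x := by
    have h1 : ∀ᶠ y : ℝ in 𝓝 x, k * (y : ℂ) ∈ Metric.ball z₀ (‖z₀‖ / 2) :=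
      hray.continuousAt.eventually (Metric.ball_mem_nhds _ hr)
    filter_upwards [h1, lt_mem_nhds hx] with y hy hy0
    exact Metric.isOpen_ball.inter_closure
      ⟨hy, halfPlane_subset_closure (mul_mem_halfPlane hk hy0)⟩
  have h2 := key.comp_hasDerivWithinAt (s := t) x (f := fun x : ℝ => k * (x : ℂ))
    hray.hasDerivWithinAt (fun y hy => hy)
  refine (h2.hasDerivAt htn).congr_deriv ?_
  simp [mul_comm]

lemma continuousOn_div_halfPlane (c : ℂ) : ContinuousOn (fun z : ℂ => c / z) halfPlane :=
  continuousOn_const.div continuousOn_id fun _ hz => hz.2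

lemma raySystem_macdonaldK (m : ℂ) {k : ℂ} (hk : k ∈ halfPlane) :
    RaySystem (-1) m k (fun x => macdonaldK m (k * x)) (fun x => macdonaldK (m + 1) (k * x)) := by
  have hc0 := continuousOn_macdonaldK m
  have hc1 := continuousOn_macdonaldK (m + 1)
  have heq : ∀ (n : ℂ) (z : ℂ), 0 < z.re → macdonaldIntegral n =ᶠ[𝓝 z] macdonaldK n := by
    intro n z hz
    filter_upwards [(isOpen_lt continuous_const Complex.continuous_re).mem_nhds hz] with y hy
    exact (macdonaldK_eq n hy).symm
  have hd0 : ∀ z : ℂ, 0 < z.re → HasDerivAt (macdonaldK m)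
      (-macdonaldK (m + 1) z + (m + 1 / 2) / z * macdonaldK m z) z := by
    intro z hz
    rw [macdonaldK_eq _ hz, macdonaldK_eq _ hz]
    exact (hasDerivAt_macdonaldIntegral m hz).congr_of_eventuallyEq (heq m z hz).symm
  have hd1 : ∀ z : ℂ, 0 < z.re → HasDerivAt (macdonaldK (m + 1))
      (-macdonaldK m z - (m + 1 / 2) / z * macdonaldK (m + 1) z) z := by
    intro z hz
    rw [macdonaldK_eq _ hz, macdonaldK_eq _ hz]
    exact (hasDerivAt_macdonaldIntegral_succ m hz).congr_of_eventuallyEq (heq _ z hz).symm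
  intro x hx
  have r0 := hasDerivAt_ray_of_continuousOn hc0
    (hc1.neg.add ((continuousOn_div_halfPlane _).mul hc0)) hd0 hk hx
  have r1 := hasDerivAt_ray_of_continuousOn hc1
    (hc0.neg.sub ((continuousOn_div_halfPlane _).mul hc1)) hd1 hk hx
  refine ⟨r0.congr_deriv ?_, r1.congr_deriv ?_⟩
  · simp
  · simp

/-! ### The Wronskian of the Bessel and Macdonald functions -/

lemma logFactor_of_le_one (m : ℂ) {t : ℝ} (ht : t ≤ 1) :
    logFactor m t = if m = 0 then 1 - Real.log t else 1 := by
  rw [logFactor, min_eq_right ht]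

/-- A positive power beats the logarithmic factor at `0`. -/
lemma tendsto_rpow_mul_logFactor (m : ℂ) {a : ℝ} (ha : 0 < a) :
    Tendsto (fun t : ℝ => t ^ a * logFactor m t) (𝓝[>] 0) (𝓝 0) := by
  have h0 : Tendsto (fun t : ℝ => t ^ a) (𝓝[>] 0) (𝓝 0) := by
    have := (Real.continuousAt_rpow_const 0 a (Or.inr ha.le)).tendsto
    rw [Real.zero_rpow ha.ne'] at this
    exact this.mono_left nhdsWithin_le_nhds
  have hle : ∀ᶠ t : ℝ in 𝓝[>] 0, t ≤ 1 := nhdsWithin_le_nhds (Iic_mem_nhds one_pos)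
  by_cases hm : m = 0
  · have h1 := h0.sub (tendsto_log_mul_rpow_nhdsGT_zero ha)
    rw [sub_zero] at h1
    refine h1.congr' ?_
    filter_upwards [hle] with t ht
    rw [logFactor_of_le_one m ht, if_pos hm]
    ring
  · refine h0.congr' ?_
    filter_upwards [hle] with t ht
    rw [logFactor_of_le_one m ht, if_neg hm, mul_one]

lemma besselE_zero (ν : ℂ) : besselE ν 0 = (Complex.Gamma (ν + 1))⁻¹ := by
  rw [besselE, tsum_eq_single 0]
  · simp
  · intro n hn
    simp [hn]

lemma continuous_besselE {ν : ℂ} (hν : -1 < ν.re) : Continuous (besselE ν) :=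
  continuous_iff_continuousAt.2 fun t => (hasDerivAt_besselE hν t).continuousAt

/-- After the powers of x cancel, the Macdonald factor contributes Γ(m + 1) and the Bessel factor
its inverse. -/
lemma tendsto_macdonaldIntegral_succ_mul_besselI {m : ℂ} (hm : -1 < m.re) :
    Tendsto (fun x : ℝ => macdonaldIntegral (m + 1) x * besselI m x) (𝓝[>] 0) (𝓝 1) := by
  have hΓ : Complex.Gamma (m + 1) ≠ 0 := by simpa using Gamma_add_ne_zero hm 0
  have h1 := tendsto_cpow_mul_macF (μ := m + 1) (by simp; linarith)
  have h2 : Tendsto (fun x : ℝ => besselE m ((x / 2 : ℂ) ^ 2)) (𝓝[>] 0)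
      (𝓝 (Complex.Gamma (m + 1))⁻¹) := by
    have hc : Continuous fun x : ℝ => besselE m ((x / 2 : ℂ) ^ 2) :=
      (continuous_besselE hm).comp (by fun_prop)
    have := hc.tendsto 0
    simp only [Complex.ofReal_zero, zero_div, ne_eq, OfNat.ofNat_ne_zero, not_false_eq_true,
      zero_pow, besselE_zero] at this
    exact this.mono_left nhdsWithin_le_nhds
  have h3 := h1.mul h2
  rw [mul_inv_cancel₀ hΓ] at h3
  refine h3.congr' ?_
  filter_upwards [self_mem_nhdsWithin] with x hx
  have hx : (0 : ℝ) < x := hx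
  have hx0 : (x : ℂ) ≠ 0 := Complex.ofReal_ne_zero.2 hx.ne'
  have hx2 : (x / 2 : ℂ) ≠ 0 := div_ne_zero hx0 two_ne_zero
  rw [macdonaldIntegral_eq, besselI_eq _ hx0, show m + 1 = 1 / 2 + (m + 1 / 2) by ring,
    Complex.cpow_add _ _ hx2]
  have e1 : (x / 2 : ℂ) ^ (1 / 2 : ℂ) = x ^ (1 / 2 : ℂ) / (Real.sqrt (2 * Real.pi) : ℂ) *
      (Real.sqrt Real.pi : ℂ) := by
    have : (x / 2 : ℂ) = ((x / 2 : ℝ) : ℂ) := by push_cast; rfl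
    rw [this, ofReal_cpow_half (by positivity), ofReal_cpow_half hx.le, ← Complex.ofReal_div,
      ← Complex.ofReal_mul, Real.sqrt_div hx.le, Real.sqrt_mul zero_le_two]
    have : Real.sqrt Real.pi ≠ 0 := by positivity
    congr 1
    field_simp
  rw [e1]
  ring

/-- The total exponent is 2 + Re m - |Re m|, which is positive because Re m > -1; it beats the
logarithm. -/
lemma tendsto_wK_mul_wI_succ {m : ℂ} (hm : -1 < m.re) :
    Tendsto (fun x : ℝ => wK m x * wI (m.re + 1) x) (𝓝[>] 0) (𝓝 0) := by
  have ha : 0 < 2 + m.re - |m.re| := by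
    rcases le_total 0 m.re with h | h
    · rw [abs_of_nonneg h]; linarith
    · rw [abs_of_nonpos h]; linarith
  refine (tendsto_rpow_mul_logFactor m ha).congr' ?_
  filter_upwards [self_mem_nhdsWithin, nhdsWithin_le_nhds (Iic_mem_nhds one_pos)] with x hx hx1
  have hx : (0 : ℝ) < x := hx
  have hn : ‖(x : ℂ)‖ = x := by rw [Complex.norm_real, Real.norm_of_nonneg hx.le]
  rw [wK, wI, hn, min_eq_right hx1, show 2 + m.re - |m.re| = (1 / 2 - |m.re|) + (1 / 2 + (m.re + 1))
    by ring, Real.rpow_add hx]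
  have : Real.exp (-(x : ℂ).re) * Real.exp (x : ℂ).re = 1 := by rw [← Real.exp_add]; simp
  linear_combination (-(x ^ (1 / 2 - |m.re|) * x ^ (1 / 2 + (m.re + 1)) * logFactor m x)) * this

lemma continuousOn_besselI {m : ℂ} (hm : -1 < m.re) : ContinuousOn (besselI m) halfPlane :=
  fun _ hz => (hasDerivAt_besselI hm
    (mem_slitPlane_of_re_nonneg hz.1 hz.2)).continuousAt.continuousWithinAt

/-- By the two first order systems the expression has zero derivative in the open half-plane. The
constant is read off on the positive axis at 0, where the first product vanishes and the second
tends to 1. Continuity carries the identity to the imaginary axis. -/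
lemma macdonaldK_wronskian {m : ℂ} (hm : -1 < m.re) {z : ℂ} (hz : z ∈ halfPlane) :
    macdonaldK m z * besselI (m + 1) z + macdonaldK (m + 1) z * besselI m z = 1 := by
  have hm1 : -1 < (m + 1).re := by simp; linarith
  have hopen : IsOpen {z : ℂ | 0 < z.re} := isOpen_lt continuous_const Complex.continuous_re
  have hder : ∀ z ∈ {z : ℂ | 0 < z.re}, HasDerivAt (fun z => macdonaldIntegral m z *
      besselI (m + 1) z + macdonaldIntegral (m + 1) z * besselI m z) 0 z := by
    intro z hz
    have hs := mem_slitPlane_of_re_nonneg hz.le (mem_halfPlane_of_re_pos hz).2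
    refine (((hasDerivAt_macdonaldIntegral m hz).fun_mul (hasDerivAt_besselI_succ hm hs)).fun_add
      ((hasDerivAt_macdonaldIntegral_succ m hz).fun_mul (hasDerivAt_besselI hm hs))).congr_deriv ?_
    ring
  obtain ⟨a, ha⟩ := hopen.exists_is_const_of_deriv_eq_zero
    (convex_halfSpace_re_gt 0).isPreconnected
    (fun z hz => (hder z hz).differentiableAt.differentiableWithinAt) fun z hz => (hder z hz).deriv
  have h0 : Tendsto (fun x : ℝ => macdonaldIntegral m x * besselI (m + 1) x) (𝓝[>] 0) (𝓝 0) := by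
    obtain ⟨C₁, hC₁, h1⟩ := exists_norm_macdonaldIntegral_le m
    obtain ⟨C₂, hC₂, h2⟩ := exists_norm_besselI_le hm1
    have := (tendsto_wK_mul_wI_succ hm).const_mul (C₁ * C₂)
    rw [mul_zero] at this
    refine squeeze_zero_norm' ?_ this
    filter_upwards [self_mem_nhdsWithin] with x hx
    have hx : (0 : ℝ) < x := hx
    have hxr : 0 < (x : ℂ).re := by simpa using hx
    have hx0 := (mem_halfPlane_of_re_pos hxr).2
    rw [norm_mul]
    calc _ ≤ (C₁ * wK m x) * (C₂ * wI (m + 1).re x) :=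
          mul_le_mul (h1 _ hxr) (h2 _ hxr.le hx0) (norm_nonneg _)
            (mul_pos hC₁ (wK_pos m hx0)).le
      _ = _ := by simp; ring
  have ha1 : a = 1 := by
    have h3 := h0.add (tendsto_macdonaldIntegral_succ_mul_besselI hm)
    rw [zero_add] at h3
    refine tendsto_nhds_unique (tendsto_const_nhds.congr' ?_) h3
    filter_upwards [self_mem_nhdsWithin] with x hx
    have hxr : 0 < (x : ℂ).re := by simpa using hx
    exact (ha x hxr).symm
  have hcont := ((continuousOn_macdonaldK m).mul (continuousOn_besselI hm1)).add
    ((continuousOn_macdonaldK (m + 1)).mul (continuousOn_besselI hm))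
  refine eqOn_halfPlane (F := fun z => macdonaldK m z * besselI (m + 1) z +
    macdonaldK (m + 1) z * besselI m z) (G := fun _ => 1) hcont continuousOn_const ?_ hz
  intro z hz
  have := ha z hz
  rw [ha1] at this
  simpa only [macdonaldK_eq _ hz] using this

/-! ### Perturbed solutions with prescribed behavior at an endpoint -/

/-- A perturbation `Q` of the equation `f'' = P f` with weights controlling a fundamental system,
such that the Volterra equations at both endpoints are solvable. -/
structure Perturbation (P Q u u' v v' : ℝ → ℂ) (U V W ψ : ℝ → ℝ) : Prop where
  base : IsBasePair P u u' v v'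
  weights : PairWeights u v U V
  le_W : ∀ x, 0 < x → U x ≤ W x
  locQ : LocallyIntegrableOn Q (Ioi 0) volume
  intψ : IntegrableOn ψ (Ioi 0) volume
  le_ψ : ∀ x, 0 < x → 2 * (V x * W x * ‖Q x‖) ≤ ψ x

/-- The solution of the perturbed equation that behaves like `f₀` at `∞`. -/
def solInfty (Q u v f₀ : ℝ → ℂ) : ℝ → ℂ := volterraSol (fun x => Ioi x) Q v u f₀

/-- The solution of the perturbed equation that behaves like `f₀` at `0`. -/
def solZero (Q u v f₀ : ℝ → ℂ) : ℝ → ℂ := volterraSol (fun x => Ioc 0 x) Q u v f₀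

/-- The bound `e^{2 ∫ ψ}` in the Volterra estimates. -/
def volterraBound (ψ : ℝ → ℝ) : ℝ := Real.exp (2 * ∫ t in Ioi (0 : ℝ), ψ t)

lemma volterraBound_pos (ψ : ℝ → ℝ) : 0 < volterraBound ψ := Real.exp_pos _

/-- `f` is a solution of the perturbed equation, represented at `∞` in the basis `u`, `v`. -/
structure RepInfty (P Q u u' v v' : ℝ → ℂ) (U V ψ : ℝ → ℝ) (f₀ f₀' f f' A B : ℝ → ℂ) (K : ℝ) :
    Prop where
  sol : IsSol (fun x => P x + Q x) f f'
  le : ∀ x, 0 < x → ‖f x‖ ≤ K * V x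
  eq : ∀ x, 0 < x → f x = f₀ x + (v x * A x - u x * B x)
  eq' : ∀ x, 0 < x → f' x = f₀' x + (v' x * A x - u' x * B x)
  leA : ∀ x, 0 < x → ‖A x‖ ≤ K * ∫ t in Ioi x, ψ t
  leB : ∀ x, 0 < x → U x * ‖B x‖ ≤ K * V x * ∫ t in Ioi x, ψ t

/-- `g` is a solution of the perturbed equation, represented at `0` in the basis `u`, `v`. -/
structure RepZero (P Q u u' v v' : ℝ → ℂ) (U V W ψ : ℝ → ℝ) (g₀ g₀' g g' A B : ℝ → ℂ) (K : ℝ) :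
    Prop where
  sol : IsSol (fun x => P x + Q x) g g'
  le : ∀ x, 0 < x → ‖g x‖ ≤ K * W x
  eq : ∀ x, 0 < x → g x = g₀ x + (u x * A x - v x * B x)
  eq' : ∀ x, 0 < x → g' x = g₀' x + (u' x * A x - v' x * B x)
  leA : ∀ x, 0 < x → ‖A x‖ ≤ K * ∫ t in Ioc 0 x, ψ t
  leB : ∀ x, 0 < x → V x * ‖B x‖ ≤ K * U x * ∫ t in Ioc 0 x, ψ t

section Perturbation

variable {P Q u u' v v' : ℝ → ℂ} {U V W ψ : ℝ → ℝ}

lemma Perturbation.posW (h : Perturbation P Q u u' v v' U V W ψ) {x : ℝ} (hx : 0 < x) :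
    0 < W x := (h.weights.posU x hx).trans_le (h.le_W x hx)

lemma Perturbation.nonneg (h : Perturbation P Q u u' v v' U V W ψ) {x : ℝ} (hx : 0 < x) :
    0 ≤ ψ x := by
  have := h.weights.posV x hx
  have := h.posW hx
  exact le_trans (by positivity) (h.le_ψ x hx)

lemma Perturbation.le_ψ' (h : Perturbation P Q u u' v v' U V W ψ) {x : ℝ} (hx : 0 < x) :
    2 * (U x * V x * ‖Q x‖) ≤ ψ x := by
  refine le_trans ?_ (h.le_ψ x hx)
  have := (h.weights.posV x hx).le
  have := h.le_W x hx
  rw [mul_comm (U x)]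
  gcongr

lemma Perturbation.dataInfty (h : Perturbation P Q u u' v v' U V W ψ) :
    VolterraData (fun x => Ioi x) (-1) P Q v v' u u' V ψ (fun x => V x / U x) :=
  h.base.volterraData_infty h.weights h.locQ h.intψ fun _ hx => h.le_ψ' hx

lemma Perturbation.dataZero (h : Perturbation P Q u u' v v' U V W ψ) :
    VolterraData (fun x => Ioc 0 x) 1 P Q u u' v v' W ψ (fun x => U x / V x) :=
  h.base.volterraData_zero h.weights h.le_W h.locQ h.intψ h.le_ψ

lemma Perturbation.weightInfty (h : Perturbation P Q u u' v v' U V W ψ) :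
    ∃ E, VolterraWeight (Ioi 0) (fun x => Ioi x) ψ E (volterraBound ψ) :=
  exists_volterraWeight_right measurableSet_Ioi
    (fun _ hx => (inter_eq_right.2 (Ioi_subset_Ioi (le_of_lt hx))).symm) h.intψ fun _ hx => h.nonneg hx

lemma Perturbation.weightZero (h : Perturbation P Q u u' v v' U V W ψ) :
    ∃ E, VolterraWeight (Ioi 0) (fun x => Ioc 0 x) ψ E (volterraBound ψ) :=
  exists_volterraWeight_left measurableSet_Ioi
    (fun _ _ => Ioi_inter_Iic.symm) h.intψ fun _ hx => h.nonneg hx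

lemma norm_integral_le_mul {S : Set ℝ} (hS : MeasurableSet S) {h : ℝ → ℂ} {φ : ℝ → ℝ} {K : ℝ}
    (hφ : IntegrableOn φ S volume) (hb : ∀ y ∈ S, ‖h y‖ ≤ K * φ y) :
    ‖∫ y in S, h y‖ ≤ K * ∫ y in S, φ y := by
  rw [← integral_const_mul]
  exact norm_integral_le_of_norm_le (hφ.const_mul K)
    ((ae_restrict_iff' hS).2 (Eventually.of_forall hb))

/-- The coefficients are A = ∫ u Q f and B = ∫ v Q f over (x, ∞). The latter is small only relative
to V/U, which is exactly what its product with `u` requires. -/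
lemma Perturbation.repInfty (h : Perturbation P Q u u' v v' U V W ψ) {f₀ f₀' : ℝ → ℂ} {C : ℝ}
    (hC : 0 ≤ C) (hf₀ : IsClassicalSol P f₀ f₀') (hb : ∀ x, 0 < x → ‖f₀ x‖ ≤ C * V x) :
    ∃ f' A B, RepInfty P Q u u' v v' U V ψ f₀ f₀' (solInfty Q u v f₀) f' A B
      (2 * C * volterraBound ψ) := by
  obtain ⟨E, hE⟩ := h.weightInfty
  have hD := h.dataInfty
  set K := 2 * C * volterraBound ψ with hKd
  have hK : 0 ≤ K := by have := volterraBound_pos ψ; positivity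
  have hle : ∀ x, 0 < x → ‖solInfty Q u v f₀ x‖ ≤ K * V x :=
    fun x hx => hD.norm_volterraSol_le hE hC hb hx
  refine ⟨_, _, _, hD.isSol hE hC hf₀ hb, hle, fun x hx => hD.volterraSol_eq hE hC
    (continuousOn_of_hasDerivAt hf₀.1) hb hx, fun _ _ => rfl, fun x hx => ?_, fun x hx => ?_⟩
  · refine norm_integral_le_mul measurableSet_Ioi (h.intψ.mono_set (Ioi_subset_Ioi hx.le))
      fun y hy => ?_
    have hy0 : 0 < y := hx.trans hy
    rw [norm_mul, norm_mul]
    calc _ ≤ ‖u y‖ * (‖Q y‖ * (K * V y)) := by gcongr; exact hle y hy0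
      _ = K * (‖u y‖ * ‖Q y‖ * V y) := by ring
      _ ≤ K * ψ y := by gcongr; exact hD.boundq y hy0
  · have hU := h.weights.posU x hx
    rw [← le_div_iff₀' hU]
    have : K * V x * (∫ t in Ioi x, ψ t) / U x = (K * V x / U x) * ∫ t in Ioi x, ψ t := by ring
    rw [this]
    refine norm_integral_le_mul measurableSet_Ioi (h.intψ.mono_set (Ioi_subset_Ioi hx.le))
      fun y hy => ?_
    have hy0 : 0 < y := hx.trans hy
    rw [norm_mul, norm_mul]
    calc _ ≤ ‖v y‖ * (‖Q y‖ * (K * V y)) := by gcongr; exact hle y hy0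
      _ = K * (‖v y‖ * ‖Q y‖ * V y) := by ring
      _ ≤ K * (V x / U x * ψ y) := mul_le_mul_of_nonneg_left (hD.boundp x hx y hy) hK
      _ = _ := by ring

lemma Perturbation.repZero (h : Perturbation P Q u u' v v' U V W ψ) {g₀ g₀' : ℝ → ℂ} {C : ℝ}
    (hC : 0 ≤ C) (hg₀ : IsClassicalSol P g₀ g₀') (hb : ∀ x, 0 < x → ‖g₀ x‖ ≤ C * W x) :
    ∃ g' A B, RepZero P Q u u' v v' U V W ψ g₀ g₀' (solZero Q u v g₀) g' A B
      (2 * C * volterraBound ψ) := by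
  obtain ⟨E, hE⟩ := h.weightZero
  have hD := h.dataZero
  set K := 2 * C * volterraBound ψ with hKd
  have hK : 0 ≤ K := by have := volterraBound_pos ψ; positivity
  have hle : ∀ x, 0 < x → ‖solZero Q u v g₀ x‖ ≤ K * W x :=
    fun x hx => hD.norm_volterraSol_le hE hC hb hx
  refine ⟨_, _, _, hD.isSol hE hC hg₀ hb, hle, fun x hx => hD.volterraSol_eq hE hC
    (continuousOn_of_hasDerivAt hg₀.1) hb hx, fun _ _ => rfl, fun x hx => ?_, fun x hx => ?_⟩
  · refine norm_integral_le_mul measurableSet_Ioc (h.intψ.mono_set Ioc_subset_Ioi_self)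
      fun y hy => ?_
    have hy0 : 0 < y := hy.1
    rw [norm_mul, norm_mul]
    calc _ ≤ ‖v y‖ * (‖Q y‖ * (K * W y)) := by gcongr; exact hle y hy0
      _ = K * (‖v y‖ * ‖Q y‖ * W y) := by ring
      _ ≤ K * ψ y := by gcongr; exact hD.boundq y hy0
  · have hV := h.weights.posV x hx
    rw [← le_div_iff₀' hV]
    have : K * U x * (∫ t in Ioc 0 x, ψ t) / V x = (K * U x / V x) * ∫ t in Ioc 0 x, ψ t := by ring
    rw [this]
    refine norm_integral_le_mul measurableSet_Ioc (h.intψ.mono_set Ioc_subset_Ioi_self)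
      fun y hy => ?_
    have hy0 : 0 < y := hy.1
    rw [norm_mul, norm_mul]
    calc _ ≤ ‖u y‖ * (‖Q y‖ * (K * W y)) := by gcongr; exact hle y hy0
      _ = K * (‖u y‖ * ‖Q y‖ * W y) := by ring
      _ ≤ K * (U x / V x * ψ y) := mul_le_mul_of_nonneg_left (hD.boundp x hx y hy) hK
      _ = _ := by ring

lemma Perturbation.tail_nonneg (h : Perturbation P Q u u' v v' U V W ψ) {x : ℝ} (hx : 0 < x) :
    0 ≤ ∫ t in Ioi x, ψ t :=
  setIntegral_nonneg measurableSet_Ioi fun _ hy => h.nonneg (hx.trans hy)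

lemma Perturbation.head_nonneg (h : Perturbation P Q u u' v v' U V W ψ) (x : ℝ) :
    0 ≤ ∫ t in Ioc 0 x, ψ t :=
  setIntegral_nonneg measurableSet_Ioc fun _ hy => h.nonneg hy.1

/-- A function dominated by the weights at `∞`, combined as in the representation at `∞`. -/
lemma RepInfty.norm_combination_le {f₀ f₀' f f' A B : ℝ → ℂ} {K : ℝ}
    (h : Perturbation P Q u u' v v' U V W ψ)
    (hf : RepInfty P Q u u' v v' U V ψ f₀ f₀' f f' A B K) {x D : ℝ} (hx : 0 < x) {a b : ℂ}
    (hD : 0 ≤ D) (ha : ‖a‖ ≤ D * V x) (hb : ‖b‖ ≤ D * U x) :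
    ‖a * A x - b * B x‖ ≤ 2 * D * K * V x * ∫ t in Ioi x, ψ t := by
  have hV := h.weights.posV x hx
  calc ‖a * A x - b * B x‖ ≤ ‖a‖ * ‖A x‖ + ‖b‖ * ‖B x‖ := by
        refine (norm_sub_le _ _).trans (by rw [norm_mul, norm_mul])
    _ ≤ (D * V x) * (K * ∫ t in Ioi x, ψ t) + (D * U x) * ‖B x‖ := by
        gcongr; exact hf.leA x hx
    _ ≤ (D * V x) * (K * ∫ t in Ioi x, ψ t) + D * (K * V x * ∫ t in Ioi x, ψ t) := by
        rw [mul_assoc D (U x)]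
        exact add_le_add_right (mul_le_mul_of_nonneg_left (hf.leB x hx) hD) _
    _ = _ := by ring

lemma RepZero.norm_combination_le {g₀ g₀' g g' A B : ℝ → ℂ} {K : ℝ}
    (h : Perturbation P Q u u' v v' U V W ψ)
    (hg : RepZero P Q u u' v v' U V W ψ g₀ g₀' g g' A B K) {x D : ℝ} (hx : 0 < x) {a b : ℂ}
    (hD : 0 ≤ D) (ha : ‖a‖ ≤ D * U x) (hb : ‖b‖ ≤ D * V x) :
    ‖a * A x - b * B x‖ ≤ 2 * D * K * U x * ∫ t in Ioc 0 x, ψ t := by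
  have hU := h.weights.posU x hx
  calc ‖a * A x - b * B x‖ ≤ ‖a‖ * ‖A x‖ + ‖b‖ * ‖B x‖ := by
        refine (norm_sub_le _ _).trans (by rw [norm_mul, norm_mul])
    _ ≤ (D * U x) * (K * ∫ t in Ioc 0 x, ψ t) + (D * V x) * ‖B x‖ := by
        gcongr; exact hg.leA x hx
    _ ≤ (D * U x) * (K * ∫ t in Ioc 0 x, ψ t) + D * (K * U x * ∫ t in Ioc 0 x, ψ t) := by
        rw [mul_assoc D (V x)]
        exact add_le_add_right (mul_le_mul_of_nonneg_left (hg.leB x hx) hD) _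
    _ = _ := by ring

/-- Zero data make the forcing term vanish in the forward and backward Grönwall estimates. -/
lemma Perturbation.eq_zero_of_initial (h : Perturbation P Q u u' v v' U V W ψ)
    (hU : ContinuousOn U (Ioi 0)) (hV : ContinuousOn V (Ioi 0)) {d d' : ℝ → ℂ}
    (hd : IsSol (fun x => P x + Q x) d d') {a : ℝ} (ha : 0 < a) (h0 : d a = 0) (h1 : d' a = 0)
    {x : ℝ} (hx : 0 < x) : d x = 0 := by
  have hψ := h.intψ
  rcases le_or_gt x a with hxa | hxa
  · have := h.base.norm_le_backward h.weights h.locQ hd ha hV (hψ.mono_set Ioc_subset_Ioi_self)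
      (fun y hy _ => h.le_ψ' hy) le_rfl (fun y hy hya => by simp [h0, h1]) x hx hxa
    simpa using this
  · have := h.base.norm_le_forward h.weights h.locQ hd ha hU (hψ.mono_set (Ioi_subset_Ioi ha.le))
      (fun y hy => h.le_ψ' (ha.trans hy)) le_rfl (fun y hy => by simp [h0, h1]) x hxa
    simpa using this

/-- Uniqueness of the solution with prescribed behavior at `∞`. -/
lemma Perturbation.eq_zero_of_isLittleO_atTop (h : Perturbation P Q u u' v v' U V W ψ)
    (hU : ContinuousOn U (Ioi 0)) (hV : ContinuousOn V (Ioi 0)) {d d' : ℝ → ℂ}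
    (hd : IsSol (fun x => P x + Q x) d d') (ho : d =o[atTop] V) (ho' : d' =o[atTop] V)
    {D M : ℝ}
    (hu' : ∀ᶠ x in atTop, ‖u' x‖ ≤ D * U x) (hv' : ∀ᶠ x in atTop, ‖v' x‖ ≤ D * V x)
    (hM : ∀ᶠ x in atTop, U x * V x ≤ M) (hM' : ∀ᶠ x in atTop, V x * V x ≤ M)
    {x : ℝ} (hx : 0 < x) : d x = 0 := by
  have hpos : ∀ᶠ x : ℝ in atTop, 0 < x := eventually_gt_atTop 0
  have Ou : u =O[atTop] U := by
    refine IsBigO.of_bound 1 ?_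
    filter_upwards [hpos] with x hx
    rw [one_mul, Real.norm_of_nonneg (h.weights.posU x hx).le]
    exact h.weights.leU x hx
  have Ov : v =O[atTop] V := by
    refine IsBigO.of_bound 1 ?_
    filter_upwards [hpos] with x hx
    rw [one_mul, Real.norm_of_nonneg (h.weights.posV x hx).le]
    exact h.weights.leV x hx
  have Ou' : u' =O[atTop] U := by
    refine IsBigO.of_bound D ?_
    filter_upwards [hpos, hu'] with x hx hb
    rwa [Real.norm_of_nonneg (h.weights.posU x hx).le]
  have Ov' : v' =O[atTop] V := by
    refine IsBigO.of_bound D ?_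
    filter_upwards [hpos, hv'] with x hx hb
    rwa [Real.norm_of_nonneg (h.weights.posV x hx).le]
  have OUV : (fun x => U x * V x) =O[atTop] (fun _ => (1 : ℝ)) := by
    refine IsBigO.of_bound M ?_
    filter_upwards [hpos, hM] with x hx hb
    rw [Real.norm_of_nonneg (mul_pos (h.weights.posU x hx) (h.weights.posV x hx)).le]
    simpa using hb
  have OVV : (fun x => V x * V x) =O[atTop] (fun _ => (1 : ℝ)) := by
    refine IsBigO.of_bound M ?_
    filter_upwards [hpos, hM'] with x hx hb
    rw [Real.norm_of_nonneg (mul_pos (h.weights.posV x hx) (h.weights.posV x hx)).le]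
    simpa using hb
  -- The two coefficients are o(V²) and o(UV). Both products are bounded, so the solution has zero
  -- data at ∞ and vanishes on a half-line; uniqueness of the initial value problem then gives all
  -- x.
  have hα : Tendsto (fun x => v x * d' x - v' x * d x) atTop (𝓝 0) := by
    have := ((Ov.mul_isLittleO ho').sub (Ov'.mul_isLittleO ho)).trans_isBigO OVV
    exact (isLittleO_one_iff ℝ).1 this
  have hβ : Tendsto (fun x => d x * u' x - d' x * u x) atTop (𝓝 0) := by
    have := ((Ou'.mul_isLittleO ho).sub (Ou.mul_isLittleO ho')).trans_isBigO OUV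
    have := (isLittleO_one_iff ℝ).1 this
    refine this.congr fun x => by ring
  obtain ⟨N, hN⟩ := eventually_atTop.1 (ho.bound one_pos)
  set x₀ := max N 1 with hx₀
  have h1x : 0 < x₀ := lt_of_lt_of_le one_pos (le_max_right _ _)
  have hz := h.base.norm_le_infty h.weights h.locQ hd hα hβ h1x.le
    (h.intψ.mono_set (Ioi_subset_Ioi h1x.le)) (fun y hy => h.le_ψ' (h1x.trans hy))
    zero_le_one (fun y hy => by
      have := hN y ((le_max_left _ _).trans hy.le)
      rwa [Real.norm_of_nonneg (h.weights.posV y (h1x.trans hy)).le] at this) le_rfl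
    (fun y hy => by simp)
  have hz' : ∀ y, x₀ < y → d y = 0 := fun y hy => by simpa using hz y hy
  have ha : 0 < x₀ + 1 := by linarith
  refine h.eq_zero_of_initial hU hV hd ha (hz' _ (by linarith)) ?_ hx
  have h2 : d =ᶠ[𝓝 (x₀ + 1)] fun _ => 0 := by
    filter_upwards [lt_mem_nhds (show x₀ < x₀ + 1 by linarith)] with y hy
    exact hz' y hy
  exact (hd.hasDerivAt ha).unique ((hasDerivAt_const _ _).congr_of_eventuallyEq h2)

/-- Uniqueness of the solution with prescribed behavior at `0`. -/
lemma Perturbation.eq_zero_of_isLittleO_zero (h : Perturbation P Q u u' v v' U V W ψ)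
    (hU : ContinuousOn U (Ioi 0)) (hV : ContinuousOn V (Ioi 0)) {d d' : ℝ → ℂ}
    (hd : IsSol (fun x => P x + Q x) d d') (ho : d =o[𝓝[>] 0] U)
    (hβ : Tendsto (fun x => d x * u' x - d' x * u x) (𝓝[>] 0) (𝓝 0))
    (hlow : U =O[𝓝[>] 0] u)
    {x : ℝ} (hx : 0 < x) : d x = 0 := by
  have hev : ∀ᶠ y in 𝓝[>] (0 : ℝ), ‖d y‖ ≤ 1 * ‖U y‖ := ho.bound one_pos
  obtain ⟨δ, hδ, hdU⟩ : ∃ δ : ℝ, 0 < δ ∧ ∀ y, 0 < y → y ≤ δ → ‖d y‖ ≤ 1 * U y := by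
    obtain ⟨δ, hδ, hs⟩ := mem_nhdsGT_iff_exists_Ioc_subset.1 hev
    refine ⟨δ, hδ, fun y hy hyδ => ?_⟩
    have : ‖d y‖ ≤ 1 * ‖U y‖ := hs ⟨hy, hyδ⟩
    rwa [Real.norm_of_nonneg (h.weights.posU y hy).le] at this
  have hdc : ContinuousOn d (Ioi 0) := hd.1.continuousOn
  have hcu := continuousOn_of_hasDerivAt h.base.solU.1
  have hcv := continuousOn_of_hasDerivAt h.base.solV.1
  have hmeas : ∀ {q : ℝ → ℂ}, ContinuousOn q (Ioi 0) → ∀ x, 0 < x →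
      AEStronglyMeasurable (fun y => q y * (Q y * d y)) (volume.restrict (Ioc 0 x)) := by
    intro q hq x hx
    have := locallyIntegrableOn_continuousOn_mul hq (locallyIntegrableOn_mul_continuousOn h.locQ hdc)
    exact this.aestronglyMeasurable.mono_measure (Measure.restrict_mono Ioc_subset_Ioi_self le_rfl)
  have hiv : ∀ x, 0 < x → x ≤ δ → IntegrableOn (fun y => v y * (Q y * d y)) (Ioc 0 x) volume := by
    intro x hx hxδ
    refine Integrable.mono' (h.intψ.mono_set Ioc_subset_Ioi_self) (hmeas hcv x hx)
      ((ae_restrict_iff' measurableSet_Ioc).2 (Eventually.of_forall fun y hy => ?_))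
    have h1 := hdU y hy.1 (hy.2.trans hxδ)
    have h2 := h.weights.leV y hy.1
    have hVy := h.weights.posV y hy.1
    have hUy := h.weights.posU y hy.1
    have h3 := h.le_ψ' hy.1
    have h4 : 0 ≤ U y * V y * ‖Q y‖ := by positivity
    rw [norm_mul, norm_mul]
    calc _ ≤ V y * (‖Q y‖ * (1 * U y)) := by gcongr
      _ = U y * V y * ‖Q y‖ := by ring
      _ ≤ ψ y := by linarith
  have hiu : ∀ x, 0 < x → x ≤ δ → IntegrableOn (fun y => u y * (Q y * d y)) (Ioc 0 x) volume := by
    intro x hx hxδ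
    refine Integrable.mono' ((h.intψ.mono_set Ioc_subset_Ioi_self).const_mul (U x / V x))
      (hmeas hcu x hx)
      ((ae_restrict_iff' measurableSet_Ioc).2 (Eventually.of_forall fun y hy => ?_))
    have h1 := hdU y hy.1 (hy.2.trans hxδ)
    have hUy := h.weights.posU y hy.1
    have h5 := h.le_W y hy.1
    have h3 := h.dataZero.boundp x hx y hy
    rw [norm_mul, norm_mul]
    calc _ ≤ ‖u y‖ * (‖Q y‖ * (1 * W y)) := by gcongr; exact h1.trans (by linarith)
      _ = ‖u y‖ * ‖Q y‖ * W y := by ring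
      _ ≤ _ := h3
  -- Only existence of this limit is claimed here, from integrability of vQd. The size of d' would
  -- not force it to be 0 when `v` carries a logarithm.
  have hα : ∃ α, Tendsto (fun x => v x * d' x - v' x * d x) (𝓝[>] 0) (𝓝 α) := by
    have hac := h.base.hasACDeriv_coeffU hd
    have hlim := (tendsto_integral_Ioc_zero hδ (hiv δ hδ le_rfl)).const_add
      (v δ * d' δ - v' δ * d δ - ∫ y in Ioc 0 δ, v y * (Q y * d y))
    refine ⟨_, hlim.congr' ?_⟩
    filter_upwards [Ioc_mem_nhdsGT hδ] with x hx
    have e1 := hac.2 x δ hx.1 hδ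
    rw [intervalIntegral.integral_of_le hx.2] at e1
    have e2 : ∫ y in Ioc 0 δ, v y * (Q y * d y) = (∫ y in Ioc 0 x, v y * (Q y * d y)) +
        ∫ y in Ioc x δ, v y * (Q y * d y) := by
      rw [← setIntegral_union (Ioc_disjoint_Ioc_of_le le_rfl) measurableSet_Ioc
        ((hiv δ hδ le_rfl).mono_set (Ioc_subset_Ioc_right hx.2))
        ((hiv δ hδ le_rfl).mono_set (Ioc_subset_Ioc_left hx.1.le)),
        Ioc_union_Ioc_eq_Ioc hx.1.le hx.2]
    linear_combination e1 - e2
  obtain ⟨α, hα⟩ := hα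
  have hrep : ∀ x, 0 < x → x ≤ δ →
      d x = α * u x + ∫ y in Ioc 0 x, (u x * v y - v x * u y) * Q y * d y := by
    intro x hx hxδ
    have := h.base.eq_integral_Ioc_zero hd hα hβ hx (hiu x hx hxδ) (hiv x hx hxδ)
    rw [this]; simp
  have hker : ∀ x ∈ Ioc 0 δ, ∀ y ∈ Ioc 0 x,
      ‖(u x * v y - v x * u y) * Q y‖ * U y ≤ U x * ψ y := by
    intro x hx y hy
    have h1 := h.weights.kernel_le hy.1 hy.2
    have h2 := h.le_ψ' hy.1
    have hUx := h.weights.posU x hx.1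
    have hUy := h.weights.posU y hy.1
    rw [norm_mul]
    calc _ ≤ 2 * (U x * V y) * ‖Q y‖ * U y := by gcongr
      _ = U x * (2 * (U y * V y * ‖Q y‖)) := by ring
      _ ≤ _ := by gcongr
  -- The representation makes αu the difference of d and a Volterra integral, both o(U). Since U =
  -- O(u), a nonzero α would give u = o(u), although u does not vanish near 0.
  have hα0 : α = 0 := by
    have h1 : (fun x => ∫ y in Ioc 0 x, (u x * v y - v x * u y) * Q y * d y) =o[𝓝[>] 0] U := by
      have h2 : (fun x => ∫ y in Ioc 0 x, (u x * v y - v x * u y) * Q y * d y) =O[𝓝[>] 0]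
          fun x => U x * ∫ y in Ioc 0 x, ψ y := by
        refine IsBigO.of_bound 1 ?_
        filter_upwards [Ioc_mem_nhdsGT hδ] with x hx
        have hUx := h.weights.posU x hx.1
        rw [one_mul, Real.norm_of_nonneg (mul_nonneg hUx.le (h.head_nonneg x))]
        refine norm_integral_le_mul measurableSet_Ioc (h.intψ.mono_set Ioc_subset_Ioi_self)
          fun y hy => ?_
        rw [norm_mul]
        refine le_trans ?_ (hker x hx y hy)
        gcongr
        simpa using hdU y hy.1 (hy.2.trans hx.2)
      refine h2.trans_isLittleO ?_
      have h3 := tendsto_integral_Ioc_zero one_pos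
        (h.intψ.mono_set (Ioc_subset_Ioi_self : Ioc (0 : ℝ) 1 ⊆ Ioi 0))
      have := (isBigO_refl U (𝓝[>] (0 : ℝ))).mul_isLittleO ((isLittleO_one_iff ℝ).2 h3)
      simpa using this
    have h4 : (fun x => α * u x) =o[𝓝[>] 0] u := by
      refine ((ho.sub h1).congr' ?_ EventuallyEq.rfl).trans_isBigO hlow
      filter_upwards [Ioc_mem_nhdsGT hδ] with x hx
      rw [hrep x hx.1 hx.2, add_sub_cancel_right]
    by_contra hne
    have h5 : u =o[𝓝[>] 0] u := (isLittleO_const_mul_left_iff hne).1 h4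
    have h6 := isLittleO_irrefl' (f' := u) (l := 𝓝[>] (0 : ℝ)) ?_
    · exact h6 h5
    · obtain ⟨c, hc⟩ := hlow.bound
      refine (hc.and self_mem_nhdsWithin).frequently.mono fun y hy => ?_
      have hUy := h.weights.posU y hy.2
      intro h0
      have := hy.1
      rw [norm_eq_zero.2 (norm_eq_zero.1 h0), mul_zero, Real.norm_of_nonneg hUy.le] at this
      linarith
  obtain ⟨E, hE⟩ := exists_volterraWeight_left (T := Ioc 0 δ) (S := fun x => Ioc 0 x) (ψ := ψ)
    measurableSet_Ioc (fun x hx => by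
      ext y; constructor
      · exact fun hy => ⟨⟨hy.1, hy.2.trans hx.2⟩, hy.2⟩
      · exact fun hy => ⟨hy.1.1, hy.2⟩) (h.intψ.mono_set Ioc_subset_Ioi_self)
    (fun y hy => h.nonneg hy.1)
  have hz := hE.gronwall (d := d) (w := U) (N := fun x y => (u x * v y - v x * u y) * Q y) le_rfl
    (fun y hy => (h.weights.posU y hy.1).le) hker zero_le_one (fun y hy => hdU y hy.1 hy.2)
    (fun y hy => by rw [hrep y hy.1 hy.2, hα0]; simp)
  have hz' : ∀ y ∈ Ioc 0 δ, d y = 0 := fun y hy => by simpa using hz y hy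
  have ha : 0 < δ / 2 := by linarith
  refine h.eq_zero_of_initial hU hV hd ha (hz' _ ⟨ha, by linarith⟩) ?_ hx
  have h2 : d =ᶠ[𝓝 (δ / 2)] fun _ => 0 := by
    filter_upwards [Ioo_mem_nhds ha (show δ / 2 < δ by linarith)] with y hy
    exact hz' y ⟨hy.1, hy.2.le⟩
  exact (hd.hasDerivAt ha).unique ((hasDerivAt_const _ _).congr_of_eventuallyEq h2)

/-- The Wronskian of the solutions prescribed at `∞` and at `0`. -/
lemma Perturbation.wronskian_formula (h : Perturbation P Q u u' v v' U V W ψ)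
    {f f' A B g g' g₀ g₀' A₂ B₂ : ℝ → ℂ} {κ : ℂ} {K K₂ C : ℝ} (hK : 0 ≤ K) (hC : 0 ≤ C)
    (hf : RepInfty P Q u u' v v' U V ψ (fun x => κ * v x) (fun x => κ * v' x) f f' A B K)
    (hg : RepZero P Q u u' v v' U V W ψ g₀ g₀' g g' A₂ B₂ K₂)
    (hg₀ : IsClassicalSol P g₀ g₀') (hb : ∀ x, 0 < x → ‖g₀ x‖ ≤ C * W x) :
    IntegrableOn (fun y => g₀ y * (Q y * f y)) (Ioi 0) volume ∧ ∀ x, 0 < x →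
      f x * g' x - f' x * g x = κ * (v x * g₀' x - v' x * g₀ x) +
        ∫ y in Ioi 0, g₀ y * (Q y * f y) := by
  have hfc : ContinuousOn f (Ioi 0) := hf.sol.1.continuousOn
  have hg₀c := continuousOn_of_hasDerivAt hg₀.1
  have hint : IntegrableOn (fun y => g₀ y * (Q y * f y)) (Ioi 0) volume := by
    refine Integrable.mono' (h.intψ.const_mul (C * K)) (locallyIntegrableOn_continuousOn_mul hg₀c
      (locallyIntegrableOn_mul_continuousOn h.locQ hfc)).aestronglyMeasurable
      ((ae_restrict_iff' measurableSet_Ioi).2 (Eventually.of_forall fun y hy => ?_))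
    have h1 := hb y hy
    have h2 := hf.le y hy
    have hVy := h.weights.posV y hy
    have hWy := h.posW hy
    have h3 := h.le_ψ y hy
    have h4 : 0 ≤ V y * W y * ‖Q y‖ := by positivity
    rw [norm_mul, norm_mul]
    calc _ ≤ (C * W y) * (‖Q y‖ * (K * V y)) := by gcongr
      _ = C * K * (V y * W y * ‖Q y‖) := by ring
      _ ≤ C * K * ψ y := by gcongr; linarith
  refine ⟨hint, ?_⟩
  have hsolu := h.base.solU.isSol h.base.cont
  have hsolv := h.base.solV.isSol h.base.cont
  have hsolg := hg₀.isSol h.base.cont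
  set c₁ := v 1 * g₀' 1 - v' 1 * g₀ 1 with hc₁
  set c₂ := u 1 * g₀' 1 - u' 1 * g₀ 1 with hc₂
  -- The Wronskians of the unperturbed solution with the two basis solutions are constant; they are
  -- the only information on g₀ that survives at ∞.
  have e1 : ∀ x, 0 < x → v x * g₀' x - v' x * g₀ x = c₁ := fun x hx =>
    hsolv.wronskian_eq hsolg hx one_pos
  have e2 : ∀ x, 0 < x → u x * g₀' x - u' x * g₀ x = c₂ := fun x hx =>
    hsolu.wronskian_eq hsolg hx one_pos
  have hac := hf.sol.hasACDeriv_wronskian hsolg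
  have htail : Tendsto (fun x => ∫ t in Ioi x, ψ t) atTop (𝓝 0) := tendsto_integral_Ioi_atTop h.intψ
  have hA : Tendsto A atTop (𝓝 0) := by
    have := htail.const_mul K
    rw [mul_zero] at this
    refine squeeze_zero_norm' ?_ this
    filter_upwards [eventually_gt_atTop 0] with x hx
    exact hf.leA x hx
  have hBt : Tendsto B atTop (𝓝 0) := by
    have := htail.const_mul (K * (V 1 / U 1))
    rw [mul_zero] at this
    refine squeeze_zero_norm' ?_ this
    filter_upwards [eventually_ge_atTop 1] with x hx
    have hx0 : 0 < x := one_pos.trans_le hx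
    have h1 := hf.leB x hx0
    have h2 := h.weights.ratio 1 x one_pos hx
    have hUx := h.weights.posU x hx0
    have hU1 := h.weights.posU 1 one_pos
    have h3 := h.tail_nonneg hx0
    have h4 : V x / U x ≤ V 1 / U 1 := by
      rw [div_le_div_iff₀ hUx hU1]; linarith
    rw [← le_div_iff₀' hUx] at h1
    calc _ ≤ _ := h1
      _ = K * (V x / U x) * ∫ t in Ioi x, ψ t := by ring
      _ ≤ _ := by gcongr
  -- In terms of the basis the Wronskian is (κ + A)c₁ - Bc₂, and A, B tend to 0.
  have hlim : Tendsto (fun x => f x * g₀' x - f' x * g₀ x) atTop (𝓝 (κ * c₁)) := by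
    have := ((hA.const_add κ).mul_const c₁).sub (hBt.mul_const c₂)
    rw [add_zero, zero_mul, sub_zero] at this
    refine this.congr' ?_
    filter_upwards [eventually_gt_atTop 0] with x hx
    rw [hf.eq x hx, hf.eq' x hx, ← e1 x hx, ← e2 x hx]
    ring
  have hW0 : ∀ x, 0 < x → f x * g₀' x - f' x * g₀ x =
      κ * c₁ + ∫ y in Ioi x, g₀ y * (Q y * f y) := by
    intro x hx
    have e : (fun y => (P y - (P y + Q y)) * f y * g₀ y) = fun y => -(g₀ y * (Q y * f y)) := by
      ext y; ring
    have h1 := hac.integral_Ioi hx (by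
      rw [e]; exact (hint.mono_set (Ioi_subset_Ioi hx.le)).neg) hlim
    rw [e, integral_neg] at h1
    linear_combination h1
  -- The correction is the Wronskian of f = (κ + A)v - Bu with g - g₀ = A₂u - B₂v, evaluated by
  -- means of v u' - v' u = 1.
  have hdec : ∀ x, 0 < x → f x * g' x - f' x * g x = κ * c₁ +
      (∫ y in Ioi x, g₀ y * (Q y * f y)) + ((κ + A x) * A₂ x - B x * B₂ x) := by
    intro x hx
    rw [← hW0 x hx, hg.eq x hx, hg.eq' x hx]
    have h1 := hf.eq x hx
    have h2 := hf.eq' x hx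
    have h3 := h.base.wr x hx
    rw [h1, h2]
    linear_combination ((κ + A x) * A₂ x - B x * B₂ x) * h3
  have hhead : Tendsto (fun x => ∫ t in Ioc 0 x, ψ t) (𝓝[>] 0) (𝓝 0) :=
    tendsto_integral_Ioc_zero one_pos (h.intψ.mono_set Ioc_subset_Ioi_self)
  set I := ∫ t in Ioi (0 : ℝ), ψ t with hI
  have htailI : ∀ x, 0 < x → ∫ t in Ioi x, ψ t ≤ I := fun x hx =>
    setIntegral_mono_set h.intψ ((ae_restrict_iff' measurableSet_Ioi).2
      (Eventually.of_forall fun y hy => h.nonneg hy)) (Ioi_subset_Ioi hx.le).eventuallyLE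
  have hrem : Tendsto (fun x => (κ + A x) * A₂ x - B x * B₂ x) (𝓝[>] 0) (𝓝 0) := by
    have := hhead.const_mul ((‖κ‖ + K * I) * K₂ + K * K₂ * I)
    rw [mul_zero] at this
    refine squeeze_zero_norm' ?_ this
    filter_upwards [self_mem_nhdsWithin] with x hx
    have hx : (0 : ℝ) < x := hx
    have a1 := hf.leA x hx
    have a2 := hg.leA x hx
    have b1 := hf.leB x hx
    have b2 := hg.leB x hx
    have hUx := h.weights.posU x hx
    have hVx := h.weights.posV x hx
    have h3 := h.tail_nonneg hx
    have h4 := h.head_nonneg x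
    have h5 := htailI x hx
    have a3 : ‖A x‖ ≤ K * I := a1.trans (by gcongr)
    have hK₂0 : 0 ≤ K₂ * ∫ t in Ioc 0 x, ψ t := (norm_nonneg _).trans a2
    -- B is bounded only relative to V/U near 0, but B₂ is bounded relative to U/V. The weights
    -- cancel in the product, and the head of ∫ψ remains as the small factor.
    have b3 : ‖B x‖ * ‖B₂ x‖ ≤ K * K₂ * I * ∫ t in Ioc 0 x, ψ t := by
      have h6 : (U x * ‖B x‖) * (V x * ‖B₂ x‖) ≤
          (K * V x * ∫ t in Ioi x, ψ t) * (K₂ * U x * ∫ t in Ioc 0 x, ψ t) :=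
        mul_le_mul b1 b2 (by positivity) (by positivity)
      have h7 : (U x * V x) * (‖B x‖ * ‖B₂ x‖) ≤
          (U x * V x) * ((K * ∫ t in Ioi x, ψ t) * (K₂ * ∫ t in Ioc 0 x, ψ t)) := by
        linarith
      have h8 := le_of_mul_le_mul_left h7 (by positivity)
      refine h8.trans ?_
      calc _ ≤ (K * I) * (K₂ * ∫ t in Ioc 0 x, ψ t) := by gcongr
        _ = _ := by ring
    calc _ ≤ (‖κ‖ + ‖A x‖) * ‖A₂ x‖ + ‖B x‖ * ‖B₂ x‖ := by
          refine (norm_sub_le _ _).trans ?_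
          rw [norm_mul, norm_mul]
          gcongr
          exact norm_add_le _ _
      _ ≤ (‖κ‖ + K * I) * (K₂ * ∫ t in Ioc 0 x, ψ t) + K * K₂ * I * ∫ t in Ioc 0 x, ψ t := by
          have : 0 ≤ K * I := (norm_nonneg _).trans a3
          gcongr
      _ = _ := by ring
  have htot : Tendsto (fun x => κ * c₁ + (∫ y in Ioi x, g₀ y * (Q y * f y)) +
      ((κ + A x) * A₂ x - B x * B₂ x)) (𝓝[>] 0)
      (𝓝 (κ * c₁ + ∫ y in Ioi 0, g₀ y * (Q y * f y))) := by
    have h1 : Tendsto (fun x => ∫ y in Ioi x, g₀ y * (Q y * f y)) (𝓝[>] 0)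
        (𝓝 (∫ y in Ioi 0, g₀ y * (Q y * f y))) := by
      have h2 := (tendsto_integral_Ioc_zero one_pos
        (hint.mono_set (Ioc_subset_Ioi_self : Ioc (0 : ℝ) 1 ⊆ Ioi 0))).const_sub
        (∫ y in Ioi 0, g₀ y * (Q y * f y))
      rw [sub_zero] at h2
      refine h2.congr' ?_
      filter_upwards [self_mem_nhdsWithin] with x hx
      rw [sub_eq_iff_eq_add', ← setIntegral_union (Ioc_disjoint_Ioi le_rfl) measurableSet_Ioi
        (hint.mono_set Ioc_subset_Ioi_self) (hint.mono_set (Ioi_subset_Ioi (le_of_lt hx))),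
        Ioc_union_Ioi_eq_Ioi (le_of_lt hx)]
    have := (h1.const_add (κ * c₁)).add hrem
    rwa [add_zero] at this
  intro x hx
  rw [e1 x hx]
  refine tendsto_nhds_unique (tendsto_const_nhds.congr' ?_) htot
  filter_upwards [self_mem_nhdsWithin] with y hy
  rw [← hdec y hy]
  exact hf.sol.wronskian_eq hg.sol hx hy

end Perturbation

/-! ### The weights of the Bessel equation -/

/-- The exponent `max(0, -2 Re m)` measuring the singularity admitted at `0`. -/
def singExp (m : ℂ) : ℝ := |m.re| - m.re

lemma singExp_nonneg (m : ℂ) : 0 ≤ singExp m := sub_nonneg.2 (le_abs_self _)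

lemma singExp_eq (m : ℂ) : singExp m = max 0 (-2 * m.re) := by
  unfold singExp
  rcases le_total 0 m.re with h | h
  · rw [abs_of_nonneg h, max_eq_left (by linarith)]; ring
  · rw [abs_of_nonpos h, max_eq_right (by linarith)]; ring

/-- The weight governing integrability of the potential, at spectral scale `κ`. -/
def scaleWeight (m : ℂ) (κ x : ℝ) : ℝ :=
  κ⁻¹ * (min 1 (κ * x)) ^ (1 - singExp m) * logFactor m (κ * x)

lemma scaleWeight_nonneg (m : ℂ) {κ x : ℝ} (hκ : 0 < κ) (hx : 0 < x) : 0 ≤ scaleWeight m κ x := by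
  have h1 := one_le_logFactor m (mul_pos hκ hx)
  have h2 : 0 < min 1 (κ * x) := lt_min one_pos (mul_pos hκ hx)
  unfold scaleWeight
  positivity

lemma continuousOn_scaleWeight (m : ℂ) {κ : ℝ} (hκ : 0 < κ) :
    ContinuousOn (scaleWeight m κ) (Ioi 0) := by
  unfold scaleWeight
  refine ContinuousOn.mul (continuousOn_const.mul ?_) ?_
  · refine ContinuousOn.rpow_const (by fun_prop) fun x hx => Or.inl ?_
    exact (lt_min one_pos (mul_pos hκ hx)).ne'
  · exact (continuousOn_logFactor m).comp (by fun_prop) fun x hx => mul_pos hκ hx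

lemma mul_min_one_le {δ κ x : ℝ} (hδ : 0 < δ) (hδ1 : δ ≤ 1) (hκ : δ ≤ κ) (hx : 0 < x) :
    δ * min 1 x ≤ min 1 (κ * x) := by
  have h1 : min 1 x ≤ 1 := min_le_left _ _
  have h2 : min 1 x ≤ x := min_le_right _ _
  have h3 : 0 < min 1 x := lt_min one_pos hx
  refine le_min ?_ ?_
  · nlinarith
  · exact mul_le_mul hκ h2 h3.le (hδ.le.trans hκ)

lemma logFactor_mul_le (m : ℂ) {δ κ x : ℝ} (hδ : 0 < δ) (hδ1 : δ ≤ 1) (hκ : δ ≤ κ) (hx : 0 < x) :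
    logFactor m (κ * x) ≤ (1 - Real.log δ) * logFactor m x := by
  have hl : Real.log δ ≤ 0 := Real.log_nonpos hδ.le hδ1
  unfold logFactor
  split_ifs
  · have h3 : 0 < min 1 x := lt_min one_pos hx
    have h1 := Real.log_le_log (mul_pos hδ h3) (mul_min_one_le hδ hδ1 hκ hx)
    rw [Real.log_mul hδ.ne' h3.ne'] at h1
    have h2 : Real.log (min 1 x) ≤ 0 := Real.log_nonpos h3.le (min_le_left _ _)
    nlinarith
  · linarith

/-- Uniform control of the weight for spectral parameters bounded away from `0`. -/
lemma scaleWeight_le (m : ℂ) {δ κ x : ℝ} (hδ : 0 < δ) (hδ1 : δ ≤ 1) (hκ : δ ≤ κ) (hx : 0 < x) :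
    scaleWeight m κ x ≤ δ⁻¹ * δ ^ (-singExp m) * (1 - Real.log δ) * scaleWeight m 1 x := by
  have hκ0 : 0 < κ := hδ.trans_le hκ
  have hκx : 0 < κ * x := mul_pos hκ0 hx
  have h3 : 0 < min 1 x := lt_min one_pos hx
  have h4 : 0 < min 1 (κ * x) := lt_min one_pos hκx
  have hl : Real.log δ ≤ 0 := Real.log_nonpos hδ.le hδ1
  have hε := singExp_nonneg m
  have hL := one_le_logFactor m hκx
  have hLx := one_le_logFactor m hx
  have b1 : κ⁻¹ * min 1 (κ * x) ≤ δ⁻¹ * min 1 x := by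
    rw [mul_min_of_nonneg _ _ (inv_pos.2 hδ).le]
    refine le_min ?_ ?_
    · exact mul_le_mul (inv_anti₀ hδ hκ) (min_le_left _ _) h4.le (inv_pos.2 hδ).le
    · calc κ⁻¹ * min 1 (κ * x) ≤ κ⁻¹ * (κ * x) := by gcongr; exact min_le_right _ _
        _ = 1 * x := by field_simp
        _ ≤ δ⁻¹ * x := by gcongr; exact (one_le_inv₀ hδ).2 hδ1
  have b2 : min 1 (κ * x) ^ (-singExp m) ≤ δ ^ (-singExp m) * min 1 x ^ (-singExp m) := by
    rw [← Real.mul_rpow hδ.le h3.le]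
    exact Real.rpow_le_rpow_of_nonpos (mul_pos hδ h3) (mul_min_one_le hδ hδ1 hκ hx) (by linarith)
  have b3 := logFactor_mul_le m hδ hδ1 hκ hx
  have e : ∀ t : ℝ, 0 < t → t ^ (1 - singExp m) = t * t ^ (-singExp m) := by
    intro t ht
    rw [sub_eq_add_neg, Real.rpow_add ht, Real.rpow_one]
  unfold scaleWeight
  rw [one_mul, inv_one, one_mul, e _ h4, e _ h3]
  calc _ = (κ⁻¹ * min 1 (κ * x)) * min 1 (κ * x) ^ (-singExp m) * logFactor m (κ * x) := by ring
    _ ≤ (δ⁻¹ * min 1 x) * (δ ^ (-singExp m) * min 1 x ^ (-singExp m)) *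
        ((1 - Real.log δ) * logFactor m x) := by gcongr
    _ = _ := by ring

/-- As soon as κx ≥ 1 the weight is exactly 1/κ. -/
lemma tendsto_scaleWeight (m : ℂ) {x : ℝ} (hx : 0 < x) :
    Tendsto (fun κ => scaleWeight m κ x) atTop (𝓝 0) := by
  refine tendsto_inv_atTop_zero.congr' ?_
  filter_upwards [eventually_ge_atTop x⁻¹] with κ hκ
  have h1 : 1 ≤ κ * x := by
    rw [← inv_mul_cancel₀ hx.ne']; gcongr
  rw [scaleWeight, logFactor, min_eq_left h1]
  simp

lemma scaleWeight_one_eq (m : ℂ) {x : ℝ} (hx1 : x ≤ 1) :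
    scaleWeight m 1 x = x ^ (1 - singExp m) * logFactor m x := by
  simp [scaleWeight, min_eq_right hx1]

/-- The weight is 1 beyond x = 1. Below it is the power appearing in the hypothesis, times one
logarithm when m = 0; the elementary bound 1 - log x ≤ 2(1 + log² x) settles that case. -/
lemma integrableOn_scaleWeight {Q : ℝ → ℂ} {m : ℂ} (hQinfty : MemLInfty 0 Q)
    (hQzero : m ≠ 0 → MemLZero (max 0 (-2 * m.re)) Q) (hQzeroLog : m = 0 → MemLZeroLog 0 2 Q) :
    IntegrableOn (fun x => scaleWeight m 1 x * ‖Q x‖) (Ioi 0) volume := by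
  have hloc : LocallyIntegrableOn Q (Ioi 0) volume := hQinfty.1
  have h1 : IntegrableOn (fun x => scaleWeight m 1 x * ‖Q x‖) (Ioi 1) volume := by
    refine hQinfty.2.congr_fun (fun x hx => ?_) measurableSet_Ioi
    have hx : (1 : ℝ) < x := hx
    simp [scaleWeight, min_eq_left hx.le, logFactor]
  have h0 : IntegrableOn (fun x => scaleWeight m 1 x * ‖Q x‖) (Ioo 0 1) volume := by
    by_cases hm : m = 0
    · have hmeas : AEStronglyMeasurable (fun x => scaleWeight m 1 x * ‖Q x‖)
          (volume.restrict (Ioo 0 1)) :=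
        (((continuousOn_scaleWeight m one_pos).aestronglyMeasurable measurableSet_Ioi).mul
          hloc.aestronglyMeasurable.norm).mono_measure (Measure.restrict_mono Ioo_subset_Ioi_self le_rfl)
      refine Integrable.mono' ((hQzeroLog hm).2.const_mul 2) hmeas
        ((ae_restrict_iff' measurableSet_Ioo).2 (Eventually.of_forall fun x hx => ?_))
      have hs := scaleWeight_nonneg m one_pos hx.1
      rw [norm_mul, norm_norm, Real.norm_of_nonneg hs, scaleWeight_one_eq m hx.2.le,
        logFactor_of_le_one m hx.2.le, if_pos hm, ← mul_assoc]
      have hε : singExp m = 0 := by simp [singExp, hm]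
      have hlog : Real.log x ≤ 0 := Real.log_nonpos hx.1.le hx.2.le
      have hxp : 0 ≤ x ^ (1 - 0 : ℝ) := Real.rpow_nonneg hx.1.le _
      rw [hε]
      have key : 1 - Real.log x ≤ 2 * (1 + |Real.log x| ^ (2 : ℝ)) := by
        rw [Real.rpow_two, sq_abs]
        nlinarith [sq_nonneg (Real.log x + 1)]
      have := mul_le_mul_of_nonneg_left key hxp
      have := mul_le_mul_of_nonneg_right this (norm_nonneg (Q x))
      linarith
    · refine (hQzero hm).2.congr_fun (fun x hx => ?_) measurableSet_Ioo
      simp only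
      rw [scaleWeight_one_eq m hx.2.le, logFactor, if_neg hm, singExp_eq, mul_one]
  have := ((integrableOn_Ioc_iff_integrableOn_Ioo).2 h0).union h1
  rwa [Ioc_union_Ioi_eq_Ioi zero_le_one] at this

/-! ### The Bessel fundamental system and its weights -/

/-- Bounds on the Bessel functions by the weights, with a common constant; `μ = ± m` has
nonnegative real part. -/
structure BesselBound (m μ : ℂ) (C : ℝ) : Prop where
  one_le : 1 ≤ C
  eq : μ = m ∨ μ = -m
  re_nonneg : 0 ≤ μ.re
  I_μ : ∀ z ∈ halfPlane, ‖besselI μ z‖ ≤ C * wI |m.re| z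
  I_succ : ∀ z ∈ halfPlane, ‖besselI (μ + 1) z‖ ≤ C * wI (|m.re| + 1) z
  I_m : ∀ z ∈ halfPlane, ‖besselI m z‖ ≤ C * wI m.re z
  K_μ : ∀ z ∈ halfPlane, ‖macdonaldK μ z‖ ≤ C * wK m z
  K_succ : ∀ z ∈ halfPlane, ‖macdonaldK (μ + 1) z‖ ≤ C * wK (μ + 1) z

/-- The sign of μ is chosen so that I_μ is recessive at 0, while K does not see the sign. The
function I_m is bounded separately because it is the solution to be perturbed. A single constant is
obtained by adding all of them. -/
lemma exists_besselBound {m : ℂ} (hm : -1 < m.re) : ∃ μ C, BesselBound m μ C := by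
  obtain ⟨μ, hμ, hre⟩ : ∃ μ : ℂ, (μ = m ∨ μ = -m) ∧ 0 ≤ μ.re := by
    rcases le_total 0 m.re with h | h
    · exact ⟨m, Or.inl rfl, h⟩
    · exact ⟨-m, Or.inr rfl, by simpa using h⟩
  have habs : μ.re = |m.re| := by
    rcases hμ with rfl | rfl
    · rw [abs_of_nonneg hre]
    · rw [Complex.neg_re] at hre ⊢
      rw [abs_of_nonpos (by linarith)]
  have hK : macdonaldK μ = macdonaldK m := by
    rcases hμ with rfl | rfl
    · rfl
    · exact macdonaldK_neg m
  obtain ⟨C₁, hC₁, h1⟩ := exists_norm_besselI_le (m := μ) (by linarith)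
  obtain ⟨C₂, hC₂, h2⟩ := exists_norm_besselI_le (m := μ + 1) (by simp; linarith)
  obtain ⟨C₃, hC₃, h3⟩ := exists_norm_besselI_le hm
  obtain ⟨C₄, hC₄, h4⟩ := exists_norm_macdonaldK_le m
  obtain ⟨C₅, hC₅, h5⟩ := exists_norm_macdonaldK_le (μ + 1)
  have mono : ∀ {a c w : ℝ}, a ≤ c * w → 0 < w → c ≤ 1 + C₁ + C₂ + C₃ + C₄ + C₅ →
      a ≤ (1 + C₁ + C₂ + C₃ + C₄ + C₅) * w := fun h hw hc =>
    h.trans (mul_le_mul_of_nonneg_right hc hw.le)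
  refine ⟨μ, 1 + C₁ + C₂ + C₃ + C₄ + C₅, by linarith, hμ, hre, fun z hz => ?_, fun z hz => ?_,
    fun z hz => ?_, fun z hz => ?_, fun z hz => ?_⟩
  · have := h1 z hz.1 hz.2
    rw [habs] at this
    exact mono this (wI_pos _ hz.2) (by linarith)
  · have := h2 z hz.1 hz.2
    rw [Complex.add_re, Complex.one_re, habs] at this
    exact mono this (wI_pos _ hz.2) (by linarith)
  · exact mono (h3 z hz.1 hz.2) (wI_pos _ hz.2) (by linarith)
  · rw [hK]
    exact mono (h4 z hz) (wK_pos _ hz.2) (by linarith)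
  · exact mono (h5 z hz) (wK_pos _ hz.2) (by linarith)

section BesselPair

variable {m μ : ℂ} {C : ℝ}

lemma BesselBound.pos (h : BesselBound m μ C) : 0 < C := one_pos.trans_le h.one_le

lemma BesselBound.sq_eq (h : BesselBound m μ C) : μ ^ 2 = m ^ 2 := by
  rcases h.eq with h | h <;> simp [h]

lemma BesselBound.re_eq (h : BesselBound m μ C) : μ.re = |m.re| := by
  have h0 := h.re_nonneg
  rcases h.eq with h | h
  · subst h; rw [abs_of_nonneg h0]
  · subst h
    rw [Complex.neg_re] at h0 ⊢
    rw [abs_of_nonpos (by linarith)]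

lemma BesselBound.macdonaldK_eq (h : BesselBound m μ C) : macdonaldK μ = macdonaldK m := by
  rcases h.eq with rfl | rfl
  · rfl
  · exact macdonaldK_neg m

/-- The solution of the Bessel equation that is recessive at `0`. -/
def pairU (μ k : ℂ) (x : ℝ) : ℂ := besselI μ (k * x)

/-- The derivative of `pairU`. -/
def pairU' (μ k : ℂ) (x : ℝ) : ℂ :=
  k * (1 * besselI (μ + 1) (k * x) + (μ + 1 / 2) / (k * x) * besselI μ (k * x))

/-- The derivative of `w⁰`. -/
def pairK' (μ k : ℂ) (x : ℝ) : ℂ :=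
  k * (-1 * macdonaldK (μ + 1) (k * x) + (μ + 1 / 2) / (k * x) * macdonaldK μ (k * x))

/-- The solution of the Bessel equation that is recessive at `∞`, normalized by
`v u' - v' u = 1`. -/
def pairV (μ k : ℂ) (x : ℝ) : ℂ := k⁻¹ * macdonaldK μ (k * x)

/-- The derivative of `pairV`. -/
def pairV' (μ k : ℂ) (x : ℝ) : ℂ := k⁻¹ * pairK' μ k x

lemma isClassicalSol_besselI {ν k : ℂ} (hν : -1 < ν.re) (hk : k ∈ halfPlane) :
    IsClassicalSol (basePot ν k) (pairU ν k) (pairU' ν k) :=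
  (raySystem_besselI hν hk.1 hk.2).isClassicalSol hk.2 (by norm_num)

lemma isClassicalSol_macdonaldK (ν : ℂ) {k : ℂ} (hk : k ∈ halfPlane) :
    IsClassicalSol (basePot ν k) (fun x => macdonaldK ν (k * x)) (pairK' ν k) :=
  (raySystem_macdonaldK ν hk).isClassicalSol hk.2 (by norm_num)

/-- The terms with (μ + 1/2)/(kx) cancel in the Wronskian, and the factors k and k⁻¹ compensate,
leaving `macdonaldK_wronskian`. -/
lemma isBasePair_bessel (hμ : -1 < μ.re) {k : ℂ} (hk : k ∈ halfPlane) :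
    IsBasePair (basePot μ k) (pairU μ k) (pairU' μ k) (pairV μ k) (pairV' μ k) where
  cont := continuousOn_basePot μ k
  solU := isClassicalSol_besselI hμ hk
  solV := (isClassicalSol_macdonaldK μ hk).const_mul _
  wr x hx := by
    have h := macdonaldK_wronskian hμ (mul_mem_halfPlane hk hx)
    have hk0 : k * k⁻¹ = 1 := mul_inv_cancel₀ hk.2
    simp only [pairU, pairU', pairV, pairV', pairK']
    linear_combination h + (macdonaldK μ (k * x) * besselI (μ + 1) (k * x) +
      macdonaldK (μ + 1) (k * x) * besselI μ (k * x)) * hk0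

lemma basePot_congr {m μ : ℂ} (h : μ ^ 2 = m ^ 2) (k : ℂ) : basePot μ k = basePot m k := by
  ext x; rw [basePot, basePot, h]

lemma norm_mul_ofReal (k : ℂ) {x : ℝ} (hx : 0 < x) : ‖k * (x : ℂ)‖ = ‖k‖ * x := by
  rw [norm_mul, Complex.norm_real, Real.norm_of_nonneg hx.le]

lemma logFactor_anti (m : ℂ) {s t : ℝ} (hs : 0 < s) (hst : s ≤ t) :
    logFactor m t ≤ logFactor m s := by
  unfold logFactor
  split_ifs
  · have := Real.log_le_log (lt_min one_pos hs) (min_le_min_left 1 hst)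
    linarith
  · exact le_rfl

/-- The quotient of the weights is a product of exp(2x Re k), a power 2|Re m| of min(1, ‖k‖x), and
the inverse of the logarithmic factor, each nondecreasing in x. -/
lemma wI_mul_wK_le (m : ℂ) {k : ℂ} (hk : k ∈ halfPlane) {y x : ℝ} (hy : 0 < y) (hyx : y ≤ x) :
    wI |m.re| (k * y) * wK m (k * x) ≤ wI |m.re| (k * x) * wK m (k * y) := by
  have hx := hy.trans_le hyx
  have hkn : 0 < ‖k‖ := norm_pos_iff.2 hk.2
  have hp := abs_nonneg m.re
  unfold wI wK
  rw [norm_mul_ofReal k hx, norm_mul_ofReal k hy, Complex.re_mul_ofReal, Complex.re_mul_ofReal]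
  have hmono : ‖k‖ * y ≤ ‖k‖ * x := by gcongr
  have hL := logFactor_anti m (mul_pos hkn hy) hmono
  have hL0 := one_le_logFactor m (mul_pos hkn hx)
  have hL0' := one_le_logFactor m (mul_pos hkn hy)
  have hry : 0 < min 1 (‖k‖ * y) := lt_min one_pos (mul_pos hkn hy)
  have hrx : 0 < min 1 (‖k‖ * x) := lt_min one_pos (mul_pos hkn hx)
  have hr : min 1 (‖k‖ * y) ≤ min 1 (‖k‖ * x) := min_le_min_left 1 hmono
  set a := min 1 (‖k‖ * y)
  set b := min 1 (‖k‖ * x)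
  have e : ∀ t : ℝ, 0 < t → t ^ (1 / 2 + |m.re|) = t ^ (1 / 2 - |m.re|) * t ^ (2 * |m.re|) := by
    intro t ht
    rw [← Real.rpow_add ht]; congr 1; ring
  rw [e a hry, e b hrx]
  have h1 : a ^ (2 * |m.re|) ≤ b ^ (2 * |m.re|) := Real.rpow_le_rpow hry.le hr (by positivity)
  have h2 : Real.exp (k.re * y) ≤ Real.exp (k.re * x) := by
    have := hk.1
    gcongr
  have h3 : Real.exp (-(k.re * x)) ≤ Real.exp (-(k.re * y)) := by
    have := hk.1
    gcongr
  calc _ = (a ^ (1 / 2 - |m.re|) * b ^ (1 / 2 - |m.re|)) * (Real.exp (k.re * y) *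
        Real.exp (-(k.re * x)) * a ^ (2 * |m.re|) * logFactor m (‖k‖ * x)) := by ring
    _ ≤ (a ^ (1 / 2 - |m.re|) * b ^ (1 / 2 - |m.re|)) * (Real.exp (k.re * x) *
        Real.exp (-(k.re * y)) * b ^ (2 * |m.re|) * logFactor m (‖k‖ * y)) := by gcongr
    _ = _ := by ring

lemma wI_le_wI {s t : ℝ} (hst : s ≤ t) {z : ℂ} (hz : z ≠ 0) : wI t z ≤ wI s z := by
  have h : 0 < min 1 ‖z‖ := lt_min one_pos (norm_pos_iff.2 hz)
  unfold wI
  exact mul_le_mul_of_nonneg_left (Real.rpow_le_rpow_of_exponent_ge h (min_le_left _ _)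
    (by linarith)) (Real.exp_pos _).le

/-- The exponentials cancel, so the product depends on k only through ‖k‖. This makes the Volterra
constants uniform up to the imaginary axis. -/
lemma wK_mul_wI (m k : ℂ) {x : ℝ} (hk : k ≠ 0) (hx : 0 < x) :
    ‖k‖⁻¹ * (wK m (k * x) * wI m.re (k * x)) = scaleWeight m ‖k‖ x := by
  have hkn : 0 < ‖k‖ := norm_pos_iff.2 hk
  have hr : 0 < min 1 (‖k‖ * x) := lt_min one_pos (mul_pos hkn hx)
  unfold wK wI scaleWeight singExp
  rw [norm_mul_ofReal k hx, show 1 - (|m.re| - m.re) = (1 / 2 - |m.re|) + (1 / 2 + m.re) by ring,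
    Real.rpow_add hr (1 / 2 - |m.re|) (1 / 2 + m.re)]
  have : Real.exp (-(k * x).re) * Real.exp (k * x).re = 1 := by rw [← Real.exp_add]; simp
  linear_combination (‖k‖⁻¹ * (min 1 (‖k‖ * x) ^ (1 / 2 - |m.re|) *
    min 1 (‖k‖ * x) ^ (1 / 2 + m.re) * logFactor m (‖k‖ * x))) * this

/-- The weight dominating `pairU`. -/
def wtU (m k : ℂ) (C x : ℝ) : ℝ := C * wI |m.re| (k * x)

/-- The weight dominating `pairV`. -/
def wtV (m k : ℂ) (C x : ℝ) : ℝ := C * ‖k‖⁻¹ * wK m (k * x)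

/-- The weight dominating the solution to be perturbed at `0`. -/
def wtW (m k : ℂ) (C x : ℝ) : ℝ := C * wI m.re (k * x)

/-- The integrable majorant of the Volterra kernels. -/
def wtψ (Q : ℝ → ℂ) (m k : ℂ) (C x : ℝ) : ℝ := 2 * C ^ 2 * (scaleWeight m ‖k‖ x * ‖Q x‖)

lemma continuousOn_ray {F : ℂ → ℝ} (hF : ContinuousOn F {0}ᶜ) {k : ℂ} (hk : k ≠ 0) :
    ContinuousOn (fun x : ℝ => F (k * x)) (Ioi 0) :=
  hF.comp (by fun_prop) fun x hx => mul_ne_zero hk (Complex.ofReal_ne_zero.2 (ne_of_gt hx))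

lemma continuousOn_wtU (m : ℂ) {k : ℂ} (hk : k ≠ 0) (C : ℝ) :
    ContinuousOn (wtU m k C) (Ioi 0) :=
  continuousOn_const.mul (continuousOn_ray (continuousOn_wI _) hk)

lemma continuousOn_wtV (m : ℂ) {k : ℂ} (hk : k ≠ 0) (C : ℝ) :
    ContinuousOn (wtV m k C) (Ioi 0) :=
  continuousOn_const.mul (continuousOn_ray (continuousOn_wK _) hk)

lemma wtψ_le (Q : ℝ → ℂ) (m : ℂ) {k : ℂ} {δ : ℝ} (hδ : 0 < δ) (hδ1 : δ ≤ 1) (hk : δ ≤ ‖k‖) (C : ℝ)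
    {x : ℝ} (hx : 0 < x) : wtψ Q m k C x ≤ 2 * C ^ 2 *
      (δ⁻¹ * δ ^ (-singExp m) * (1 - Real.log δ)) * (scaleWeight m 1 x * ‖Q x‖) := by
  have h1 := scaleWeight_le m hδ hδ1 hk hx
  have h2 : scaleWeight m ‖k‖ x * ‖Q x‖ ≤
    δ⁻¹ * δ ^ (-singExp m) * (1 - Real.log δ) * scaleWeight m 1 x * ‖Q x‖ := by gcongr
  unfold wtψ
  calc _ ≤ 2 * C ^ 2 * (δ⁻¹ * δ ^ (-singExp m) * (1 - Real.log δ) * scaleWeight m 1 x * ‖Q x‖) := by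
        gcongr
    _ = _ := by ring

lemma wtψ_nonneg (Q : ℝ → ℂ) (m : ℂ) {k : ℂ} (hk : k ≠ 0) (C : ℝ) {x : ℝ} (hx : 0 < x) :
    0 ≤ wtψ Q m k C x := by
  have := scaleWeight_nonneg m (norm_pos_iff.2 hk) hx
  unfold wtψ
  positivity

lemma aestronglyMeasurable_wtψ {Q : ℝ → ℂ} (hQ : LocallyIntegrableOn Q (Ioi 0) volume) (m : ℂ)
    {k : ℂ} (hk : k ≠ 0) (C : ℝ) :
    AEStronglyMeasurable (wtψ Q m k C) (volume.restrict (Ioi 0)) :=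
  (((continuousOn_scaleWeight m (norm_pos_iff.2 hk)).aestronglyMeasurable measurableSet_Ioi).mul
    hQ.aestronglyMeasurable.norm).const_mul _

lemma integrableOn_wtψ {Q : ℝ → ℂ} (hQ : LocallyIntegrableOn Q (Ioi 0) volume)
    (hQ1 : IntegrableOn (fun x => scaleWeight m 1 x * ‖Q x‖) (Ioi 0) volume)
    {k : ℂ} (hk : k ≠ 0) (C : ℝ) : IntegrableOn (wtψ Q m k C) (Ioi 0) volume := by
  have hδ : 0 < min 1 ‖k‖ := lt_min one_pos (norm_pos_iff.2 hk)
  refine Integrable.mono' (hQ1.const_mul (2 * C ^ 2 * ((min 1 ‖k‖)⁻¹ *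
    (min 1 ‖k‖) ^ (-singExp m) * (1 - Real.log (min 1 ‖k‖))))) (aestronglyMeasurable_wtψ hQ m hk C)
    ((ae_restrict_iff' measurableSet_Ioi).2 (Eventually.of_forall fun x hx => ?_))
  rw [Real.norm_of_nonneg (wtψ_nonneg Q m hk C hx)]
  exact wtψ_le Q m hδ (min_le_left _ _) (min_le_right _ _) C hx

lemma BesselBound.perturbation (h : BesselBound m μ C) {Q : ℝ → ℂ}
    (hQ : LocallyIntegrableOn Q (Ioi 0) volume)
    (hQ1 : IntegrableOn (fun x => scaleWeight m 1 x * ‖Q x‖) (Ioi 0) volume)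
    {k : ℂ} (hk : k ∈ halfPlane) :
    Perturbation (basePot m k) Q (pairU μ k) (pairU' μ k) (pairV μ k) (pairV' μ k)
      (wtU m k C) (wtV m k C) (wtW m k C) (wtψ Q m k C) where
  base := by
    rw [← basePot_congr h.sq_eq]
    exact isBasePair_bessel (by linarith [h.re_nonneg]) hk
  weights :=
    { posU := fun x hx => mul_pos h.pos (wI_pos _ (mul_mem_halfPlane hk hx).2)
      posV := fun x hx => mul_pos (mul_pos h.pos (inv_pos.2 (norm_pos_iff.2 hk.2)))
        (wK_pos _ (mul_mem_halfPlane hk hx).2)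
      leU := fun x hx => h.I_μ _ (mul_mem_halfPlane hk hx)
      leV := fun x hx => by
        have := h.K_μ _ (mul_mem_halfPlane hk hx)
        rw [pairV, wtV, norm_mul, norm_inv]
        calc _ ≤ ‖k‖⁻¹ * (C * wK m (k * x)) := by gcongr
          _ = _ := by ring
      ratio := fun y x hy hyx => by
        have h1 := wI_mul_wK_le m hk hy hyx
        have h2 := h.pos
        unfold wtU wtV
        calc _ = C * (C * ‖k‖⁻¹) * (wI |m.re| (k * y) * wK m (k * x)) := by ring
          _ ≤ C * (C * ‖k‖⁻¹) * (wI |m.re| (k * x) * wK m (k * y)) := by gcongr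
          _ = _ := by ring }
  le_W x hx := mul_le_mul_of_nonneg_left (wI_le_wI (le_abs_self _) (mul_mem_halfPlane hk hx).2)
    h.pos.le
  locQ := hQ
  intψ := integrableOn_wtψ hQ hQ1 hk.2 C
  le_ψ x hx := by
    rw [wtψ, ← wK_mul_wI m k hk.2 hx, wtV, wtW]
    exact le_of_eq (by ring)

end BesselPair

/-! ### The distinguished solutions of the perturbed Bessel equation -/

lemma isEigensolution_iff {Q : ℝ → ℂ} {m k : ℂ} {f : ℝ → ℂ} :
    IsEigensolution Q m k f ↔ ∃ f', IsSol (fun x => basePot m k x + Q x) f f' := by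
  constructor
  · rintro ⟨g, h, hfg, hgh, heq⟩
    refine ⟨g, hfg, hgh.congr (fun x _ => rfl) ?_⟩
    filter_upwards [heq] with x hx
    simp only [basePot]
    linear_combination hx
  · rintro ⟨g, hfg, hgh⟩
    refine ⟨g, _, hfg, hgh, Eventually.of_forall fun x => ?_⟩
    simp only [basePot]
    ring

section Asymptotics

variable {m μ : ℂ} {C : ℝ}

/-- Raising the order costs one inverse power of min(1, ‖z‖) and no logarithm, since Re(μ + 1) > 0
excludes order 0. -/
lemma wK_succ_le (h : BesselBound m μ C) {z : ℂ} (hz : z ∈ halfPlane) :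
    wK (μ + 1) z ≤ wK m z / min 1 ‖z‖ := by
  have hzn : 0 < ‖z‖ := norm_pos_iff.2 hz.2
  have hr : 0 < min 1 ‖z‖ := lt_min one_pos hzn
  have hL := one_le_logFactor m hzn
  have hμ := h.re_nonneg
  have hne : μ + 1 ≠ 0 := fun h0 => by
    have := congrArg Complex.re h0
    simp at this
    linarith
  have hre : |(μ + 1).re| = |m.re| + 1 := by
    rw [Complex.add_re, Complex.one_re, abs_of_nonneg (by linarith), h.re_eq]
  unfold wK
  rw [hre, logFactor, if_neg hne, mul_one, show 1 / 2 - (|m.re| + 1) = 1 / 2 - |m.re| - 1 by ring,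
    Real.rpow_sub_one hr.ne', ← mul_div_assoc]
  exact div_le_div_of_nonneg_right (le_mul_of_one_le_right (by positivity) hL) hr.le

lemma norm_div_mul_le (a : ℂ) {z : ℂ} (hz : z ≠ 0) {b w : ℝ} (hb : b ≤ w) (hb0 : 0 ≤ b) :
    ‖a / z‖ * b ≤ ‖a‖ * (w / min 1 ‖z‖) := by
  have hzn : 0 < ‖z‖ := norm_pos_iff.2 hz
  have hr : 0 < min 1 ‖z‖ := lt_min one_pos hzn
  rw [norm_div]
  calc ‖a‖ / ‖z‖ * b ≤ ‖a‖ / min 1 ‖z‖ * w := by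
        gcongr
        exact min_le_right _ _
    _ = _ := by ring

/-- The constant in the estimates of the derivatives of the fundamental system. -/
def derivConst (μ k : ℂ) : ℝ := ‖k‖ * (1 + ‖μ + 1 / 2‖)

lemma derivConst_nonneg (μ k : ℂ) : 0 ≤ derivConst μ k := by unfold derivConst; positivity

/-- Differentiation costs the same factor, proportional to ‖k‖/min(1, ‖k‖x), for both members of the
fundamental system. The remainders of the derivatives are thereby handled like those of the
functions. -/
lemma BesselBound.norm_pairU'_le (h : BesselBound m μ C) {k : ℂ} (hk : k ∈ halfPlane) {x : ℝ}
    (hx : 0 < x) :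
    ‖pairU' μ k x‖ ≤ derivConst μ k / min 1 (‖k‖ * x) * wtU m k C x := by
  have hz := mul_mem_halfPlane hk hx
  have hC := h.pos
  have hr : 0 < min 1 ‖k * (x : ℂ)‖ := lt_min one_pos (norm_pos_iff.2 hz.2)
  have hw := wI_pos |m.re| hz.2
  have h1 : ‖besselI (μ + 1) (k * x)‖ ≤ wtU m k C x / min 1 ‖k * (x : ℂ)‖ := by
    refine (h.I_succ _ hz).trans ?_
    rw [le_div_iff₀ hr]
    calc _ ≤ C * wI (|m.re| + 1) (k * x) * 1 := by
          have := (wI_pos (|m.re| + 1) hz.2).le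
          gcongr; exact min_le_left _ _
      _ ≤ _ := by
          rw [mul_one]
          exact mul_le_mul_of_nonneg_left (wI_le_wI (by linarith) hz.2) hC.le
  have h2 := norm_div_mul_le (μ + 1 / 2) hz.2 (h.I_μ _ hz) (norm_nonneg _)
  rw [← norm_mul_ofReal k hx, pairU', norm_mul, derivConst]
  calc _ ≤ ‖k‖ * (wtU m k C x / min 1 ‖k * (x : ℂ)‖ +
        ‖μ + 1 / 2‖ * (wtU m k C x / min 1 ‖k * (x : ℂ)‖)) := by
        gcongr
        refine (norm_add_le _ _).trans ?_
        rw [one_mul, norm_mul]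
        exact add_le_add h1 h2
    _ = _ := by ring

lemma BesselBound.norm_pairV'_le (h : BesselBound m μ C) {k : ℂ} (hk : k ∈ halfPlane) {x : ℝ}
    (hx : 0 < x) :
    ‖pairV' μ k x‖ ≤ derivConst μ k / min 1 (‖k‖ * x) * wtV m k C x := by
  have hz := mul_mem_halfPlane hk hx
  have hC := h.pos
  have hr : 0 < min 1 ‖k * (x : ℂ)‖ := lt_min one_pos (norm_pos_iff.2 hz.2)
  have h1 : ‖macdonaldK (μ + 1) (k * x)‖ ≤ C * wK m (k * x) / min 1 ‖k * (x : ℂ)‖ := by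
    refine (h.K_succ _ hz).trans ?_
    rw [mul_div_assoc]
    exact mul_le_mul_of_nonneg_left (wK_succ_le h hz) hC.le
  have h2 := norm_div_mul_le (μ + 1 / 2) hz.2 (h.K_μ _ hz) (norm_nonneg _)
  rw [← norm_mul_ofReal k hx, pairV', pairK', norm_mul, norm_mul, norm_inv, derivConst, wtV]
  calc _ ≤ ‖k‖⁻¹ * (‖k‖ * (C * wK m (k * x) / min 1 ‖k * (x : ℂ)‖ +
        ‖μ + 1 / 2‖ * (C * wK m (k * x) / min 1 ‖k * (x : ℂ)‖))) := by
        gcongr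
        refine (norm_add_le _ _).trans ?_
        rw [norm_mul, norm_mul, norm_neg, norm_one, one_mul]
        exact add_le_add h1 h2
    _ = _ := by ring

lemma eventually_one_le_mul {κ : ℝ} (hκ : 0 < κ) : ∀ᶠ x : ℝ in atTop, 1 ≤ κ * x := by
  filter_upwards [eventually_ge_atTop κ⁻¹] with x hx
  rw [← mul_inv_cancel₀ hκ.ne']
  gcongr

lemma eventually_mul_le_one {κ : ℝ} (hκ : 0 < κ) : ∀ᶠ x : ℝ in 𝓝[>] 0, κ * x ≤ 1 := by
  filter_upwards [Ioc_mem_nhdsGT (inv_pos.2 hκ)] with x hx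
  rw [← mul_inv_cancel₀ hκ.ne']
  gcongr
  exact hx.2

lemma wtU_of_large (m k : ℂ) (C : ℝ) {x : ℝ} (hx : 0 < x) (h : 1 ≤ ‖k‖ * x) :
    wtU m k C x = C * Real.exp (x * k.re) := by
  rw [wtU, wI, norm_mul_ofReal k hx, min_eq_left h, Real.one_rpow, Complex.re_mul_ofReal,
    mul_comm k.re]
  ring

lemma wtV_of_large (m k : ℂ) (C : ℝ) {x : ℝ} (hx : 0 < x) (h : 1 ≤ ‖k‖ * x) :
    wtV m k C x = C * ‖k‖⁻¹ * Real.exp (-x * k.re) := by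
  rw [wtV, wK, norm_mul_ofReal k hx, min_eq_left h, Real.one_rpow, Complex.re_mul_ofReal,
    logFactor, min_eq_left h]
  simp [mul_comm]

lemma wtV_isTheta_atTop (m : ℂ) {k : ℂ} (hk : k ≠ 0) {C : ℝ} (hC : 0 < C) :
    wtV m k C =Θ[atTop] fun x : ℝ => Real.exp (-x * k.re) := by
  have hkn : 0 < ‖k‖ := norm_pos_iff.2 hk
  have : wtV m k C =ᶠ[atTop] fun x : ℝ => C * ‖k‖⁻¹ * Real.exp (-x * k.re) := by
    filter_upwards [eventually_gt_atTop 0, eventually_one_le_mul hkn] with x hx h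
    exact wtV_of_large m k C hx h
  refine this.trans_isTheta ?_
  exact (isTheta_const_mul_left (by positivity)).2 (isTheta_refl _ _)

lemma wtU_of_small (m k : ℂ) (C : ℝ) {x : ℝ} (hx : 0 < x) (h : ‖k‖ * x ≤ 1) :
    wtU m k C x = C * Real.exp (k.re * x) * ‖k‖ ^ (1 / 2 + |m.re|) * x ^ (1 / 2 + |m.re|) := by
  rw [wtU, wI, norm_mul_ofReal k hx, min_eq_right h, Complex.re_mul_ofReal,
    Real.mul_rpow (norm_nonneg k) hx.le]
  ring

lemma wtU_isTheta_zero (m : ℂ) {k : ℂ} (hk : k ∈ halfPlane) {C : ℝ} (hC : 0 < C) :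
    wtU m k C =Θ[𝓝[>] 0] fun x : ℝ => x ^ (1 / 2 + |m.re|) := by
  have hkn : 0 < ‖k‖ := norm_pos_iff.2 hk.2
  constructor
  · refine IsBigO.of_bound (C * Real.exp 1 * ‖k‖ ^ (1 / 2 + |m.re|)) ?_
    filter_upwards [self_mem_nhdsWithin, eventually_mul_le_one hkn] with x hx h
    have hx : (0 : ℝ) < x := hx
    rw [wtU_of_small m k C hx h, Real.norm_of_nonneg (by positivity),
      Real.norm_of_nonneg (by positivity)]
    gcongr
    exact (mul_le_mul_of_nonneg_right (Complex.re_le_norm k) hx.le).trans h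
  · refine IsBigO.of_bound (C * ‖k‖ ^ (1 / 2 + |m.re|))⁻¹ ?_
    filter_upwards [self_mem_nhdsWithin, eventually_mul_le_one hkn] with x hx h
    have hx : (0 : ℝ) < x := hx
    rw [wtU_of_small m k C hx h, Real.norm_of_nonneg (by positivity),
      Real.norm_of_nonneg (by positivity), ← div_eq_inv_mul, le_div_iff₀ (by positivity)]
    have h1 : 1 ≤ Real.exp (k.re * x) := Real.one_le_exp (mul_nonneg hk.1 hx.le)
    calc _ = C * 1 * ‖k‖ ^ (1 / 2 + |m.re|) * x ^ (1 / 2 + |m.re|) := by ring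
      _ ≤ _ := by gcongr

/-- Divided by its leading power, the solution tends to a nonzero multiple of 1/Γ(μ + 1). This lower
bound is what uniqueness at 0 requires. -/
lemma isBigO_pairU {μ : ℂ} (hμ : 0 ≤ μ.re) {k : ℂ} (hk : k ≠ 0) :
    (fun x : ℝ => x ^ (1 / 2 + μ.re)) =O[𝓝[>] 0] pairU μ k := by
  have hk2 : k / 2 ≠ 0 := div_ne_zero hk two_ne_zero
  have hμ1 : -1 < μ.re := by linarith
  have hΓ : Complex.Gamma (μ + 1) ≠ 0 := by simpa using Gamma_add_ne_zero hμ1 0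
  set c := (Real.sqrt Real.pi : ℂ) * (k / 2) ^ (μ + 1 / 2) with hc
  have hc0 : c ≠ 0 := by
    refine mul_ne_zero (Complex.ofReal_ne_zero.2 (by positivity)) ?_
    rw [Complex.cpow_def_of_ne_zero hk2]
    exact Complex.exp_ne_zero _
  have hlim : Tendsto (fun x : ℝ => ‖c * besselE μ ((k * x / 2) ^ 2)‖) (𝓝[>] 0)
      (𝓝 ‖c * (Complex.Gamma (μ + 1))⁻¹‖) := by
    have hcont : Continuous fun x : ℝ => ‖c * besselE μ ((k * x / 2) ^ 2)‖ :=
      (continuous_const.mul ((continuous_besselE hμ1).comp (by fun_prop))).norm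
    have := hcont.tendsto 0
    simp only [Complex.ofReal_zero, mul_zero, zero_div, ne_eq, OfNat.ofNat_ne_zero,
      not_false_eq_true, zero_pow, besselE_zero] at this
    exact this.mono_left nhdsWithin_le_nhds
  have hpos : 0 < ‖c * (Complex.Gamma (μ + 1))⁻¹‖ :=
    norm_pos_iff.2 (mul_ne_zero hc0 (inv_ne_zero hΓ))
  generalize ‖c * (Complex.Gamma (μ + 1))⁻¹‖ = a at hlim hpos
  refine IsBigO.of_bound (a / 2)⁻¹ ?_
  filter_upwards [self_mem_nhdsWithin, hlim.eventually (lt_mem_nhds (half_lt_self hpos))] with x hx h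
  have hx : (0 : ℝ) < x := hx
  have e : pairU μ k x = c * besselE μ ((k * x / 2) ^ 2) * (x : ℂ) ^ (μ + 1 / 2) := by
    rw [pairU, besselI_eq _ (mul_ne_zero hk (Complex.ofReal_ne_zero.2 hx.ne')),
      show k * (x : ℂ) / 2 = k / 2 * x by ring, mul_ofReal_cpow hk2 hx, hc]
    ring
  rw [e, norm_mul, Complex.norm_cpow_eq_rpow_re_of_pos hx, Real.norm_of_nonneg (by positivity),
    ← div_eq_inv_mul, le_div_iff₀ (by positivity), mul_comm]
  have : (μ + 1 / 2).re = 1 / 2 + μ.re := by simp [add_comm]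
  rw [this]
  gcongr

end Asymptotics

section Solutions

variable {m μ : ℂ} {C : ℝ} {Q : ℝ → ℂ}

/-- The prefactor of `u⁰`. -/
def preU (m k : ℂ) : ℂ := (2 / (Real.pi * k)) ^ (1 / 2 : ℂ) * (2 / k) ^ m

/-- The prefactor of `v`. -/
def preV (m k : ℂ) : ℂ := (Real.pi / (2 * k)) ^ (1 / 2 : ℂ) * (k / 2) ^ m

lemma u0_eq (m k : ℂ) : u0 m k = fun x => preU m k * pairU m k x := rfl

lemma w0_eq (h : BesselBound m μ C) {k : ℂ} (hk : k ≠ 0) : w0 m k = fun x => k * pairV μ k x := by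
  ext x
  rw [w0, pairV, mul_inv_cancel_left₀ hk, h.macdonaldK_eq]

/-- The Jost solution. -/
def jostSol (Q : ℝ → ℂ) (m μ k : ℂ) : ℝ → ℂ := solInfty Q (pairU μ k) (pairV μ k) (w0 m k)

/-- The regular solution. -/
def regSol (Q : ℝ → ℂ) (m μ k : ℂ) : ℝ → ℂ := solZero Q (pairU μ k) (pairV μ k) (u0 m k)

lemma BesselBound.repJost (h : BesselBound m μ C) (hQ : LocallyIntegrableOn Q (Ioi 0) volume)
    (hQ1 : IntegrableOn (fun x => scaleWeight m 1 x * ‖Q x‖) (Ioi 0) volume)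
    {k : ℂ} (hk : k ∈ halfPlane) :
    ∃ f' A B, RepInfty (basePot m k) Q (pairU μ k) (pairU' μ k) (pairV μ k) (pairV' μ k)
      (wtU m k C) (wtV m k C) (wtψ Q m k C) (fun x => k * pairV μ k x) (fun x => k * pairV' μ k x)
      (jostSol Q m μ k) f' A B (2 * ‖k‖ * volterraBound (wtψ Q m k C)) := by
  have hP := h.perturbation hQ hQ1 hk
  rw [jostSol, w0_eq h hk.2]
  refine hP.repInfty (norm_nonneg k) (hP.base.solV.const_mul k) fun x hx => ?_
  rw [norm_mul]
  exact mul_le_mul_of_nonneg_left (hP.weights.leV x hx) (norm_nonneg k)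

lemma isClassicalSol_u0 (hm : -1 < m.re) {k : ℂ} (hk : k ∈ halfPlane) :
    IsClassicalSol (basePot m k) (u0 m k) (fun x => preU m k * pairU' m k x) :=
  (isClassicalSol_besselI hm hk).const_mul _

lemma BesselBound.norm_u0_le (h : BesselBound m μ C) {k : ℂ} (hk : k ∈ halfPlane) {x : ℝ}
    (hx : 0 < x) : ‖u0 m k x‖ ≤ ‖preU m k‖ * wtW m k C x := by
  rw [u0_eq, norm_mul]
  exact mul_le_mul_of_nonneg_left (h.I_m _ (mul_mem_halfPlane hk hx)) (norm_nonneg _)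

lemma BesselBound.repReg (h : BesselBound m μ C) (hm : -1 < m.re)
    (hQ : LocallyIntegrableOn Q (Ioi 0) volume)
    (hQ1 : IntegrableOn (fun x => scaleWeight m 1 x * ‖Q x‖) (Ioi 0) volume)
    {k : ℂ} (hk : k ∈ halfPlane) :
    ∃ g' A B, RepZero (basePot m k) Q (pairU μ k) (pairU' μ k) (pairV μ k) (pairV' μ k)
      (wtU m k C) (wtV m k C) (wtW m k C) (wtψ Q m k C) (u0 m k)
      (fun x => preU m k * pairU' m k x)
      (regSol Q m μ k) g' A B (2 * ‖preU m k‖ * volterraBound (wtψ Q m k C)) :=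
  (h.perturbation hQ hQ1 hk).repZero (norm_nonneg _) (isClassicalSol_u0 hm hk)
    fun _ hx => h.norm_u0_le hk hx

/-- Both remainders are bounded by a constant times V times the tail of ∫ψ, and V is comparable to
exp(-x Re k) at ∞. -/
lemma BesselBound.isJostSolution (h : BesselBound m μ C)
    (hQ : LocallyIntegrableOn Q (Ioi 0) volume)
    (hQ1 : IntegrableOn (fun x => scaleWeight m 1 x * ‖Q x‖) (Ioi 0) volume)
    {k : ℂ} (hk : k ∈ halfPlane) : IsJostSolution Q m k (jostSol Q m μ k) := by
  obtain ⟨f', A, B, hf⟩ := h.repJost hQ hQ1 hk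
  have hP := h.perturbation hQ hQ1 hk
  have hkn : 0 < ‖k‖ := norm_pos_iff.2 hk.2
  have hD := derivConst_nonneg μ k
  set K := 2 * ‖k‖ * volterraBound (wtψ Q m k C) with hK
  have hT : Tendsto (fun x => ∫ t in Ioi x, wtψ Q m k C t) atTop (𝓝 0) :=
    tendsto_integral_Ioi_atTop hP.intψ
  have ho : ∀ c : ℝ, (fun x => c * wtV m k C x * ∫ t in Ioi x, wtψ Q m k C t) =o[atTop]
      fun x : ℝ => Real.exp (-x * k.re) := by
    intro c
    have h1 := ((wtV_isTheta_atTop m hk.2 h.pos).isBigO.const_mul_left c).mul_isLittleO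
      ((isLittleO_one_iff ℝ).2 hT)
    simpa using h1
  refine ⟨isEigensolution_iff.2 ⟨f', hf.sol⟩, ?_, ?_⟩
  · refine IsBigO.trans_isLittleO (IsBigO.of_bound 1 ?_) (ho (2 * 1 * K))
    filter_upwards [eventually_gt_atTop 0] with x hx
    have e : jostSol Q m μ k x - w0 m k x = pairV μ k x * A x - pairU μ k x * B x := by
      rw [hf.eq x hx, w0_eq h hk.2]; ring
    rw [e, one_mul]
    refine (hf.norm_combination_le hP hx zero_le_one ?_ ?_).trans (le_abs_self _)
    · rw [one_mul]; exact hP.weights.leV x hx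
    · rw [one_mul]; exact hP.weights.leU x hx
  · refine IsBigO.trans_isLittleO (IsBigO.of_bound 1 ?_) (ho (2 * derivConst μ k * K))
    filter_upwards [eventually_gt_atTop 0, eventually_one_le_mul hkn] with x hx h1
    have e1 : deriv (w0 m k) x = k * pairV' μ k x := by
      rw [w0_eq h hk.2]; exact ((hP.base.solV.const_mul k).1 x hx).deriv
    have e : deriv (jostSol Q m μ k) x - deriv (w0 m k) x =
        pairV' μ k x * A x - pairU' μ k x * B x := by
      rw [(hf.sol.hasDerivAt hx).deriv, e1, hf.eq' x hx]; ring
    have d1 := h.norm_pairU'_le hk hx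
    have d2 := h.norm_pairV'_le hk hx
    rw [min_eq_left h1, div_one] at d1 d2
    rw [e, one_mul]
    exact (hf.norm_combination_le hP hx hD d2 d1).trans (le_abs_self _)

/-- For ‖k‖x ≥ 1 the product UV is constant, and V² is bounded because Re k ≥ 0. -/
lemma BesselBound.isJostSolution_unique (h : BesselBound m μ C)
    (hQ : LocallyIntegrableOn Q (Ioi 0) volume)
    (hQ1 : IntegrableOn (fun x => scaleWeight m 1 x * ‖Q x‖) (Ioi 0) volume)
    {k : ℂ} (hk : k ∈ halfPlane) {f g : ℝ → ℂ} (hf : IsJostSolution Q m k f)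
    (hg : IsJostSolution Q m k g) : EqOn f g (Ioi 0) := by
  obtain ⟨f', hf'⟩ := isEigensolution_iff.1 hf.1
  obtain ⟨g', hg'⟩ := isEigensolution_iff.1 hg.1
  have hP := h.perturbation hQ hQ1 hk
  have hkn : 0 < ‖k‖ := norm_pos_iff.2 hk.2
  have hC := h.pos
  have hTh := (wtV_isTheta_atTop m hk.2 hC).2
  have o1 : (fun x => f x - g x) =o[atTop] wtV m k C := by
    refine ((hf.2.1.sub hg.2.1).congr_left fun x => ?_).trans_isBigO hTh
    ring
  have o2 : (fun x => f' x - g' x) =o[atTop] wtV m k C := by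
    refine ((hf.2.2.sub hg.2.2).congr' ?_ EventuallyEq.rfl).trans_isBigO hTh
    filter_upwards [eventually_gt_atTop 0] with x hx
    rw [(hf'.hasDerivAt hx).deriv, (hg'.hasDerivAt hx).deriv]
    ring
  intro x hx
  refine sub_eq_zero.1 (hP.eq_zero_of_isLittleO_atTop (continuousOn_wtU m hk.2 C)
    (continuousOn_wtV m hk.2 C) (hf'.sub hg') o1 o2 (D := derivConst μ k)
    (M := C * (C * ‖k‖⁻¹) + (C * ‖k‖⁻¹) ^ 2) ?_ ?_ ?_ ?_ hx)
  · filter_upwards [eventually_gt_atTop 0, eventually_one_le_mul hkn] with x hx h1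
    have d1 := h.norm_pairU'_le hk hx
    rwa [min_eq_left h1, div_one] at d1
  · filter_upwards [eventually_gt_atTop 0, eventually_one_le_mul hkn] with x hx h1
    have d1 := h.norm_pairV'_le hk hx
    rwa [min_eq_left h1, div_one] at d1
  · filter_upwards [eventually_gt_atTop 0, eventually_one_le_mul hkn] with x hx h1
    rw [wtU_of_large m k C hx h1, wtV_of_large m k C hx h1]
    have : Real.exp (x * k.re) * Real.exp (-x * k.re) = 1 := by
      rw [← Real.exp_add]; simp
    have : C * Real.exp (x * k.re) * (C * ‖k‖⁻¹ * Real.exp (-x * k.re)) = C * (C * ‖k‖⁻¹) := by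
      linear_combination C * (C * ‖k‖⁻¹) * this
    rw [this]
    exact le_add_of_nonneg_right (by positivity)
  · filter_upwards [eventually_gt_atTop 0, eventually_one_le_mul hkn] with x hx h1
    rw [wtV_of_large m k C hx h1]
    have h2 : Real.exp (-x * k.re) ≤ 1 := Real.exp_le_one_iff.2 (by nlinarith [hk.1])
    have h3 : C * ‖k‖⁻¹ * Real.exp (-x * k.re) ≤ C * ‖k‖⁻¹ * 1 := by gcongr
    have h4 : 0 ≤ C * ‖k‖⁻¹ * Real.exp (-x * k.re) := by positivity
    calc _ ≤ (C * ‖k‖⁻¹ * 1) * (C * ‖k‖⁻¹ * 1) := by gcongr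
      _ = (C * ‖k‖⁻¹) ^ 2 := by ring
      _ ≤ _ := le_add_of_nonneg_left (by positivity)

lemma isBigO_wtU_div (m : ℂ) {k : ℂ} (hk : k ∈ halfPlane) (hC : 0 < C) (D : ℝ) :
    (fun x => D / min 1 (‖k‖ * x) * wtU m k C x) =O[𝓝[>] 0]
      fun x : ℝ => x ^ (-(1 / 2) + |m.re|) := by
  have hkn : 0 < ‖k‖ := norm_pos_iff.2 hk.2
  have h1 : (fun x : ℝ => D / min 1 (‖k‖ * x)) =O[𝓝[>] 0] fun x : ℝ => x⁻¹ := by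
    refine IsBigO.of_bound (‖D‖ * ‖k‖⁻¹) ?_
    filter_upwards [self_mem_nhdsWithin, eventually_mul_le_one hkn] with x hx h
    have hx : (0 : ℝ) < x := hx
    rw [min_eq_right h, norm_div, norm_mul, norm_norm, norm_inv, div_eq_mul_inv, mul_inv, mul_assoc]
  refine (h1.mul (wtU_isTheta_zero m hk hC).1).congr' EventuallyEq.rfl ?_
  filter_upwards [self_mem_nhdsWithin] with x hx
  rw [← Real.rpow_neg_one, ← Real.rpow_add hx]
  congr 1
  ring

/-- The remainders are governed by U, which is comparable to x^{1/2+|Re m|}, times the head of ∫ψ;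
the derivative loses one power of x. -/
lemma BesselBound.isRegularSolution (h : BesselBound m μ C) (hm : -1 < m.re)
    (hQ : LocallyIntegrableOn Q (Ioi 0) volume)
    (hQ1 : IntegrableOn (fun x => scaleWeight m 1 x * ‖Q x‖) (Ioi 0) volume)
    {k : ℂ} (hk : k ∈ halfPlane) : IsRegularSolution Q m k (regSol Q m μ k) := by
  obtain ⟨g', A, B, hg⟩ := h.repReg hm hQ hQ1 hk
  have hP := h.perturbation hQ hQ1 hk
  have hkn : 0 < ‖k‖ := norm_pos_iff.2 hk.2
  have hD := derivConst_nonneg μ k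
  set K := 2 * ‖preU m k‖ * volterraBound (wtψ Q m k C) with hK
  have hT : Tendsto (fun x => ∫ t in Ioc 0 x, wtψ Q m k C t) (𝓝[>] 0) (𝓝 0) :=
    tendsto_integral_Ioc_zero one_pos (hP.intψ.mono_set Ioc_subset_Ioi_self)
  refine ⟨isEigensolution_iff.2 ⟨g', hg.sol⟩, ?_, ?_⟩
  · have ho := ((wtU_isTheta_zero m hk h.pos).1.const_mul_left (2 * 1 * K)).mul_isLittleO
      ((isLittleO_one_iff ℝ).2 hT)
    simp only [mul_one] at ho
    refine IsBigO.trans_isLittleO (IsBigO.of_bound 1 ?_) ho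
    filter_upwards [self_mem_nhdsWithin] with x hx
    have e : regSol Q m μ k x - u0 m k x = pairU μ k x * A x - pairV μ k x * B x := by
      rw [hg.eq x hx]; ring
    rw [e, one_mul]
    have := hg.norm_combination_le hP hx zero_le_one (a := pairU μ k x) (b := pairV μ k x)
      (by rw [one_mul]; exact hP.weights.leU x hx) (by rw [one_mul]; exact hP.weights.leV x hx)
    rw [mul_one] at this
    exact this.trans (le_abs_self _)
  · have ho := ((isBigO_wtU_div m hk h.pos (derivConst μ k)).const_mul_left (2 * K)).mul_isLittleO
      ((isLittleO_one_iff ℝ).2 hT)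
    simp only [mul_one] at ho
    refine IsBigO.trans_isLittleO (IsBigO.of_bound 1 ?_) ho
    filter_upwards [self_mem_nhdsWithin] with x hx
    have hx : (0 : ℝ) < x := hx
    have e1 : deriv (u0 m k) x = preU m k * pairU' m k x := ((isClassicalSol_u0 hm hk).1 x hx).deriv
    have e : deriv (regSol Q m μ k) x - deriv (u0 m k) x =
        pairU' μ k x * A x - pairV' μ k x * B x := by
      rw [(hg.sol.hasDerivAt hx).deriv, e1, hg.eq' x hx]; ring
    have hr : 0 < min 1 (‖k‖ * x) := lt_min one_pos (mul_pos hkn hx)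
    rw [e, one_mul]
    refine (hg.norm_combination_le hP hx (div_nonneg hD hr.le) (h.norm_pairU'_le hk hx)
      (h.norm_pairV'_le hk hx)).trans (le_trans (le_of_eq ?_) (le_abs_self _))
    ring

/-- The coefficient along v of the difference is o(x^{2|Re m|}) by the two asymptotic conditions
together. The coefficient along u is excluded by the lower bound `isBigO_pairU`. -/
lemma BesselBound.isRegularSolution_unique (h : BesselBound m μ C)
    (hQ : LocallyIntegrableOn Q (Ioi 0) volume)
    (hQ1 : IntegrableOn (fun x => scaleWeight m 1 x * ‖Q x‖) (Ioi 0) volume)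
    {k : ℂ} (hk : k ∈ halfPlane) {f g : ℝ → ℂ} (hf : IsRegularSolution Q m k f)
    (hg : IsRegularSolution Q m k g) : EqOn f g (Ioi 0) := by
  obtain ⟨f', hf'⟩ := isEigensolution_iff.1 hf.1
  obtain ⟨g', hg'⟩ := isEigensolution_iff.1 hg.1
  have hP := h.perturbation hQ hQ1 hk
  have hC := h.pos
  have hTh := wtU_isTheta_zero m hk hC
  have o1 : (fun x => f x - g x) =o[𝓝[>] 0] fun x : ℝ => x ^ (1 / 2 + |m.re|) :=
    (hf.2.1.sub hg.2.1).congr_left fun x => by ring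
  have o2 : (fun x => f' x - g' x) =o[𝓝[>] 0] fun x : ℝ => x ^ (-(1 / 2) + |m.re|) := by
    refine (hf.2.2.sub hg.2.2).congr' ?_ EventuallyEq.rfl
    filter_upwards [self_mem_nhdsWithin] with x hx
    rw [(hf'.hasDerivAt hx).deriv, (hg'.hasDerivAt hx).deriv]
    ring
  have Ou : pairU μ k =O[𝓝[>] 0] fun x : ℝ => x ^ (1 / 2 + |m.re|) := by
    refine IsBigO.trans (IsBigO.of_bound 1 ?_) hTh.1
    filter_upwards [self_mem_nhdsWithin] with x hx
    rw [one_mul]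
    exact (hP.weights.leU x hx).trans (le_abs_self _)
  have Ou' : pairU' μ k =O[𝓝[>] 0] fun x : ℝ => x ^ (-(1 / 2) + |m.re|) := by
    refine IsBigO.trans (IsBigO.of_bound 1 ?_) (isBigO_wtU_div m hk hC (derivConst μ k))
    filter_upwards [self_mem_nhdsWithin] with x hx
    rw [one_mul]
    exact (h.norm_pairU'_le hk hx).trans (le_abs_self _)
  have hpow : (fun x : ℝ => x ^ (1 / 2 + |m.re|) * x ^ (-(1 / 2) + |m.re|)) =O[𝓝[>] 0]
      fun _ => (1 : ℝ) := by
    refine IsBigO.of_bound 1 ?_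
    filter_upwards [Ioc_mem_nhdsGT one_pos] with x hx
    rw [← Real.rpow_add hx.1, Real.norm_of_nonneg (Real.rpow_nonneg hx.1.le _), norm_one, mul_one]
    exact Real.rpow_le_one hx.1.le hx.2 (by linarith [abs_nonneg m.re])
  intro x hx
  refine sub_eq_zero.1 (hP.eq_zero_of_isLittleO_zero (continuousOn_wtU m hk.2 C)
    (continuousOn_wtV m hk.2 C) (hf'.sub hg') (o1.trans_isBigO hTh.2) ?_ ?_ hx)
  · have h1 := (o1.mul_isBigO Ou').sub ((Ou.mul_isLittleO o2))
    have h2 := (isLittleO_one_iff ℝ).1 (h1.trans_isBigO hpow)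
    refine h2.congr fun x => ?_
    ring
  · have := isBigO_pairU h.re_nonneg hk.2
    rw [h.re_eq] at this
    exact hTh.1.trans this

end Solutions

/-! ### The Jost function -/

section Jost

variable {m μ : ℂ} {C : ℝ} {Q : ℝ → ℂ}

/-- Principal powers behave multiplicatively here: positive real factors split off, and k/2 stays
away from the cut because Re k ≥ 0 and k ≠ 0. -/
lemma preV_mul_preU (m : ℂ) {k : ℂ} (hk : k ∈ halfPlane) : preV m k * preU m k = k⁻¹ := by
  have hk0 := hk.2
  have hs := mem_slitPlane_of_re_nonneg hk.1 hk.2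
  have hk2 : k / 2 ≠ 0 := div_ne_zero hk0 two_ne_zero
  have h1 : (k / 2) ^ m * (2 / k) ^ m = 1 := by
    have e : 2 / k = (k / 2)⁻¹ := by rw [inv_div]
    rw [e, Complex.inv_cpow _ _ (Complex.mem_slitPlane_iff_arg.1 (half_mem_slitPlane hs)).1]
    refine mul_inv_cancel₀ ?_
    rw [Complex.cpow_def_of_ne_zero hk2]
    exact Complex.exp_ne_zero _
  have h2 : ((Real.pi : ℂ) / (2 * k)) ^ (1 / 2 : ℂ) * (2 / (Real.pi * k)) ^ (1 / 2 : ℂ) = k⁻¹ := by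
    have hp := Real.pi_pos
    have e1 : ((Real.pi : ℂ) / (2 * k)) = k⁻¹ * ((Real.pi / 2 : ℝ) : ℂ) := by
      push_cast; field_simp
    have e2 : (2 / (Real.pi * k) : ℂ) = k⁻¹ * ((2 / Real.pi : ℝ) : ℂ) := by
      push_cast; field_simp
    have e3 : (k⁻¹ : ℂ) ^ (1 / 2 : ℂ) * (k⁻¹ : ℂ) ^ (1 / 2 : ℂ) = k⁻¹ := by
      rw [← Complex.cpow_add _ _ (inv_ne_zero hk0)]; norm_num
    have e4 : ((Real.pi / 2 : ℝ) : ℂ) ^ (1 / 2 : ℂ) * ((2 / Real.pi : ℝ) : ℂ) ^ (1 / 2 : ℂ) = 1 := by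
      rw [ofReal_cpow_half (by positivity), ofReal_cpow_half (by positivity), ← Complex.ofReal_mul,
        ← Real.sqrt_mul (by positivity), show Real.pi / 2 * (2 / Real.pi) = 1 by field_simp]
      simp
    rw [e1, e2, mul_ofReal_cpow (inv_ne_zero hk0) (by positivity),
      mul_ofReal_cpow (inv_ne_zero hk0) (by positivity)]
    linear_combination e3 + k⁻¹ ^ (1 / 2 : ℂ) * k⁻¹ ^ (1 / 2 : ℂ) * e4
  unfold preV preU
  linear_combination h2 + (((Real.pi : ℂ) / (2 * k)) ^ (1 / 2 : ℂ) *
    (2 / (Real.pi * k)) ^ (1 / 2 : ℂ)) * h1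

lemma BesselBound.pairV'_eq (h : BesselBound m μ C) {k : ℂ} (hk : k ∈ halfPlane) {x : ℝ}
    (hx : 0 < x) : pairV' μ k x = pairV' m k x := by
  have h1 := ((isClassicalSol_macdonaldK μ hk).const_mul k⁻¹).1 x hx
  have h2 := ((isClassicalSol_macdonaldK m hk).const_mul k⁻¹).1 x hx
  rw [h.macdonaldK_eq] at h1
  exact h1.unique h2

/-- The Jost solution has coefficient κ = k along v, so the boundary term becomes k times the
product of the prefactors, which is 1. Since K is even in its order, the Wronskian with I_m may be
computed from the pair of order m even when μ = -m. -/
lemma BesselBound.jost_formula (h : BesselBound m μ C) (hm : -1 < m.re)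
    (hQ : LocallyIntegrableOn Q (Ioi 0) volume)
    (hQ1 : IntegrableOn (fun x => scaleWeight m 1 x * ‖Q x‖) (Ioi 0) volume)
    {k : ℂ} (hk : k ∈ halfPlane) :
    IntegrableOn (fun y => u0 m k y * (Q y * jostSol Q m μ k y)) (Ioi 0) volume ∧ ∀ x, 0 < x →
      preV m k * (jostSol Q m μ k x * deriv (regSol Q m μ k) x -
        deriv (jostSol Q m μ k) x * regSol Q m μ k x) =
      1 + preV m k * ∫ y in Ioi 0, u0 m k y * (Q y * jostSol Q m μ k y) := by
  obtain ⟨f', A, B, hf⟩ := h.repJost hQ hQ1 hk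
  obtain ⟨g', A₂, B₂, hg⟩ := h.repReg hm hQ hQ1 hk
  have hP := h.perturbation hQ hQ1 hk
  have hB := volterraBound_pos (wtψ Q m k C)
  obtain ⟨hi, hw⟩ := hP.wronskian_formula (by positivity) (norm_nonneg (preU m k)) hf hg
    (isClassicalSol_u0 hm hk) fun x hx => h.norm_u0_le hk hx
  refine ⟨hi, fun x hx => ?_⟩
  have e1 := (isBasePair_bessel hm hk).wr x hx
  have e2 : pairV μ k x = pairV m k x := by rw [pairV, pairV, h.macdonaldK_eq]
  have e3 := preV_mul_preU m hk
  have e4 : k * k⁻¹ = 1 := mul_inv_cancel₀ hk.2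
  have e5 : k * (preV m k * preU m k) = 1 := by rw [e3, e4]
  rw [(hf.sol.hasDerivAt hx).deriv, (hg.sol.hasDerivAt hx).deriv, hw x hx, h.pairV'_eq hk hx, e2,
    u0_eq]
  linear_combination e5 + k * (preV m k * preU m k) * e1

/-- The factor ‖k‖ is the size of the Jost solution relative to V; it cancels the k⁻¹ in front of
the integral. -/
lemma BesselBound.norm_integrand_le (h : BesselBound m μ C)
    (hQ : LocallyIntegrableOn Q (Ioi 0) volume)
    (hQ1 : IntegrableOn (fun x => scaleWeight m 1 x * ‖Q x‖) (Ioi 0) volume)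
    {k : ℂ} (hk : k ∈ halfPlane) {x : ℝ} (hx : 0 < x) :
    ‖pairU m k x * (Q x * jostSol Q m μ k x)‖ ≤
      ‖k‖ * volterraBound (wtψ Q m k C) * wtψ Q m k C x := by
  obtain ⟨f', A, B, hf⟩ := h.repJost hQ hQ1 hk
  have hP := h.perturbation hQ hQ1 hk
  have hB := volterraBound_pos (wtψ Q m k C)
  have h1 : ‖pairU m k x‖ ≤ wtW m k C x := h.I_m _ (mul_mem_halfPlane hk hx)
  have h2 := hf.le x hx
  have hW := hP.posW hx
  rw [norm_mul, norm_mul]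
  calc _ ≤ wtW m k C x * (‖Q x‖ * (2 * ‖k‖ * volterraBound (wtψ Q m k C) * wtV m k C x)) := by gcongr
    _ = ‖k‖ * volterraBound (wtψ Q m k C) * (2 * (wtV m k C x * wtW m k C x * ‖Q x‖)) := by ring
    _ ≤ _ := by gcongr; exact hP.le_ψ x hx

/-- The Jost function as an explicit integral. -/
def jostIntegral (Q : ℝ → ℂ) (m μ k : ℂ) : ℂ :=
  1 + k⁻¹ * ∫ y in Ioi (0 : ℝ), pairU m k y * (Q y * jostSol Q m μ k y)

lemma jostIntegral_eq (Q : ℝ → ℂ) (m μ : ℂ) {k : ℂ} (hk : k ∈ halfPlane) :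
    1 + preV m k * ∫ y in Ioi (0 : ℝ), u0 m k y * (Q y * jostSol Q m μ k y) =
      jostIntegral Q m μ k := by
  rw [jostIntegral, ← preV_mul_preU m hk, mul_assoc, ← integral_const_mul (preU m k)]
  simp only [u0_eq, mul_assoc]

/-- The majorant depends only on ‖k‖, so real κ suffice. For κ ≥ 1 it is dominated by its value at κ
= 1, and it tends to 0 pointwise. -/
lemma tendsto_integral_wtψ (hQ : LocallyIntegrableOn Q (Ioi 0) volume)
    (hQ1 : IntegrableOn (fun x => scaleWeight m 1 x * ‖Q x‖) (Ioi 0) volume) (C : ℝ) :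
    Tendsto (fun k : ℂ => ∫ x in Ioi (0 : ℝ), wtψ Q m k C x) (Bornology.cobounded ℂ) (𝓝 0) := by
  have hn : Tendsto (fun k : ℂ => ‖k‖) (Bornology.cobounded ℂ) atTop := tendsto_norm_cobounded_atTop
  have key : Tendsto (fun κ : ℝ => ∫ x in Ioi (0 : ℝ), wtψ Q m (κ : ℂ) C x) atTop (𝓝 0) := by
    suffices Tendsto (fun κ : ℝ => ∫ x in Ioi (0 : ℝ), wtψ Q m (κ : ℂ) C x) atTop
        (𝓝 (∫ _ in Ioi (0 : ℝ), (0 : ℝ))) by simpa using this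
    refine tendsto_integral_filter_of_dominated_convergence (fun x => 2 * C ^ 2 *
      ((1 : ℝ)⁻¹ * 1 ^ (-singExp m) * (1 - Real.log 1)) * (scaleWeight m 1 x * ‖Q x‖)) ?_ ?_
      (hQ1.const_mul _) ?_
    · filter_upwards [eventually_gt_atTop 0] with κ hκ
      exact aestronglyMeasurable_wtψ hQ m (Complex.ofReal_ne_zero.2 hκ.ne') C
    · filter_upwards [eventually_ge_atTop 1] with κ hκ
      refine (ae_restrict_iff' measurableSet_Ioi).2 (Eventually.of_forall fun x hx => ?_)
      have hκ0 : 0 < κ := one_pos.trans_le hκ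
      rw [Real.norm_of_nonneg (wtψ_nonneg Q m (Complex.ofReal_ne_zero.2 hκ0.ne') C hx)]
      exact wtψ_le Q m one_pos le_rfl
        (by rwa [Complex.norm_real, Real.norm_of_nonneg hκ0.le]) C hx
    · refine (ae_restrict_iff' measurableSet_Ioi).2 (Eventually.of_forall fun x hx => ?_)
      have := ((tendsto_scaleWeight m hx).mul_const ‖Q x‖).const_mul (2 * C ^ 2)
      rw [zero_mul, mul_zero] at this
      refine this.congr' ?_
      filter_upwards [eventually_gt_atTop 0] with κ hκ
      rw [wtψ, Complex.norm_real, Real.norm_of_nonneg hκ.le]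
  refine (key.comp hn).congr fun k => ?_
  simp only [Function.comp, wtψ, Complex.norm_real, norm_norm]

lemma BesselBound.norm_jostIntegral_sub_one_le (h : BesselBound m μ C)
    (hQ : LocallyIntegrableOn Q (Ioi 0) volume)
    (hQ1 : IntegrableOn (fun x => scaleWeight m 1 x * ‖Q x‖) (Ioi 0) volume)
    {k : ℂ} (hk : k ∈ halfPlane) :
    ‖jostIntegral Q m μ k - 1‖ ≤
      volterraBound (wtψ Q m k C) * ∫ x in Ioi (0 : ℝ), wtψ Q m k C x := by
  have hkn : 0 < ‖k‖ := norm_pos_iff.2 hk.2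
  have h1 := norm_integral_le_mul measurableSet_Ioi (integrableOn_wtψ hQ hQ1 hk.2 C)
    fun x hx => h.norm_integrand_le hQ hQ1 hk hx
  rw [jostIntegral, add_sub_cancel_left, norm_mul, norm_inv]
  calc _ ≤ ‖k‖⁻¹ * (‖k‖ * volterraBound (wtψ Q m k C) * ∫ x in Ioi (0 : ℝ), wtψ Q m k C x) := by
        gcongr
    _ = _ := by field_simp

lemma BesselBound.tendsto_jostIntegral (h : BesselBound m μ C)
    (hQ : LocallyIntegrableOn Q (Ioi 0) volume)
    (hQ1 : IntegrableOn (fun x => scaleWeight m 1 x * ‖Q x‖) (Ioi 0) volume) :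
    Tendsto (jostIntegral Q m μ) (Bornology.cobounded ℂ ⊓ 𝓟 {k : ℂ | 0 ≤ k.re}) (𝓝 1) := by
  have hI := (tendsto_integral_wtψ hQ hQ1 C).mono_left
    (inf_le_left : Bornology.cobounded ℂ ⊓ 𝓟 {k : ℂ | 0 ≤ k.re} ≤ Bornology.cobounded ℂ)
  have hlim := ((Real.continuous_exp.tendsto _).comp (hI.const_mul 2)).mul hI
  rw [mul_zero] at hlim
  rw [tendsto_iff_norm_sub_tendsto_zero]
  refine squeeze_zero' (Eventually.of_forall fun _ => norm_nonneg _) ?_ hlim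
  have h1 : ∀ᶠ k : ℂ in Bornology.cobounded ℂ ⊓ 𝓟 {k : ℂ | 0 ≤ k.re}, 0 < ‖k‖ :=
    (tendsto_norm_cobounded_atTop.mono_left inf_le_left).eventually (eventually_gt_atTop 0)
  have h2 : ∀ᶠ k : ℂ in Bornology.cobounded ℂ ⊓ 𝓟 {k : ℂ | 0 ≤ k.re}, 0 ≤ k.re :=
    (inf_le_right : _ ≤ 𝓟 {k : ℂ | 0 ≤ k.re}) (mem_principal_self _)
  filter_upwards [h1, h2] with k hk1 hk2
  exact h.norm_jostIntegral_sub_one_le hQ hQ1 ⟨hk2, norm_pos_iff.1 hk1⟩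

end Jost

/-! ### Analyticity of the Jost function -/

/-- A dominated integral of holomorphic functions is holomorphic. -/
lemma differentiableAt_integral_of_dominated {S : Set ℝ} (hS : MeasurableSet S) {F : ℂ → ℝ → ℂ}
    {k₀ : ℂ} {b : ℝ → ℝ} {O : Set ℂ} (hO : O ∈ 𝓝 k₀)
    (hmeas : ∀ k ∈ O, AEStronglyMeasurable (F k) (volume.restrict S))
    (hdiff : ∀ x ∈ S, DifferentiableOn ℂ (fun k => F k x) O)
    (hb : ∀ k ∈ O, ∀ x ∈ S, ‖F k x‖ ≤ b x) (hbi : IntegrableOn b S volume) :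
    DifferentiableAt ℂ (fun k => ∫ x in S, F k x) k₀ := by
  obtain ⟨r, hr, hrO⟩ := Metric.mem_nhds_iff.1 hO
  have hr2 : 0 < r / 2 := half_pos hr
  have hd : ∀ x ∈ S, ∀ k ∈ Metric.ball k₀ r, HasDerivAt (fun k => F k x) (deriv (fun k => F k x) k) k :=
    fun x hx k hk => ((hdiff x hx).differentiableAt
      (mem_of_superset (Metric.isOpen_ball.mem_nhds hk) hrO)).hasDerivAt
  have hk₀ : k₀ ∈ Metric.ball k₀ r := Metric.mem_ball_self hr
  -- The derivative is measurable as a pointwise limit of difference quotients along a sequence.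
  have hmeas' : AEStronglyMeasurable (fun x => deriv (fun k => F k x) k₀) (volume.restrict S) := by
    have hseq : Tendsto (fun n : ℕ => ((r / 2 * (1 / ((n : ℝ) + 1)) : ℝ) : ℂ)) atTop (𝓝[≠] 0) := by
      refine tendsto_nhdsWithin_iff.2 ⟨?_, Eventually.of_forall fun n => ?_⟩
      · have h1 := (tendsto_one_div_add_atTop_nhds_zero_nat (𝕜 := ℝ)).const_mul (r / 2)
        rw [mul_zero] at h1
        have h2 := (Complex.continuous_ofReal.tendsto 0).comp h1
        rwa [Complex.ofReal_zero] at h2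
      · exact Complex.ofReal_ne_zero.2 (by positivity)
    have hmem : ∀ n : ℕ, k₀ + ((r / 2 * (1 / ((n : ℝ) + 1)) : ℝ) : ℂ) ∈ Metric.ball k₀ r := by
      intro n
      rw [Metric.mem_ball, dist_self_add_left, Complex.norm_real, Real.norm_of_nonneg (by positivity)]
      have : 1 / ((n : ℝ) + 1) ≤ 1 := by
        rw [div_le_one (by positivity)]
        have : (0 : ℝ) ≤ n := n.cast_nonneg
        linarith
      calc _ ≤ r / 2 * 1 := by gcongr
        _ < r := by linarith
    refine aestronglyMeasurable_of_tendsto_ae atTop (f := fun (n : ℕ) x =>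
      ((r / 2 * (1 / ((n : ℝ) + 1)) : ℝ) : ℂ)⁻¹ •
        (F (k₀ + ((r / 2 * (1 / ((n : ℝ) + 1)) : ℝ) : ℂ)) x - F k₀ x)) (fun n => ?_) ?_
    · exact ((hmeas _ (hrO (hmem n))).sub (hmeas _ (hrO hk₀))).const_smul
        (((r / 2 * (1 / ((n : ℝ) + 1)) : ℝ) : ℂ)⁻¹)
    · refine (ae_restrict_iff' hS).2 (Eventually.of_forall fun x hx => ?_)
      exact (hasDerivAt_iff_tendsto_slope_zero.1 (hd x hx k₀ hk₀)).comp hseq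
  have hsub : ∀ k ∈ Metric.ball k₀ (r / 2), Metric.closedBall k (r / 2) ⊆ Metric.ball k₀ r := by
    intro k hk z hz
    rw [Metric.mem_ball] at hk ⊢
    rw [Metric.mem_closedBall] at hz
    linarith [dist_triangle z k k₀]
  refine (hasDerivAt_integral_of_dominated_loc_of_deriv_le (Metric.ball_mem_nhds k₀ hr2)
    (mem_of_superset (Metric.ball_mem_nhds k₀ hr) fun k hk => hmeas k (hrO hk))
    (Integrable.mono' hbi (hmeas k₀ (hrO hk₀)) ((ae_restrict_iff' hS).2
      (Eventually.of_forall fun x hx => hb k₀ (hrO hk₀) x hx))) (F' := fun k x => deriv (fun k => F k x) k)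
    hmeas' (bound := fun x => b x / (r / 2)) ?_ (hbi.div_const _) ?_).2.differentiableAt
  -- Cauchy's estimate on circles of radius r/2 converts the bound on the functions into one on
  -- their derivatives.
  · refine (ae_restrict_iff' hS).2 (Eventually.of_forall fun x hx k hk => ?_)
    refine Complex.norm_deriv_le_of_forall_mem_sphere_norm_le hr2 ?_ fun z hz =>
      hb z (hrO (hsub k hk (Metric.sphere_subset_closedBall hz))) x hx
    refine DifferentiableOn.diffContOnCl ?_
    exact (hdiff x hx).mono ((Metric.closure_ball_subset_closedBall.trans (hsub k hk)).trans hrO)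
  · refine (ae_restrict_iff' hS).2 (Eventually.of_forall fun x hx k hk => hd x hx k ?_)
    exact Metric.ball_subset_ball (by linarith) hk

section Analytic

variable {m μ : ℂ} {C : ℝ} {Q : ℝ → ℂ}

lemma isOpen_re_pos : IsOpen {k : ℂ | 0 < k.re} := isOpen_lt continuous_const Complex.continuous_re

lemma differentiableOn_pairU {ν : ℂ} (hν : -1 < ν.re) {x : ℝ} (hx : 0 < x) :
    DifferentiableOn ℂ (fun k => pairU ν k x) {k : ℂ | 0 < k.re} := by
  intro k hk
  have hz := mul_mem_halfPlane (mem_halfPlane_of_re_pos hk) hx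
  have h1 := (hasDerivAt_besselI hν (mem_slitPlane_of_re_nonneg hz.1 hz.2)).differentiableAt
  exact (h1.comp k (f := fun k : ℂ => k * (x : ℂ)) (by fun_prop)).differentiableWithinAt

lemma differentiableOn_macdonaldK (ν : ℂ) {x : ℝ} (hx : 0 < x) :
    DifferentiableOn ℂ (fun k : ℂ => macdonaldK ν (k * x)) {k : ℂ | 0 < k.re} := by
  intro k hk
  have hz : 0 < (k * (x : ℂ)).re := re_mul_ofReal_pos hk hx
  have h1 : DifferentiableAt ℂ (macdonaldIntegral ν) (k * x) :=
    (hasDerivAt_macdonaldIntegral ν hz).differentiableAt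
  have h2 : DifferentiableAt ℂ (fun k : ℂ => macdonaldIntegral ν (k * x)) k :=
    h1.comp k (f := fun k : ℂ => k * (x : ℂ)) (by fun_prop)
  refine (h2.differentiableWithinAt).congr (fun l hl => ?_) ?_
  · exact macdonaldK_eq ν (re_mul_ofReal_pos hl hx)
  · exact macdonaldK_eq ν hz

lemma differentiableOn_pairV (ν : ℂ) {x : ℝ} (hx : 0 < x) :
    DifferentiableOn ℂ (fun k => pairV ν k x) {k : ℂ | 0 < k.re} :=
  (differentiableOn_inv.mono fun _ hk => (mem_halfPlane_of_re_pos hk).2).mul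
    (differentiableOn_macdonaldK ν hx)

/-- Near k₀ the modulus of k stays above δ = min(1, ‖k₀‖/2), which bounds ψ and hence the
exponential of its integral; V at x is bounded by continuity. One constant covers all three
quantities. -/
lemma exists_local_bounds
    (hQ1 : IntegrableOn (fun x => scaleWeight m 1 x * ‖Q x‖) (Ioi 0) volume)
    (hQ : LocallyIntegrableOn Q (Ioi 0) volume)
    (hC : 0 ≤ C) {k₀ : ℂ} (hk₀ : 0 < k₀.re) {x : ℝ} (hx : 0 < x) :
    ∃ M : ℝ, 0 ≤ M ∧ ∃ O : Set ℂ, O ⊆ {k : ℂ | 0 < k.re} ∧ IsOpen O ∧ k₀ ∈ O ∧ ∀ k ∈ O,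
      wtV m k C x ≤ M ∧ ‖k‖ * volterraBound (wtψ Q m k C) ≤ M ∧
      ∀ y, 0 < y → wtψ Q m k C y ≤ M * (scaleWeight m 1 y * ‖Q y‖) := by
  have hk0 := (mem_halfPlane_of_re_pos hk₀).2
  have hkn : 0 < ‖k₀‖ := norm_pos_iff.2 hk0
  set δ := min 1 (‖k₀‖ / 2) with hδd
  have hδ : 0 < δ := lt_min one_pos (half_pos hkn)
  have hδ1 : δ ≤ 1 := min_le_left _ _
  set c := 2 * C ^ 2 * (δ⁻¹ * δ ^ (-singExp m) * (1 - Real.log δ)) with hc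
  have hc0 : 0 ≤ c := by
    have := Real.log_nonpos hδ.le hδ1
    have : 0 ≤ 1 - Real.log δ := by linarith
    positivity
  set I := ∫ y in Ioi (0 : ℝ), scaleWeight m 1 y * ‖Q y‖ with hI
  have hV0 : 0 ≤ wtV m k₀ C x := by
    have := (wK_pos m (mul_mem_halfPlane (mem_halfPlane_of_re_pos hk₀) hx).2).le
    unfold wtV
    positivity
  have hcont : ContinuousAt (fun k => wtV m k C x) k₀ := by
    unfold wtV
    refine ContinuousAt.mul (continuousAt_const.mul
      (continuousAt_id.norm.inv₀ (norm_ne_zero_iff.2 hk0))) ?_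
    have h1 : ContinuousAt (wK m) (k₀ * x) := (continuousOn_wK m).continuousAt
      (isOpen_compl_singleton.mem_nhds (mul_ne_zero hk0 (Complex.ofReal_ne_zero.2 hx.ne')))
    exact ContinuousAt.comp (f := fun k : ℂ => k * (x : ℂ)) h1 (by fun_prop)
  have hev : ∀ᶠ k in 𝓝 k₀, 0 < k.re ∧ wtV m k C x < wtV m k₀ C x + 1 ∧ ‖k‖ < ‖k₀‖ + 1 ∧
      ‖k₀‖ / 2 < ‖k‖ := by
    refine (isOpen_re_pos.eventually_mem hk₀).and ((hcont.eventually (gt_mem_nhds (lt_add_one _))).and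
      ((continuous_norm.continuousAt.eventually (gt_mem_nhds (lt_add_one _))).and
      (continuous_norm.continuousAt.eventually (lt_mem_nhds (half_lt_self hkn)))))
  obtain ⟨O, hOsub, hO, hmem⟩ := eventually_nhds_iff.1 hev
  refine ⟨(wtV m k₀ C x + 1) + (‖k₀‖ + 1) * Real.exp (2 * (c * I)) + c, by positivity, O,
    fun k hk => (hOsub k hk).1, hO, hmem, fun k hk => ?_⟩
  obtain ⟨k1, k2, k3, k4⟩ := hOsub k hk
  have hkδ : δ ≤ ‖k‖ := (min_le_right _ _).trans k4.le
  have hk0' := (mem_halfPlane_of_re_pos k1).2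
  have e0 : 0 ≤ (‖k₀‖ + 1) * Real.exp (2 * (c * I)) := by positivity
  have hψ : ∀ y, 0 < y → wtψ Q m k C y ≤ c * (scaleWeight m 1 y * ‖Q y‖) :=
    fun y hy => wtψ_le Q m hδ hδ1 hkδ C hy
  refine ⟨by linarith, ?_, fun y hy => (hψ y hy).trans ?_⟩
  · have hint : ∫ y in Ioi (0 : ℝ), wtψ Q m k C y ≤ c * I := by
      rw [hI, ← integral_const_mul]
      exact setIntegral_mono_on (integrableOn_wtψ hQ hQ1 hk0' C) (hQ1.const_mul c)
        measurableSet_Ioi hψ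
    have hB : volterraBound (wtψ Q m k C) ≤ Real.exp (2 * (c * I)) := by
      unfold volterraBound
      gcongr
    calc _ ≤ (‖k₀‖ + 1) * Real.exp (2 * (c * I)) := by
          have := (volterraBound_pos (wtψ Q m k C)).le
          gcongr
      _ ≤ _ := by linarith
  · have := scaleWeight_nonneg m one_pos hy
    exact mul_le_mul_of_nonneg_right (by linarith) (by positivity)

/-- The iterates whose sum is the Jost solution. -/
def jostIter (Q : ℝ → ℂ) (m μ k : ℂ) : ℕ → ℝ → ℂ :=
  picardIter (fun x => Ioi x)
    (fun x y => (pairV μ k x * pairU μ k y - pairU μ k x * pairV μ k y) * Q y) (w0 m k)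

lemma BesselBound.norm_w0_le (h : BesselBound m μ C)
    (hQ : LocallyIntegrableOn Q (Ioi 0) volume)
    (hQ1 : IntegrableOn (fun x => scaleWeight m 1 x * ‖Q x‖) (Ioi 0) volume)
    {k : ℂ} (hk : k ∈ halfPlane) {x : ℝ} (hx : 0 < x) : ‖w0 m k x‖ ≤ ‖k‖ * wtV m k C x := by
  rw [w0_eq h hk.2, norm_mul]
  exact mul_le_mul_of_nonneg_left ((h.perturbation hQ hQ1 hk).weights.leV x hx) (norm_nonneg k)

lemma BesselBound.norm_jostIter_le (h : BesselBound m μ C)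
    (hQ : LocallyIntegrableOn Q (Ioi 0) volume)
    (hQ1 : IntegrableOn (fun x => scaleWeight m 1 x * ‖Q x‖) (Ioi 0) volume)
    {k : ℂ} (hk : k ∈ halfPlane) (n : ℕ) {x : ℝ} (hx : 0 < x) :
    ‖jostIter Q m μ k n x‖ ≤
      ‖k‖ * volterraBound (wtψ Q m k C) * wtV m k C x * (1 / 2) ^ n := by
  have hP := h.perturbation hQ hQ1 hk
  obtain ⟨E, hE⟩ := hP.weightInfty
  exact hE.norm_picardIter_le_bound (norm_nonneg k) (fun x hx => (hP.weights.posV x hx).le)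
    hP.dataInfty.kernel' (fun x hx => h.norm_w0_le hQ hQ1 hk hx) n x hx

lemma BesselBound.jostIter_meas (h : BesselBound m μ C)
    (hQ : LocallyIntegrableOn Q (Ioi 0) volume)
    (hQ1 : IntegrableOn (fun x => scaleWeight m 1 x * ‖Q x‖) (Ioi 0) volume)
    {k : ℂ} (hk : k ∈ halfPlane) (n : ℕ) :
    AEStronglyMeasurable (jostIter Q m μ k n) (volume.restrict (Ioi 0)) := by
  have hP := h.perturbation hQ hQ1 hk
  obtain ⟨E, hE⟩ := hP.weightInfty
  refine hP.dataInfty.picardIter_meas hE (norm_nonneg k) ?_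
    (fun x hx => h.norm_w0_le hQ hQ1 hk hx) n
  rw [w0_eq h hk.2]
  exact continuousOn_const.mul (continuousOn_of_hasDerivAt hP.base.solV.1)

/-- Induction on n. The integrand is dominated with three factors M, one each for the prefactor of
the iterate, the weight at x and the majorant ψ. -/
lemma BesselBound.differentiableOn_jostIter (h : BesselBound m μ C)
    (hQ : LocallyIntegrableOn Q (Ioi 0) volume)
    (hQ1 : IntegrableOn (fun x => scaleWeight m 1 x * ‖Q x‖) (Ioi 0) volume) (n : ℕ) :
    ∀ x, 0 < x → DifferentiableOn ℂ (fun k => jostIter Q m μ k n x) {k : ℂ | 0 < k.re} := by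
  have hμ : -1 < μ.re := by linarith [h.re_nonneg]
  induction n with
  | zero => exact fun x hx => differentiableOn_macdonaldK m hx
  | succ n ih =>
    intro x hx k₀ hk₀
    obtain ⟨M, hM, O, hOsub, hO, hmem, hb⟩ := exists_local_bounds hQ1 hQ h.pos.le hk₀ hx
    refine DifferentiableAt.differentiableWithinAt ?_
    refine differentiableAt_integral_of_dominated measurableSet_Ioi (hO.mem_nhds hmem)
      (b := fun y => M * (M * (M * (scaleWeight m 1 y * ‖Q y‖))))
      (F := fun k y => (pairV μ k x * pairU μ k y - pairU μ k x * pairV μ k y) * Q y *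
        jostIter Q m μ k n y) (fun k hk => ?_) (fun y hy => ?_) (fun k hk y hy => ?_) ?_
    · have hk' := mem_halfPlane_of_re_pos (hOsub hk)
      have hP := h.perturbation hQ hQ1 hk'
      have hU := continuousOn_of_hasDerivAt hP.base.solU.1
      have hV := continuousOn_of_hasDerivAt hP.base.solV.1
      refine ((AEStronglyMeasurable.mul (ContinuousOn.aestronglyMeasurable ?_ measurableSet_Ioi)
        hQ.aestronglyMeasurable).mul (h.jostIter_meas hQ hQ1 hk' n)).mono_measure
        (Measure.restrict_mono (Ioi_subset_Ioi hx.le) le_rfl)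
      exact (continuousOn_const.mul hU).sub (continuousOn_const.mul hV)
    · have hy0 : 0 < y := hx.trans hy
      exact (((((differentiableOn_pairV μ hx).mul (differentiableOn_pairU hμ hy0)).sub
        ((differentiableOn_pairU hμ hx).mul (differentiableOn_pairV μ hy0))).mul_const _).mul
        (ih y hy0)).mono hOsub
    · have hy0 : 0 < y := hx.trans hy
      have hk' := mem_halfPlane_of_re_pos (hOsub hk)
      have hP := h.perturbation hQ hQ1 hk'
      obtain ⟨b1, b2, b3⟩ := hb k hk
      have h1 := h.norm_jostIter_le hQ hQ1 hk' n hy0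
      have h2 := hP.dataInfty.kernel' x hx y hy
      have hVy := (hP.weights.posV y hy0).le
      have hVx := (hP.weights.posV x hx).le
      have hψ := hP.nonneg hy0
      have hB := (volterraBound_pos (wtψ Q m k C)).le
      have h3 : ((1 : ℝ) / 2) ^ n ≤ 1 := pow_le_one₀ (by norm_num) (by norm_num)
      have h4 : 0 ≤ ‖(pairV μ k x * pairU μ k y - pairU μ k x * pairV μ k y) * Q y‖ := norm_nonneg _
      rw [norm_mul]
      generalize ‖(pairV μ k x * pairU μ k y - pairU μ k x * pairV μ k y) * Q y‖ = N at h2 h4 ⊢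
      calc _ ≤ N * (‖k‖ * volterraBound (wtψ Q m k C) * wtV m k C y * 1) := by
            refine mul_le_mul_of_nonneg_left (h1.trans ?_) h4
            gcongr
        _ = ‖k‖ * volterraBound (wtψ Q m k C) * (N * wtV m k C y) := by ring
        _ ≤ M * (wtV m k C x * wtψ Q m k C y) :=
            mul_le_mul b2 h2 (mul_nonneg h4 hVy) hM
        _ ≤ _ := mul_le_mul_of_nonneg_left (mul_le_mul b1 (b3 y hy0) hψ hM) hM
    · exact ((((hQ1.mono_set (Ioi_subset_Ioi hx.le)).const_mul M).const_mul M).const_mul M)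

/-- The iterates are bounded by M² 2⁻ⁿ near k₀, so Weierstrass's theorem applies to the Neumann
series. -/
lemma BesselBound.differentiableOn_jostSol (h : BesselBound m μ C)
    (hQ : LocallyIntegrableOn Q (Ioi 0) volume)
    (hQ1 : IntegrableOn (fun x => scaleWeight m 1 x * ‖Q x‖) (Ioi 0) volume) {x : ℝ} (hx : 0 < x) :
    DifferentiableOn ℂ (fun k => jostSol Q m μ k x) {k : ℂ | 0 < k.re} := by
  intro k₀ hk₀
  obtain ⟨M, hM, O, hOsub, hO, hmem, hb⟩ := exists_local_bounds hQ1 hQ h.pos.le hk₀ hx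
  have key : DifferentiableOn ℂ (fun k => ∑' n, jostIter Q m μ k n x) O := by
    refine Complex.differentiableOn_tsum_of_summable_norm (u := fun n => M * M * (1 / 2) ^ n)
      (summable_geometric_two.mul_left _)
      (fun n => (h.differentiableOn_jostIter hQ hQ1 n x hx).mono hOsub) hO fun n k hk => ?_
    have hk' := mem_halfPlane_of_re_pos (hOsub hk)
    obtain ⟨b1, b2, _⟩ := hb k hk
    have hV := ((h.perturbation hQ hQ1 hk').weights.posV x hx).le
    refine (h.norm_jostIter_le hQ hQ1 hk' n hx).trans ?_
    exact mul_le_mul_of_nonneg_right (mul_le_mul b2 b1 hV hM) (by positivity)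
  exact (key.differentiableAt (hO.mem_nhds hmem)).differentiableWithinAt

lemma BesselBound.differentiableOn_jostIntegral (h : BesselBound m μ C) (hm : -1 < m.re)
    (hQ : LocallyIntegrableOn Q (Ioi 0) volume)
    (hQ1 : IntegrableOn (fun x => scaleWeight m 1 x * ‖Q x‖) (Ioi 0) volume) :
    DifferentiableOn ℂ (jostIntegral Q m μ) {k : ℂ | 0 < k.re} := by
  refine (differentiableOn_const 1).add (DifferentiableOn.mul
    (differentiableOn_inv.mono fun k hk => (mem_halfPlane_of_re_pos hk).2) ?_)
  intro k₀ hk₀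
  obtain ⟨M, hM, O, hOsub, hO, hmem, hb⟩ := exists_local_bounds hQ1 hQ h.pos.le hk₀ one_pos
  refine DifferentiableAt.differentiableWithinAt ?_
  refine differentiableAt_integral_of_dominated measurableSet_Ioi (hO.mem_nhds hmem)
    (b := fun y => M * (M * (scaleWeight m 1 y * ‖Q y‖)))
    (F := fun k y => pairU m k y * (Q y * jostSol Q m μ k y))
    (fun k hk => ?_) (fun y hy => ?_) (fun k hk y hy => ?_) ((hQ1.const_mul M).const_mul M)
  · have hk' := mem_halfPlane_of_re_pos (hOsub hk)
    obtain ⟨f', A, B, hf⟩ := h.repJost hQ hQ1 hk'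
    exact (locallyIntegrableOn_continuousOn_mul
      (continuousOn_of_hasDerivAt (isClassicalSol_besselI hm hk').1)
      (locallyIntegrableOn_mul_continuousOn hQ hf.sol.1.continuousOn)).aestronglyMeasurable
  · exact ((differentiableOn_pairU hm hy).mul
      ((h.differentiableOn_jostSol hQ hQ1 hy).const_mul _)).mono hOsub
  · have hk' := mem_halfPlane_of_re_pos (hOsub hk)
    obtain ⟨_, b2, b3⟩ := hb k hk
    exact (h.norm_integrand_le hQ hQ1 hk' hy).trans
      (mul_le_mul b2 (b3 y hy) ((h.perturbation hQ hQ1 hk').nonneg hy) hM)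

lemma tendsto_ofReal_cobounded_re :
    Tendsto (fun r : ℝ => (r : ℂ)) atTop (Bornology.cobounded ℂ ⊓ 𝓟 {k : ℂ | 0 ≤ k.re}) := by
  refine tendsto_inf.2 ⟨?_, tendsto_principal.2 ?_⟩
  · rw [← tendsto_norm_atTop_iff_cobounded]
    exact tendsto_abs_atTop_atTop.congr fun r => (Complex.norm_real r).symm
  · filter_upwards [eventually_ge_atTop 0] with r hr
    simpa using hr

/-- The zeros of the Jost function are isolated. -/
lemma BesselBound.eventually_jostIntegral_ne_zero (h : BesselBound m μ C) (hm : -1 < m.re)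
    (hQ : LocallyIntegrableOn Q (Ioi 0) volume)
    (hQ1 : IntegrableOn (fun x => scaleWeight m 1 x * ‖Q x‖) (Ioi 0) volume) {k₀ : ℂ}
    (hk₀ : 0 < k₀.re) : ∀ᶠ k in 𝓝[≠] k₀, jostIntegral Q m μ k ≠ 0 := by
  have han : AnalyticOnNhd ℂ (jostIntegral Q m μ) {k : ℂ | 0 < k.re} :=
    (h.differentiableOn_jostIntegral hm hQ hQ1).analyticOnNhd isOpen_re_pos
  -- If the zeros accumulated at k₀, the identity theorem would make the function vanish on the
  -- whole half-plane, contradicting the limit 1 along the positive axis.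
  by_contra hne
  have hfr : ∃ᶠ k in 𝓝[≠] k₀, jostIntegral Q m μ k = 0 := hne
  have hz := han.eqOn_zero_of_preconnected_of_frequently_eq_zero
    (convex_halfSpace_re_gt 0).isPreconnected hk₀ hfr
  have hlim := (h.tendsto_jostIntegral hQ hQ1).comp tendsto_ofReal_cobounded_re
  have h0 : Tendsto (jostIntegral Q m μ ∘ fun r : ℝ => (r : ℂ)) atTop (𝓝 0) := by
    refine tendsto_const_nhds.congr' ?_
    filter_upwards [eventually_gt_atTop 0] with r hr
    exact (hz (show 0 < (r : ℂ).re by simpa using hr)).symm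
  exact one_ne_zero (tendsto_nhds_unique hlim h0)

end Analytic

/-! ### The distinguished solutions and the Jost function of the statement -/

section Main

variable {m μ : ℂ} {C : ℝ} {Q : ℝ → ℂ}

lemma BesselBound.uSol_spec (h : BesselBound m μ C) (hm : -1 < m.re)
    (hQ : LocallyIntegrableOn Q (Ioi 0) volume)
    (hQ1 : IntegrableOn (fun x => scaleWeight m 1 x * ‖Q x‖) (Ioi 0) volume)
    {k : ℂ} (hk : k ∈ halfPlane) : IsRegularSolution Q m k (uSol Q m k) :=
  Classical.epsilon_spec ⟨_, h.isRegularSolution hm hQ hQ1 hk⟩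

lemma BesselBound.wSol_spec (h : BesselBound m μ C)
    (hQ : LocallyIntegrableOn Q (Ioi 0) volume)
    (hQ1 : IntegrableOn (fun x => scaleWeight m 1 x * ‖Q x‖) (Ioi 0) volume)
    {k : ℂ} (hk : k ∈ halfPlane) : IsJostSolution Q m k (wSol Q m k) :=
  Classical.epsilon_spec ⟨_, h.isJostSolution hQ hQ1 hk⟩

lemma deriv_eq_of_eqOn {f g : ℝ → ℂ} (h : EqOn f g (Ioi 0)) {x : ℝ} (hx : 0 < x) :
    deriv f x = deriv g x :=
  (h.eventuallyEq_of_mem (Ioi_mem_nhds hx)).deriv_eq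

lemma vSol_eq (Q : ℝ → ℂ) (m k : ℂ) : vSol Q m k = fun x => preV m k * wSol Q m k x := rfl

/-- By uniqueness the chosen solutions agree on the half-line with the constructed ones, and so do
their derivatives there; the formula for the constructed solutions then applies at every x. -/
lemma BesselBound.wronskian_eq (h : BesselBound m μ C) (hm : -1 < m.re)
    (hQ : LocallyIntegrableOn Q (Ioi 0) volume)
    (hQ1 : IntegrableOn (fun x => scaleWeight m 1 x * ‖Q x‖) (Ioi 0) volume)
    {k : ℂ} (hk : k ∈ halfPlane) {x : ℝ} (hx : 0 < x) :
    wronskian (vSol Q m k) (uSol Q m k) x = jostIntegral Q m μ k := by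
  have hu : EqOn (uSol Q m k) (regSol Q m μ k) (Ioi 0) := h.isRegularSolution_unique hQ hQ1 hk
    (h.uSol_spec hm hQ hQ1 hk) (h.isRegularSolution hm hQ hQ1 hk)
  have hw : EqOn (wSol Q m k) (jostSol Q m μ k) (Ioi 0) := h.isJostSolution_unique hQ hQ1 hk
    (h.wSol_spec hQ hQ1 hk) (h.isJostSolution hQ hQ1 hk)
  have hv : deriv (vSol Q m k) x = preV m k * deriv (jostSol Q m μ k) x := by
    rw [vSol_eq, deriv_const_mul_field, deriv_eq_of_eqOn hw hx]
  have hv' : vSol Q m k x = preV m k * jostSol Q m μ k x := by rw [vSol_eq, ← hw hx]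
  rw [wronskian, hv, deriv_eq_of_eqOn hu hx, hv', hu hx, ← jostIntegral_eq Q m μ hk,
    ← (h.jost_formula hm hQ hQ1 hk).2 x hx]
  ring

lemma BesselBound.jostFunction_eq (h : BesselBound m μ C) (hm : -1 < m.re)
    (hQ : LocallyIntegrableOn Q (Ioi 0) volume)
    (hQ1 : IntegrableOn (fun x => scaleWeight m 1 x * ‖Q x‖) (Ioi 0) volume)
    {k : ℂ} (hk : k ∈ halfPlane) : jostFunction Q m k = jostIntegral Q m μ k :=
  h.wronskian_eq hm hQ hQ1 hk one_pos

lemma BesselBound.integrand_eq (h : BesselBound m μ C)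
    (hQ : LocallyIntegrableOn Q (Ioi 0) volume)
    (hQ1 : IntegrableOn (fun x => scaleWeight m 1 x * ‖Q x‖) (Ioi 0) volume)
    {k : ℂ} (hk : k ∈ halfPlane) :
    EqOn (fun x => preV m k * (u0 m k x * (Q x * jostSol Q m μ k x)))
      (fun x => u0 m k x * (Q x * vSol Q m k x)) (Ioi 0) := by
  intro x hx
  have hw : EqOn (wSol Q m k) (jostSol Q m μ k) (Ioi 0) := h.isJostSolution_unique hQ hQ1 hk
    (h.wSol_spec hQ hQ1 hk) (h.isJostSolution hQ hQ1 hk)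
  simp only [vSol_eq]
  rw [hw hx]
  ring

lemma BesselBound.eventually_jostFunction_ne_zero (h : BesselBound m μ C) (hm : -1 < m.re)
    (hQ : LocallyIntegrableOn Q (Ioi 0) volume)
    (hQ1 : IntegrableOn (fun x => scaleWeight m 1 x * ‖Q x‖) (Ioi 0) volume) {k₀ : ℂ}
    (hk₀ : 0 < k₀.re) : ∀ᶠ k in 𝓝[≠] k₀, jostFunction Q m k ≠ 0 := by
  filter_upwards [h.eventually_jostIntegral_ne_zero hm hQ hQ1 hk₀,
    nhdsWithin_le_nhds (isOpen_re_pos.mem_nhds hk₀)] with k hk hre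
  rwa [h.jostFunction_eq hm hQ hQ1 (mem_halfPlane_of_re_pos hre)]

lemma BesselBound.tendsto_jostFunction (h : BesselBound m μ C) (hm : -1 < m.re)
    (hQ : LocallyIntegrableOn Q (Ioi 0) volume)
    (hQ1 : IntegrableOn (fun x => scaleWeight m 1 x * ‖Q x‖) (Ioi 0) volume) :
    Tendsto (jostFunction Q m) (Bornology.cobounded ℂ ⊓ 𝓟 {k : ℂ | 0 ≤ k.re}) (𝓝 1) := by
  refine (h.tendsto_jostIntegral hQ hQ1).congr' ?_
  have h1 : ∀ᶠ k : ℂ in Bornology.cobounded ℂ ⊓ 𝓟 {k : ℂ | 0 ≤ k.re}, 0 < ‖k‖ :=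
    (tendsto_norm_cobounded_atTop.mono_left inf_le_left).eventually (eventually_gt_atTop 0)
  have h2 : ∀ᶠ k : ℂ in Bornology.cobounded ℂ ⊓ 𝓟 {k : ℂ | 0 ≤ k.re}, 0 ≤ k.re :=
    (inf_le_right : _ ≤ 𝓟 {k : ℂ | 0 ≤ k.re}) (mem_principal_self _)
  filter_upwards [h1, h2] with k hk1 hk2
  exact (h.jostFunction_eq hm hQ hQ1 ⟨hk2, norm_pos_iff.1 hk1⟩).symm

end Main

end PerturbedBessel

end

theorem mainTheorem8 (Q : ℝ → ℂ) (m : ℂ) (hm : -1 < m.re)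
    (hQinfty : PerturbedBessel.MemLInfty 0 Q)
    (hQzero : m ≠ 0 → PerturbedBessel.MemLZero (max 0 (-2 * m.re)) Q)
    (hQzeroLog : m = 0 → PerturbedBessel.MemLZeroLog 0 2 Q) :
    -- for `Re k ≥ 0`, `k ≠ 0`, the solutions `u_m`, `w_m` and the Jost function are well defined
    -- and the Jost function is given by `1 + ⟨u⁰_m | Q v_m⟩`
    (∀ k : ℂ, 0 ≤ k.re → k ≠ 0 →
      (PerturbedBessel.IsRegularSolution Q m k (PerturbedBessel.uSol Q m k) ∧
        ∀ g : ℝ → ℂ, PerturbedBessel.IsRegularSolution Q m k g →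
          Set.EqOn g (PerturbedBessel.uSol Q m k) (Set.Ioi 0)) ∧
      (PerturbedBessel.IsJostSolution Q m k (PerturbedBessel.wSol Q m k) ∧
        ∀ g : ℝ → ℂ, PerturbedBessel.IsJostSolution Q m k g →
          Set.EqOn g (PerturbedBessel.wSol Q m k) (Set.Ioi 0)) ∧
      (∀ x : ℝ, 0 < x →
        PerturbedBessel.wronskian (PerturbedBessel.vSol Q m k) (PerturbedBessel.uSol Q m k) x =
          PerturbedBessel.jostFunction Q m k) ∧
      MeasureTheory.IntegrableOn
        (fun x : ℝ => PerturbedBessel.u0 m k x * (Q x * PerturbedBessel.vSol Q m k x))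
        (Set.Ioi 0) MeasureTheory.volume ∧
      PerturbedBessel.jostFunction Q m k =
        1 + ∫ x in Set.Ioi (0 : ℝ),
          PerturbedBessel.u0 m k x * (Q x * PerturbedBessel.vSol Q m k x)) ∧
    -- `𝓦_m(k) → 1` as `|k| → ∞` in `Re k ≥ 0`
    Filter.Tendsto (PerturbedBessel.jostFunction Q m)
      (Bornology.cobounded ℂ ⊓ Filter.principal {k : ℂ | 0 ≤ k.re}) (nhds 1) ∧
    -- the zeros in `Re k > 0` form a discrete set, without accumulation point in `Re k > 0`
    IsDiscrete {k : ℂ | 0 < k.re ∧ PerturbedBessel.jostFunction Q m k = 0} ∧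
    (∀ k₀ : ℂ, 0 < k₀.re →
      ∀ᶠ k in nhdsWithin k₀ {k₀}ᶜ, PerturbedBessel.jostFunction Q m k ≠ 0) := by
  have hQ : LocallyIntegrableOn Q (Ioi 0) volume := hQinfty.1
  have hQ1 := PerturbedBessel.integrableOn_scaleWeight hQinfty hQzero hQzeroLog
  obtain ⟨μ, C, h⟩ := PerturbedBessel.exists_besselBound hm
  refine ⟨fun k hk hk0 => ?_, h.tendsto_jostFunction hm hQ hQ1, ?_,
    fun k₀ hk₀ => h.eventually_jostFunction_ne_zero hm hQ hQ1 hk₀⟩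
  · have hk' : k ∈ PerturbedBessel.halfPlane := ⟨hk, hk0⟩
    have hu := h.uSol_spec hm hQ hQ1 hk'
    have hw := h.wSol_spec hQ hQ1 hk'
    have heq := h.integrand_eq hQ hQ1 hk'
    refine ⟨⟨hu, fun g hg => h.isRegularSolution_unique hQ hQ1 hk' hg hu⟩,
      ⟨hw, fun g hg => h.isJostSolution_unique hQ hQ1 hk' hg hw⟩, fun x hx => ?_, ?_, ?_⟩
    · rw [h.wronskian_eq hm hQ hQ1 hk' hx, h.jostFunction_eq hm hQ hQ1 hk']
    · exact IntegrableOn.congr_fun ((h.jost_formula hm hQ hQ1 hk').1.const_mul _) heq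
        measurableSet_Ioi
    · rw [← setIntegral_congr_fun measurableSet_Ioi heq, integral_const_mul,
        PerturbedBessel.jostIntegral_eq Q m μ hk', h.jostFunction_eq hm hQ hQ1 hk']
  · rw [isDiscrete_iff_nhdsNE]
    intro k₀ hk₀
    have h1 := h.eventually_jostFunction_ne_zero hm hQ hQ1 hk₀.1
    rw [← Filter.empty_mem_iff_bot]
    filter_upwards [mem_inf_of_left h1, mem_inf_of_right (mem_principal_self _)] with k hk1 hk2
    exact hk1 hk2.2
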